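/- Let $\Phi$ be a smooth real function on an open set $V\subset\mathbb C^n$ that is a potential of a Kähler metric, i.e. the Hermitian matrix $H=(h_{i\bar j})$, $h_{i\bar j}=\partial_i\bar\partial_j\Phi$, is positive definite at every point of $V$. For $f_1,f_2\in C^\infty(V)$ the non-normalized star product is the formal power series in $\hbar$ $$(f_1\bullet f_2)(z,\bar z)=\int f_1(z,\bar v)\,f_2(v,\bar z)\,e^{\phi(z,\bar z;v,\bar v)/\hbar}\,d\mu_\hbar(v,\bar v),$$ $$\phi(z,\bar z;v,\bar v)=\Phi(z,\bar v)+\Phi(v,\bar z)-\Phi(z,\bar z)-\Phi(v,\bar v),\qquad d\mu_\hbar=\det H\prod_{i=1}^n\frac{|dv^i\wedge d\bar v^i|}{2\pi\hbar},$$ understood as the formal Laplace expansion at $v=z$: put $v=z+\epsilon y$, $\epsilon^2=\hbar$, replace $f_1(z,\bar z+\epsilon\bar y)$, $f_2(z+\epsilon y,\bar z)$, $\phi$ and $\det H$ by their formal Taylor series at $z$ in $(\epsilon y,\epsilon\bar y)$, so that $$(f_1\bullet f_2)(z,\bar z)=\pi^{-n}\int_{\mathbb C^n}f_1(z,\bar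 z+\epsilon\bar y)\,f_2(z+\epsilon y,\bar z)\,e^{V_z(y,\bar y;\epsilon)}\,\det H(z+\epsilon y,\bar z+\epsilon\bar y)\,e^{-(Hy,y)}\,d\lambda(y),$$ where $(Hy,y)=\sum_{i,j} h_{i\bar j}(z,\bar z)\,y^i\bar y^j$, $\lambda$ is Lebesgue measure, $V_z=\epsilon^{-2}\phi(z,\bar z;z+\epsilon y,\bar z+\epsilon\bar y)+(Hy,y)$ is a formal power series in $\epsilon$ without constant term, the integrand apart from $e^{-(Hy,y)}$ is expanded in powers of $\epsilon$, and the integral is taken term by term (odd powers of $\epsilon$ integrate to zero). The product is extended $\mathbb C[[\hbar]]$-bilinearly to $C^\infty(V)[[\hbar]]$. Let $w=g(z)$ be a holomorphic change of coordinates on an open set $U\subset\mathbb C^n$, that is, a biholomorphic map from $U$ onto an open set $g(U)\subset V$. Then for all $f_1,f_2\in C^\infty(V)[[\hbar]]$ $$(f_1\bullet f_2)\circ g|_U=\big((f_1\circ g)\bullet(f_2\circ g)\big)|_U ,$$ where $(f\circ g)(z,\bar z)=f(g(z),\overline{g(z)})$, coefficientwise in $\hbar$. Here the product on the left is that of the metric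 with potential $\Phi$ on $V$, and the product on the right is that of the same metric written in the coordinates $z\in U$, formed with an arbitrary smooth real potential $\Phi'$ on $U$ of the pulled-back metric: $\partial_i\bar\partial_j\Phi'=\sum_{k,l}\partial_i g^k\,\overline{\partial_j g^l}\,(h_{k\bar l}\circ g)$ (for example $\Phi'=\Phi\circ g$). -/

import Mathlib

open scoped ContDiff ComplexConjugate ComplexOrder

noncomputable section

namespace FormalKahler

/-- The Wirtinger derivative `∂_i f = ∂f/∂z^i`. -/
def dz {n : ℕ} (i : Fin n) (f : (Fin n → ℂ) → ℂ) (z : Fin n → ℂ) : ℂ :=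
  (1 / 2 : ℂ) * (fderiv ℝ f z (Pi.single i 1) - Complex.I * fderiv ℝ f z (Pi.single i Complex.I))

/-- The Wirtinger derivative `∂̄_i f = ∂f/∂z̄^i`. -/
def dzbar {n : ℕ} (i : Fin n) (f : (Fin n → ℂ) → ℂ) (z : Fin n → ℂ) : ℂ :=
  (1 / 2 : ℂ) * (fderiv ℝ f z (Pi.single i 1) + Complex.I * fderiv ℝ f z (Pi.single i Complex.I))

/-- `∂^I f = ∂_1^{i_1} ⋯ ∂_n^{i_n} f` for a multi-index `I`. -/
def dzMulti {n : ℕ} (I : Fin n → ℕ) (f : (Fin n → ℂ) → ℂ) : (Fin n → ℂ) → ℂ :=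
  (List.finRange n).foldr (fun i F => (dz i)^[I i] F) f

/-- `∂̄^J f = ∂̄_1^{j_1} ⋯ ∂̄_n^{j_n} f` for a multi-index `J`. -/
def dzbarMulti {n : ℕ} (J : Fin n → ℕ) (f : (Fin n → ℂ) → ℂ) : (Fin n → ℂ) → ℂ :=
  (List.finRange n).foldr (fun j F => (dzbar j)^[J j] F) f

/-- The part of bidegree `(p, q)` in `(y, ȳ)` of the Taylor expansion of `f` at `z`:
`∑_{|I| = p, |J| = q} (1 / (I! J!)) ∂^I ∂̄^J f(z) y^I ȳ^J`. -/
def taylorTerm {n : ℕ} (f : (Fin n → ℂ) → ℂ) (z y : Fin n → ℂ) (p q : ℕ) : ℂ :=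
  ∑ I ∈ Finset.piAntidiag (Finset.univ : Finset (Fin n)) p,
    ∑ J ∈ Finset.piAntidiag (Finset.univ : Finset (Fin n)) q,
      dzMulti I (dzbarMulti J f) z / ((∏ i, ((I i).factorial : ℂ)) * ∏ j, ((J j).factorial : ℂ)) *
        ((∏ i, y i ^ I i) * ∏ j, conj (y j) ^ J j)

/-- The formal power series in `ε` denoted `f(z + εy, z̄ + εȳ)`. -/
def jet {n : ℕ} (f : (Fin n → ℂ) → ℂ) (z y : Fin n → ℂ) : PowerSeries ℂ :=
  PowerSeries.mk fun N => ∑ pq ∈ Finset.HasAntidiagonal.antidiagonal N, taylorTerm f z y pq.1 pq.2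

/-- The formal power series in `ε` denoted `f(z + εy, z̄)`. -/
def jetHol {n : ℕ} (f : (Fin n → ℂ) → ℂ) (z y : Fin n → ℂ) : PowerSeries ℂ :=
  PowerSeries.mk fun p => taylorTerm f z y p 0

/-- The formal power series in `ε` denoted `f(z, z̄ + εȳ)`. -/
def jetAntihol {n : ℕ} (f : (Fin n → ℂ) → ℂ) (z y : Fin n → ℂ) : PowerSeries ℂ :=
  PowerSeries.mk fun q => taylorTerm f z y 0 q

/-- The Hermitian matrix `H = (h_{i j̄})`, `h_{i j̄} = ∂_i ∂̄_j Φ`, of the metric with potential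
`Φ`. -/
def metric {n : ℕ} (Φ : (Fin n → ℂ) → ℝ) (z : Fin n → ℂ) : Matrix (Fin n) (Fin n) ℂ :=
  Matrix.of fun i j => dz i (dzbar j (fun w => (Φ w : ℂ))) z

/-- `Φ` is (a smooth real function which is) a potential of a Kähler metric on `V`. -/
structure IsKahlerPotential {n : ℕ} (Φ : (Fin n → ℂ) → ℝ) (V : Set (Fin n → ℂ)) : Prop where
  smooth : ContDiffOn ℝ ∞ Φ V
  posDef : ∀ z ∈ V, (metric Φ z).PosDef

/-- `(Hy, y) = ∑_{i,j} h_{i j̄}(z, z̄) y^i ȳ^j`. -/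
def hermForm {n : ℕ} (Φ : (Fin n → ℂ) → ℝ) (z y : Fin n → ℂ) : ℂ :=
  ∑ i, ∑ j, metric Φ z i j * y i * conj (y j)

/-- The formal power series in `ε` of the Calabi function
`φ(z, z̄; v, v̄) = Φ(z, v̄) + Φ(v, z̄) - Φ(z, z̄) - Φ(v, v̄)` at `v = z + εy`. -/
def calabi {n : ℕ} (Φ : (Fin n → ℂ) → ℝ) (z y : Fin n → ℂ) : PowerSeries ℂ :=
  jetAntihol (fun w => (Φ w : ℂ)) z y + jetHol (fun w => (Φ w : ℂ)) z y
    - PowerSeries.C (Φ z : ℂ) - jet (fun w => (Φ w : ℂ)) z y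

/-- The non-Gaussian part `V` of the exponent: the series `φ(z, z̄; z + εy, z̄ + εȳ) / ε²` has
constant term `-(Hy, y)`, and `V` is what remains of it when that term is removed. -/
def interaction {n : ℕ} (Φ : (Fin n → ℂ) → ℝ) (z y : Fin n → ℂ) : PowerSeries ℂ :=
  PowerSeries.mk fun N => if N = 0 then 0 else PowerSeries.coeff (N + 2) (calabi Φ z y)

/-- The formal power series in `ε`
`f₁(z, z̄ + εȳ) f₂(z + εy, z̄) exp(V) det H(z + εy, z̄ + εȳ)`. The substitution of `V` in the
exponential series is legitimate since `V` has no constant term. -/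
def integrand {n : ℕ} (Φ : (Fin n → ℂ) → ℝ) (f₁ f₂ : (Fin n → ℂ) → ℂ) (z y : Fin n → ℂ) :
    PowerSeries ℂ :=
  jetAntihol f₁ z y * jetHol f₂ z y * (PowerSeries.exp ℂ).subst (interaction Φ z y) *
    jet (fun w => (metric Φ w).det) z y

/-- The coefficient of `ħ^m` in the formal integral
`∫ f₁(z, v̄) f₂(v, z̄) e^{φ(z, z̄; v, v̄)/ħ} dμ_ħ(v, v̄)`, `dμ_ħ = det H ∏ |dv^i ∧ dv̄^i| / (2πħ)`.
After the substitution `v = z + εy`, `ε² = ħ`, this is the coefficient of `ε^{2m}`, integrated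
term by term against the Gaussian weight `π^{-n} e^{-(Hy,y)}` and Lebesgue measure. The odd
powers of `ε` integrate to zero by the symmetry `y ↦ -y`. -/
def bulletCoeff {n : ℕ} (Φ : (Fin n → ℂ) → ℝ) (m : ℕ) (f₁ f₂ : (Fin n → ℂ) → ℂ)
    (z : Fin n → ℂ) : ℂ :=
  ((Real.pi : ℂ) ^ n)⁻¹ * ∫ y : Fin n → ℂ,
    PowerSeries.coeff (2 * m) (integrand Φ f₁ f₂ z y) * Complex.exp (-hermForm Φ z y)

/-- The non-normalized star product `•` of formal power series in `ħ` whose coefficients are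
functions: the `ℂ[[ħ]]`-bilinear extension of the formal integral of two functions. -/
def bullet {n : ℕ} (Φ : (Fin n → ℂ) → ℝ) (f₁ f₂ : PowerSeries ((Fin n → ℂ) → ℂ)) :
    PowerSeries ((Fin n → ℂ) → ℂ) :=
  PowerSeries.mk fun N => ∑ p ∈ Finset.HasAntidiagonal.antidiagonal N, ∑ q ∈ Finset.HasAntidiagonal.antidiagonal p.2,
    bulletCoeff Φ p.1 (PowerSeries.coeff q.1 f₁) (PowerSeries.coeff q.2 f₂)

/-- `f` belongs to `C^∞(V)[[ħ]]`. -/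
def SmoothOn {n : ℕ} (f : PowerSeries ((Fin n → ℂ) → ℂ)) (V : Set (Fin n → ℂ)) : Prop :=
  ∀ k, ContDiffOn ℝ ∞ (PowerSeries.coeff k f) V

/-- `f ∘ g`, coefficientwise in `ħ`. -/
def compMap {n : ℕ} (f : PowerSeries ((Fin n → ℂ) → ℂ)) (g : (Fin n → ℂ) → (Fin n → ℂ)) :
    PowerSeries ((Fin n → ℂ) → ℂ) :=
  PowerSeries.mk fun k => PowerSeries.coeff k f ∘ g

/-- The matrix at `z` of the pullback under `g` of the metric with potential `Φ`:
`∑_{k,l} ∂_i g^k(z) h_{k l̄}(g(z)) conj(∂_j g^l(z))`. -/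
def pullbackMetric {n : ℕ} (Φ : (Fin n → ℂ) → ℝ) (g : (Fin n → ℂ) → (Fin n → ℂ))
    (z : Fin n → ℂ) : Matrix (Fin n) (Fin n) ℂ :=
  Matrix.of fun i j => ∑ k, ∑ l,
    fderiv ℂ g z (Pi.single i 1) k * metric Φ (g z) k l * conj (fderiv ℂ g z (Pi.single j 1) l)

end FormalKahler

end

/-! The formal integral is an algebraic object. Write ε = X. Apart from the Gaussian weight, the
integrand is a power series in X with coefficients in ℂ[y, ȳ] (`integrandPoly`). Integration is a
linear functional on ℂ[y, ȳ] that vanishes on ∂_j P - P ∂_j Q, where Q = (Hy, y)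
(`gaussian_pderiv`).

The change of variables is y ↦ (g(z + εy) - g(z))/ε together with its conjugate (`formalIncrement`),
a series whose constant term is the linear map dg. Since g is holomorphic, this substitution
respects setting y or ȳ to zero. Hence f₁(z, v̄), f₂(v, z̄) and the Calabi function of Φ pull back
to those of f₁ ∘ g, f₂ ∘ g and Φ ∘ g. The potentials Φ' and Φ ∘ g differ by a pluriharmonic
function, which the Calabi function does not see (`calabiPoly_congr`). After division by ε² the old
quadratic form becomes the new form Q plus a series W without constant term, while det H produces
the factor |det ∂g|², which is the formal Jacobian. So the new integrand is the substituted old one,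
times the Jacobian, times exp(-W) (`integrandPoly_comp`).

Such a transport does not change the integral (`formal_change_of_variables`). At order ε⁰ this is
the linear substitution dg in an honest Gaussian integral. For the step from m to m + 1, the
ε-derivative of a transported series F is the transported F' plus a total divergence for the weight
exp(-Q) (`derivX_transported_integrand`), and the functional kills the divergence.

Most identities between expansions come from one device: the errors, taken over all smooth functions
at once, vanish at ε = 0, and their ε-derivatives are combinations of errors, so they are zero
(`eq_zero_of_derivX_mem_span`). -/

noncomputable section
namespace FormalKahler
open PowerSeries

/-! ### Substitution into the coefficients of a power series -/

section Substitution

variable {A B : Type*} [CommRing A] [CommRing B]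

/-- A family of power series, each of which is `X` times a member of the family, vanishes. -/
theorem eq_zero_of_forall_exists_X_mul {ι : Type*} (E : ι → B⟦X⟧)
    (h : ∀ i, ∃ j, E i = X * E j) (i : ι) : E i = 0 := by
  have key : ∀ m i, coeff m (E i) = 0 := by
    intro m
    induction m with
    | zero => intro i; obtain ⟨j, hj⟩ := h i; rw [hj]; simp
    | succ m ih => intro i; obtain ⟨j, hj⟩ := h i; rw [hj, coeff_succ_X_mul]; exact ih j
  ext m
  simpa using key m i

/-- The map `∑ a_k X^k ↦ ∑ ψ(a_k) X^k`, as an additive map. -/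
def substAddHom (ψ : A →+* B⟦X⟧) : A⟦X⟧ →+ B⟦X⟧ where
  toFun F := mk fun m => ∑ kl ∈ Finset.HasAntidiagonal.antidiagonal m, coeff kl.2 (ψ (coeff kl.1 F))
  map_zero' := by ext m; simp
  map_add' F G := by ext m; simp [Finset.sum_add_distrib]

theorem coeff_substAddHom (ψ : A →+* B⟦X⟧) (F : A⟦X⟧) (m : ℕ) :
    coeff m (substAddHom ψ F) =
      ∑ kl ∈ Finset.HasAntidiagonal.antidiagonal m, coeff kl.2 (ψ (coeff kl.1 F)) := by
  simp [substAddHom]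

theorem substAddHom_C (ψ : A →+* B⟦X⟧) (a : A) : substAddHom ψ (C a) = ψ a := by
  ext m
  rw [coeff_substAddHom, Finset.sum_eq_single (0, m)]
  · simp
  · rintro ⟨k, l⟩ hkl hne
    rw [Finset.HasAntidiagonal.mem_antidiagonal] at hkl
    have hk : k ≠ 0 := by
      rintro rfl
      exact hne (by simpa using hkl)
    simp [coeff_C, hk]
  · intro h; exact absurd (by simp) h

/-- Together with `substAddHom_C` this drives the descent: in F = X * G + C a the constant is
handled directly, and the rest is X times the same problem for G. -/
theorem substAddHom_X_mul (ψ : A →+* B⟦X⟧) (F : A⟦X⟧) :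
    substAddHom ψ (X * F) = X * substAddHom ψ F := by
  ext m
  cases m with
  | zero => simp [coeff_substAddHom]
  | succ m =>
    rw [coeff_succ_X_mul, coeff_substAddHom, coeff_substAddHom,
      Finset.Nat.sum_antidiagonal_succ]
    simp [coeff_succ_X_mul]

/-- Splitting the constant term off one factor turns the error of multiplicativity into X times
another such error. The case of a constant first factor (`h1`) is needed before the general one. -/
theorem substAddHom_mul (ψ : A →+* B⟦X⟧) (F G : A⟦X⟧) :
    substAddHom ψ (F * G) = substAddHom ψ F * substAddHom ψ G := by
  have h1 : ∀ p : A × A⟦X⟧,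
      substAddHom ψ (C p.1 * p.2) - ψ p.1 * substAddHom ψ p.2 = 0 := by
    refine eq_zero_of_forall_exists_X_mul _ fun p => ⟨(p.1, mk fun k => coeff (k + 1) p.2), ?_⟩
    dsimp only
    conv_lhs => rw [eq_X_mul_shift_add_const p.2]
    rw [mul_add, mul_left_comm, ← map_mul C, map_add, map_add, substAddHom_X_mul,
      substAddHom_X_mul, substAddHom_C, substAddHom_C, map_mul ψ]
    ring
  have h2 : ∀ p : A⟦X⟧ × A⟦X⟧,
      substAddHom ψ (p.1 * p.2) - substAddHom ψ p.1 * substAddHom ψ p.2 = 0 := by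
    refine eq_zero_of_forall_exists_X_mul _ fun p => ⟨(mk fun k => coeff (k + 1) p.1, p.2), ?_⟩
    dsimp only
    conv_lhs => rw [eq_X_mul_shift_add_const p.1]
    rw [add_mul, mul_assoc, map_add, map_add, substAddHom_X_mul, substAddHom_X_mul,
      sub_eq_zero.mp (h1 (constantCoeff p.1, p.2)), substAddHom_C]
    ring
  exact sub_eq_zero.mp (h2 (F, G))

/-- The ring homomorphism `∑ a_k X^k ↦ ∑ ψ(a_k) X^k`. -/
def substHom (ψ : A →+* B⟦X⟧) : A⟦X⟧ →+* B⟦X⟧ where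
  __ := substAddHom ψ
  map_one' := by
    change substAddHom ψ 1 = 1
    rw [← map_one (C : A →+* A⟦X⟧), substAddHom_C, map_one]
  map_mul' := substAddHom_mul ψ

theorem coeff_substHom (ψ : A →+* B⟦X⟧) (F : A⟦X⟧) (m : ℕ) :
    coeff m (substHom ψ F) =
      ∑ kl ∈ Finset.HasAntidiagonal.antidiagonal m, coeff kl.2 (ψ (coeff kl.1 F)) :=
  coeff_substAddHom ψ F m

theorem constantCoeff_substHom (ψ : A →+* B⟦X⟧) (F : A⟦X⟧) :
    constantCoeff (substHom ψ F) = constantCoeff (ψ (constantCoeff F)) := by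
  rw [← coeff_zero_eq_constantCoeff_apply, coeff_substHom]
  simp

@[simp]
theorem substHom_C (ψ : A →+* B⟦X⟧) (a : A) : substHom ψ (C a) = ψ a := substAddHom_C ψ a

theorem substHom_X_mul (ψ : A →+* B⟦X⟧) (F : A⟦X⟧) : substHom ψ (X * F) = X * substHom ψ F :=
  substAddHom_X_mul ψ F

@[simp]
theorem substHom_X (ψ : A →+* B⟦X⟧) : substHom ψ X = X := by
  simpa using substHom_X_mul ψ 1

theorem substHom_map {A' : Type*} [CommRing A'] (ψ : A →+* B⟦X⟧) (φ : A' →+* A) (F : A'⟦X⟧) :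
    substHom ψ (PowerSeries.map φ F) = substHom (ψ.comp φ) F := by
  ext m
  simp [coeff_substHom]

end Substitution

/-! ### Derivations of power series rings, chain rule, Jacobi's formula -/

section Derivations

variable {A : Type*} [CommRing A] [Algebra ℂ A]

/-- The derivation of `A⟦X⟧` which acts coefficientwise by a derivation of `A`. -/
def coeffDerivation (d : Derivation ℂ A A) : Derivation ℂ A⟦X⟧ A⟦X⟧ where
  toFun F := mk fun m => d (coeff m F)
  map_add' F G := by ext m; simp
  map_smul' c F := by ext m; simp
  map_one_eq_zero' := by
    ext m
    change coeff m (mk fun m => d (coeff m 1)) = 0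
    rw [coeff_mk, coeff_one]
    split_ifs <;> simp
  leibniz' F G := by
    ext m
    change coeff m (mk fun m => d (coeff m (F * G))) =
      coeff m (F * (mk fun m => d (coeff m G)) + G * (mk fun m => d (coeff m F)))
    rw [mul_comm G, coeff_mk, map_add, coeff_mul, coeff_mul, coeff_mul, map_sum,
      ← Finset.sum_add_distrib]
    refine Finset.sum_congr rfl fun p _ => ?_
    simp [Derivation.leibniz, mul_comm]

@[simp]
theorem coeff_coeffDerivation (d : Derivation ℂ A A) (F : A⟦X⟧) (m : ℕ) :
    coeff m (coeffDerivation d F) = d (coeff m F) :=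
  coeff_mk m fun m => d (coeff m F)

@[simp]
theorem coeffDerivation_C (d : Derivation ℂ A A) (a : A) :
    coeffDerivation d (C a) = C (d a) := by
  ext m
  rw [coeff_coeffDerivation, coeff_C, coeff_C]
  split_ifs <;> simp

@[simp]
theorem coeffDerivation_X (d : Derivation ℂ A A) : coeffDerivation d (X : A⟦X⟧) = 0 := by
  ext m
  rw [coeff_coeffDerivation, coeff_X]
  split_ifs <;> simp

variable (A) in
/-- The derivative of formal power series, as a derivation over `ℂ`. -/
def derivX : Derivation ℂ A⟦X⟧ A⟦X⟧ := (derivative A).restrictScalars ℂ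

theorem derivX_apply (F : A⟦X⟧) : derivX A F = derivative A F := rfl

theorem coeff_derivX (F : A⟦X⟧) (m : ℕ) :
    coeff m (derivX A F) = coeff (m + 1) F * (m + 1) := coeff_derivative F m

@[simp]
theorem derivX_C (a : A) : derivX A (C a) = 0 := derivative_C

@[simp]
theorem derivX_X : derivX A X = 1 := derivative_X

theorem coeffDerivation_derivX (d : Derivation ℂ A A) (F : A⟦X⟧) :
    coeffDerivation d (derivX A F) = derivX A (coeffDerivation d F) := by
  ext m
  simp only [coeff_coeffDerivation, coeff_derivX, Derivation.leibniz]
  have : d ((m : A) + 1) = 0 := by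
    rw [← Nat.cast_add_one]
    exact d.map_natCast (m + 1)
  simp [this, mul_comm]

/-- A need not be a domain; m + 1 is invertible because A is a ℂ-algebra. -/
theorem natCast_mul_cancel {m : ℕ} {a b : A} (h : a * ((m : A) + 1) = b * ((m : A) + 1)) :
    a = b := by
  have h2 : algebraMap ℂ A ((m : ℂ) + 1) = (m : A) + 1 := by simp
  have h3 : ((m : A) + 1) * algebraMap ℂ A (((m : ℂ) + 1)⁻¹) = 1 := by
    rw [← h2, ← map_mul, mul_inv_cancel₀ (Nat.cast_add_one_ne_zero m), map_one]
  calc a = a * ((m : A) + 1) * algebraMap ℂ A (((m : ℂ) + 1)⁻¹) := by rw [mul_assoc, h3, mul_one]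
    _ = b * ((m : A) + 1) * algebraMap ℂ A (((m : ℂ) + 1)⁻¹) := by rw [h]
    _ = b := by rw [mul_assoc, h3, mul_one]

theorem coeff_succ_of_derivX {F : A⟦X⟧} {m : ℕ} (h : coeff m (derivX A F) = 0) :
    coeff (m + 1) F = 0 := by
  rw [coeff_derivX] at h
  exact natCast_mul_cancel (m := m) (by rw [h, zero_mul])

/-- Uniqueness for the linear equation F' = aF: coefficient m + 1 of F is determined by the lower
ones. -/
theorem eq_zero_of_derivX_eq_mul {a F : A⟦X⟧} (h : derivX A F = a * F)
    (h0 : constantCoeff F = 0) : F = 0 := by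
  have key : ∀ m, coeff m F = 0 := by
    intro m
    induction m using Nat.strong_induction_on with
    | _ m ih =>
      cases m with
      | zero => simpa using h0
      | succ m =>
        refine coeff_succ_of_derivX ?_
        rw [h, coeff_mul]
        refine Finset.sum_eq_zero fun p hp => ?_
        rw [ih p.2 (by have := Finset.HasAntidiagonal.mem_antidiagonal.mp hp; omega), mul_zero]
  ext m
  simpa using key m

/-- The chain rule for the substitution homomorphism of a polynomial ring. -/
theorem derivation_substHom {σ : Type*} [Fintype σ] [DecidableEq σ]
    (δ : Derivation ℂ A⟦X⟧ A⟦X⟧) (ψ : MvPolynomial σ ℂ →ₐ[ℂ] A⟦X⟧)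
    (F : (MvPolynomial σ ℂ)⟦X⟧) :
    δ (substHom (ψ : MvPolynomial σ ℂ →+* A⟦X⟧) F) =
      substHom (ψ : MvPolynomial σ ℂ →+* A⟦X⟧) (derivX _ F) * δ X +
      ∑ k, substHom (ψ : MvPolynomial σ ℂ →+* A⟦X⟧)
        (coeffDerivation (MvPolynomial.pderiv k) F) * δ (ψ (MvPolynomial.X k)) := by
  have hC : ∀ a : MvPolynomial σ ℂ,
      δ (ψ a) = ∑ k, ψ (MvPolynomial.pderiv k a) * δ (ψ (MvPolynomial.X k)) := by
    intro a
    induction a using MvPolynomial.induction_on with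
    | C c =>
      have : ψ (MvPolynomial.C c) = algebraMap ℂ _ c := ψ.commutes c
      simp [this]
    | add p q hp hq => simp [hp, hq, add_mul, Finset.sum_add_distrib]
    | mul_X p i hp =>
      simp only [map_mul, Derivation.leibniz, smul_eq_mul, hp, map_add, add_mul,
        Finset.sum_add_distrib, MvPolynomial.pderiv_X, Finset.mul_sum]
      congr 1
      · rw [Finset.sum_eq_single i]
        · simp
        · intro k _ hk
          simp [hk.symm]
        · simp
      · exact Finset.sum_congr rfl fun k _ => by ring
  set Ψ := substHom (ψ : MvPolynomial σ ℂ →+* A⟦X⟧) with hΨ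
  -- Descent: `hC` settles the constant term of F, and what is left is X times the error of the
  -- shifted series.
  have key : ∀ F : (MvPolynomial σ ℂ)⟦X⟧, δ (Ψ F) - (Ψ (derivX _ F) * δ X +
      ∑ k, Ψ (coeffDerivation (MvPolynomial.pderiv k) F) * δ (ψ (MvPolynomial.X k))) = 0 := by
    refine eq_zero_of_forall_exists_X_mul _ fun F => ⟨mk fun k => coeff (k + 1) F, ?_⟩
    set G : (MvPolynomial σ ℂ)⟦X⟧ := mk fun k => coeff (k + 1) F
    have hF : F = X * G + C (constantCoeff F) := eq_X_mul_shift_add_const F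
    set a := constantCoeff F
    rw [hF]
    have h1 := hC a
    have h2 : Ψ (C a) = ψ a := substHom_C _ _
    have h3 : ∀ k, Ψ (C (MvPolynomial.pderiv k a)) = ψ (MvPolynomial.pderiv k a) :=
      fun k => substHom_C _ _
    have h4 : Ψ X = X := substHom_X _
    simp only [map_add, map_mul, Derivation.leibniz, smul_eq_mul, derivX_C, derivX_X,
      coeffDerivation_C, coeffDerivation_X, h2, h3, h4, h1, add_mul, Finset.sum_add_distrib,
      mul_zero, add_zero, mul_one]
    simp only [mul_assoc, ← Finset.mul_sum]
    ring
  exact sub_eq_zero.mp (key F)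

theorem derivation_prod {S ι : Type*} [CommRing S] [Algebra ℂ S] [DecidableEq ι]
    (δ : Derivation ℂ S S) (s : Finset ι) (f : ι → S) :
    δ (∏ i ∈ s, f i) = ∑ i ∈ s, ∏ j ∈ s, Function.update f i (δ (f i)) j := by
  induction s using Finset.induction_on with
  | empty => simp
  | insert a s ha ih =>
    rw [Finset.prod_insert ha, Derivation.leibniz, ih, Finset.sum_insert ha,
      Finset.prod_insert ha, smul_eq_mul, smul_eq_mul, Finset.mul_sum, add_comm]
    congr 1
    · rw [Function.update_self, mul_comm]
      congr 1
      refine Finset.prod_congr rfl fun j hj => ?_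
      rw [Function.update_of_ne (by rintro rfl; exact ha hj)]
    · refine Finset.sum_congr rfl fun i hi => ?_
      rw [Finset.prod_insert ha, Function.update_of_ne (by rintro rfl; exact ha hi)]

/-- Leibniz rule on each monomial of the determinant, regrouped by the column that is
differentiated. -/
theorem derivation_det {S ι : Type*} [CommRing S] [Algebra ℂ S] [Fintype ι] [DecidableEq ι]
    (δ : Derivation ℂ S S) (M : Matrix ι ι S) :
    δ M.det = ∑ j, (M.updateCol j fun k => δ (M k j)).det := by
  simp only [Matrix.det_apply, map_sum]
  rw [Finset.sum_comm]
  refine Finset.sum_congr rfl fun e _ => ?_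
  rw [← Finset.smul_sum]
  have : δ (∏ i, M (e i) i) =
      ∑ j, ∏ i, (M.updateCol j fun k => δ (M k j)) (e i) i := by
    rw [derivation_prod]
    refine Finset.sum_congr rfl fun j _ => Finset.prod_congr rfl fun i _ => ?_
    rw [Matrix.updateCol_apply, Function.update_apply]
    split_ifs with h
    · rw [h]
    · rfl
  rw [← this]
  rcases Int.units_eq_one_or (Equiv.Perm.sign e) with h | h <;> simp [h]

/-- Jacobi's formula without inverting M. Replacing column j by a combination of the columns of M
leaves only the multiple N j j of column j itself. -/
theorem derivation_det_of_eq_mul {S ι : Type*} [CommRing S] [Algebra ℂ S] [Fintype ι]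
    [DecidableEq ι] (δ : Derivation ℂ S S) (M N : Matrix ι ι S)
    (h : ∀ k j, δ (M k j) = ∑ i, M k i * N i j) : δ M.det = M.det * N.trace := by
  rw [derivation_det, Matrix.trace, Finset.mul_sum]
  refine Finset.sum_congr rfl fun j _ => ?_
  have := Matrix.det_updateCol_sum M j (fun i => N i j)
  simp only [h, Matrix.diag_apply]
  rw [mul_comm M.det, ← smul_eq_mul, ← this]
  simp [mul_comm]

end Derivations

/-! ### The exponential series, characterised by its differential equation -/

section Exponential

variable {A : Type*} [CommRing A] [Algebra ℚ A]

/-- The exponential of a power series without constant term. -/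
def expSeries (a : A⟦X⟧) : A⟦X⟧ := (PowerSeries.exp A).subst a

theorem constantCoeff_expSeries {a : A⟦X⟧} (ha : constantCoeff a = 0) :
    constantCoeff (expSeries a) = 1 := by
  have h := PowerSeries.constantCoeff_subst_eq_zero ha (PowerSeries.exp A - 1) (by simp)
  rw [PowerSeries.subst_sub (HasSubst.of_constantCoeff_zero' ha)] at h
  have h1 : (1 : A⟦X⟧).subst a = (1 : A⟦X⟧) := by
    rw [← PowerSeries.coe_substAlgHom (HasSubst.of_constantCoeff_zero' ha), map_one]
  rw [h1, map_sub] at h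
  have h2 : MvPowerSeries.constantCoeff (1 : A⟦X⟧) = 1 := map_one _
  rw [h2, sub_eq_zero] at h
  exact h

theorem map_expSeries {A' : Type*} [CommRing A'] [Algebra ℚ A'] (φ : A →+* A')
    {a : A⟦X⟧} (ha : constantCoeff a = 0) :
    PowerSeries.map φ (expSeries a) = expSeries (PowerSeries.map φ a) := by
  refine (PowerSeries.map_subst (HasSubst.of_constantCoeff_zero' ha) _).trans ?_
  rw [map_exp]
  rfl

variable [Algebra ℂ A]

theorem derivX_expSeries {a : A⟦X⟧} (ha : constantCoeff a = 0) :
    derivX A (expSeries a) = derivX A a * expSeries a := by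
  rw [derivX_apply, expSeries, derivative_subst (HasSubst.of_constantCoeff_zero' ha),
    derivative_exp, mul_comm, derivX_apply]

/-- Additivity of the exponential and its compatibility with substitution both reduce to this
uniqueness statement. -/
theorem eq_expSeries {a F : A⟦X⟧} (ha : constantCoeff a = 0)
    (hF : derivX A F = derivX A a * F) (h0 : constantCoeff F = 1) : F = expSeries a := by
  refine sub_eq_zero.mp (eq_zero_of_derivX_eq_mul (a := derivX A a) ?_ ?_)
  · rw [map_sub, hF, derivX_expSeries ha, mul_sub]
  · rw [map_sub, h0, constantCoeff_expSeries ha, sub_self]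

theorem expSeries_add {a b : A⟦X⟧} (ha : constantCoeff a = 0) (hb : constantCoeff b = 0) :
    expSeries (a + b) = expSeries a * expSeries b := by
  symm
  refine eq_expSeries (by simp [ha, hb]) ?_ ?_
  · rw [Derivation.leibniz, derivX_expSeries ha, derivX_expSeries hb, map_add]
    simp only [smul_eq_mul]
    ring
  · rw [map_mul, constantCoeff_expSeries ha, constantCoeff_expSeries hb, one_mul]

/-- The derivation d commutes with d/dX, so the error d(E) - d(a)E solves the same equation F' = a'F
as E, with zero initial value. -/
theorem coeffDerivation_expSeries (d : Derivation ℂ A A) {a : A⟦X⟧} (ha : constantCoeff a = 0) :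
    coeffDerivation d (expSeries a) = coeffDerivation d a * expSeries a := by
  refine sub_eq_zero.mp (eq_zero_of_derivX_eq_mul (a := derivX A a) ?_ ?_)
  · rw [map_sub, ← coeffDerivation_derivX, derivX_expSeries ha]
    simp only [Derivation.leibniz, smul_eq_mul, ← coeffDerivation_derivX, derivX_expSeries ha]
    ring
  · have h1 : constantCoeff (coeffDerivation d (expSeries a)) = 0 := by
      rw [← coeff_zero_eq_constantCoeff_apply, coeff_coeffDerivation,
        coeff_zero_eq_constantCoeff_apply, constantCoeff_expSeries ha, Derivation.map_one_eq_zero]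
    have h2 : constantCoeff (coeffDerivation d a) = 0 := by
      rw [← coeff_zero_eq_constantCoeff_apply, coeff_coeffDerivation,
        coeff_zero_eq_constantCoeff_apply, ha, map_zero]
    rw [map_sub, map_mul, h1, h2, zero_mul, sub_zero]

theorem substHom_expSeries {σ : Type*} [Fintype σ] [DecidableEq σ]
    (ψ : MvPolynomial σ ℂ →ₐ[ℂ] A⟦X⟧) {a : (MvPolynomial σ ℂ)⟦X⟧} (ha : constantCoeff a = 0) :
    substHom (ψ : MvPolynomial σ ℂ →+* A⟦X⟧) (expSeries a) =
      expSeries (substHom (ψ : MvPolynomial σ ℂ →+* A⟦X⟧) a) := by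
  refine eq_expSeries ?_ ?_ ?_
  · rw [constantCoeff_substHom, ha]; simp
  · rw [derivation_substHom, derivation_substHom, derivX_expSeries ha]
    simp only [coeffDerivation_expSeries _ ha, map_mul, add_mul, Finset.sum_mul]
    congr 1
    · ring
    · exact Finset.sum_congr rfl fun k _ => by ring
  · rw [constantCoeff_substHom, constantCoeff_expSeries ha]; simp

end Exponential

end FormalKahler
end

noncomputable section
namespace FormalKahler
open PowerSeries

/-! ### The formal change of variables -/

section ChangeOfVariables

/-- The substitution of the series `u` for the variables of the polynomial coefficients. -/
def substPoly {σ A : Type*} [CommRing A] [Algebra ℂ A] (u : σ → A⟦X⟧) :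
    (MvPolynomial σ ℂ)⟦X⟧ →+* A⟦X⟧ :=
  substHom ((MvPolynomial.aeval u : MvPolynomial σ ℂ →ₐ[ℂ] A⟦X⟧) : MvPolynomial σ ℂ →+* A⟦X⟧)

@[simp]
theorem substPoly_C {σ A : Type*} [CommRing A] [Algebra ℂ A] (u : σ → A⟦X⟧)
    (P : MvPolynomial σ ℂ) : substPoly u (C P) = MvPolynomial.aeval u P := substHom_C _ _

@[simp]
theorem substPoly_X {σ A : Type*} [CommRing A] [Algebra ℂ A] (u : σ → A⟦X⟧) :
    substPoly u X = X := substHom_X _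

theorem derivation_substPoly {σ A : Type*} [Fintype σ] [DecidableEq σ] [CommRing A] [Algebra ℂ A]
    (u : σ → A⟦X⟧) (δ : Derivation ℂ A⟦X⟧ A⟦X⟧) (F : (MvPolynomial σ ℂ)⟦X⟧) :
    δ (substPoly u F) = substPoly u (derivX _ F) * δ X +
      ∑ k, substPoly u (coeffDerivation (MvPolynomial.pderiv k) F) * δ (u k) := by
  simpa [substPoly] using derivation_substHom δ (MvPolynomial.aeval u) F

theorem substPoly_expSeries {σ A : Type*} [Fintype σ] [DecidableEq σ] [CommRing A] [Algebra ℂ A]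
    [Algebra ℚ A] (u : σ → A⟦X⟧) {a : (MvPolynomial σ ℂ)⟦X⟧} (ha : constantCoeff a = 0) :
    substPoly u (expSeries a) = expSeries (substPoly u a) :=
  substHom_expSeries (MvPolynomial.aeval u) ha

variable {σ : Type*} [DecidableEq σ]

/-- The Jacobian matrix of a formal family of polynomial maps. -/
def jacobian (u : σ → (MvPolynomial σ ℂ)⟦X⟧) : Matrix σ σ (MvPolynomial σ ℂ)⟦X⟧ :=
  Matrix.of fun k j => coeffDerivation (MvPolynomial.pderiv j) (u k)

/-- The commutator of two derivations is a derivation, and this one kills the variables. -/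
theorem coeffDerivation_pderiv_comm (i j : σ) (F : (MvPolynomial σ ℂ)⟦X⟧) :
    coeffDerivation (MvPolynomial.pderiv i) (coeffDerivation (MvPolynomial.pderiv j) F) =
      coeffDerivation (MvPolynomial.pderiv j) (coeffDerivation (MvPolynomial.pderiv i) F) := by
  ext1 m
  simp only [coeff_coeffDerivation]
  have : ⁅(MvPolynomial.pderiv i : Derivation ℂ (MvPolynomial σ ℂ) _),
      (MvPolynomial.pderiv j : Derivation ℂ (MvPolynomial σ ℂ) _)⁆ = 0 := by
    refine MvPolynomial.derivation_ext fun k => ?_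
    rw [Derivation.commutator_apply]
    simp only [MvPolynomial.pderiv_X, Pi.single_apply]
    split_ifs <;> simp
  have h := congrArg (fun d => d (coeff m F)) this
  simpa [Derivation.commutator_apply, sub_eq_zero] using h

variable [Fintype σ]

/-- The derivative with respect to the parameter of a formal integrand, transported by a formal
change of variables, is the transported derivative up to a divergence. -/
theorem derivX_transported_integrand (u : σ → (MvPolynomial σ ℂ)⟦X⟧)
    (hu : IsUnit (jacobian u).det) {Q Q₂ : MvPolynomial σ ℂ} {W : (MvPolynomial σ ℂ)⟦X⟧}
    (hW : constantCoeff W = 0) (hQ : MvPolynomial.aeval u Q₂ = C Q + W) :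
    ∃ v : σ → (MvPolynomial σ ℂ)⟦X⟧, ∀ F : (MvPolynomial σ ℂ)⟦X⟧,
      derivX _ (substPoly u F * (jacobian u).det * expSeries (-W)) =
        substPoly u (derivX _ F) * (jacobian u).det * expSeries (-W) +
        ∑ j, (coeffDerivation (MvPolynomial.pderiv j)
            (v j * (substPoly u F * (jacobian u).det * expSeries (-W))) -
          v j * (substPoly u F * (jacobian u).det * expSeries (-W)) *
            C (MvPolynomial.pderiv j Q)) := by
  set D : σ → Derivation ℂ (MvPolynomial σ ℂ)⟦X⟧ (MvPolynomial σ ℂ)⟦X⟧ :=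
    fun j => coeffDerivation (MvPolynomial.pderiv j) with hD
  -- Here v is the inverse Jacobian applied to ∂u/∂ε, the vector field for which u is constant along
  -- ∂_ε - ∑ v_j ∂_j.
  obtain ⟨v, hv'⟩ : ∃ v : σ → (MvPolynomial σ ℂ)⟦X⟧,
      ∀ k, ∑ j, D j (u k) * v j = derivX _ (u k) := by
    refine ⟨(jacobian u)⁻¹.mulVec fun k => derivX _ (u k), fun k => ?_⟩
    have h := congrFun (Matrix.mulVec_mulVec (fun k => derivX _ (u k)) (jacobian u)
      (jacobian u)⁻¹) k
    rw [Matrix.mul_nonsing_inv _ hu, Matrix.one_mulVec] at h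
    exact h
  obtain ⟨δ, hδ_apply⟩ : ∃ δ : Derivation ℂ (MvPolynomial σ ℂ)⟦X⟧ (MvPolynomial σ ℂ)⟦X⟧,
      ∀ G, δ G = derivX _ G - ∑ j, v j * D j G := by
    refine ⟨derivX _ - ∑ j, v j • D j, fun G => ?_⟩
    rw [Derivation.sub_apply]
    congr 1
    have h := congrFun (map_sum (Derivation.coeFnAddMonoidHom (R := ℂ)
      (A := (MvPolynomial σ ℂ)⟦X⟧) (M := (MvPolynomial σ ℂ)⟦X⟧)) (fun j => v j • D j)
        Finset.univ) G
    rw [Finset.sum_apply] at h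
    exact h
  have hδu : ∀ k, δ (u k) = 0 := by
    intro k
    rw [hδ_apply, ← hv' k, sub_eq_zero]
    exact Finset.sum_congr rfl fun j _ => mul_comm _ _
  have hδX : δ X = 1 := by
    rw [hδ_apply]
    simp [hD]
  -- Differentiating δ u = 0 in direction j shows that δ multiplies the Jacobian matrix on the right
  -- by (∂_j v_i), so Jacobi's formula yields div v.
  have hδJ : δ (jacobian u).det = (jacobian u).det * ∑ j, D j (v j) := by
    refine derivation_det_of_eq_mul δ (jacobian u) (Matrix.of fun i j => D j (v i)) fun k j => ?_
    change δ (D j (u k)) = ∑ i, D i (u k) * D j (v i)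
    have h := congrArg (D j) (hδu k)
    rw [hδ_apply, map_sub, map_sum, map_zero, sub_eq_zero] at h
    rw [hδ_apply]
    have h2 : derivX _ (D j (u k)) = D j (derivX _ (u k)) := (coeffDerivation_derivX _ _).symm
    rw [h2, h, ← Finset.sum_sub_distrib]
    refine Finset.sum_congr rfl fun i _ => ?_
    have h3 : D i (D j (u k)) = D j (D i (u k)) := coeffDerivation_pderiv_comm _ _ _
    rw [Derivation.leibniz, h3, smul_eq_mul, smul_eq_mul]
    ring
  have hW' : constantCoeff (-W) = 0 := by simp [hW]
  have hDE : ∀ j, D j (expSeries (-W)) = D j (-W) * expSeries (-W) :=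
    fun j => coeffDerivation_expSeries _ hW'
  have hdE := derivX_expSeries hW'
  generalize expSeries (-W) = E at hDE hdE ⊢
  -- Q₂(u) = Q + W is constant along δ and Q is free of ε, so δ W = -δ Q = ∑ v_j ∂_j Q.
  have hδE : δ E = -(∑ j, v j * C (MvPolynomial.pderiv j Q)) * E := by
    have h1 : δ E = δ (-W) * E := by
      rw [hδ_apply, hδ_apply, hdE, sub_mul, Finset.sum_mul]
      simp only [hDE, mul_assoc]
    have h2 : δ (MvPolynomial.aeval u Q₂) = 0 := by
      have h := derivation_substPoly u δ (C Q₂)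
      simpa [hδu] using h
    rw [hQ, map_add, hδ_apply (C Q)] at h2
    have h3 : ∀ j, D j (C Q) = C (MvPolynomial.pderiv j Q) := fun j => coeffDerivation_C _ _
    simp only [derivX_C, h3, zero_sub] at h2
    rw [h1, map_neg]
    linear_combination (-E) * h2
  refine ⟨v, fun F => ?_⟩
  generalize (jacobian u).det = J at hδJ
  have hF : δ (substPoly u F) = substPoly u (derivX _ F) := by
    rw [derivation_substPoly, hδX]
    simp [hδu]
  have hG : δ (substPoly u F * J * E) = substPoly u (derivX _ F) * J * E +
      substPoly u F * J * E * (∑ j, D j (v j)) -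
      substPoly u F * J * E * ∑ j, v j * C (MvPolynomial.pderiv j Q) := by
    simp only [Derivation.leibniz, smul_eq_mul, hF, hδJ, hδE]
    ring
  generalize substPoly u F * J * E = G at hG
  -- Passing from δ back to ∂_ε adds ∑ v_j ∂_j G, which completes G div v to the divergence of vG.
  have h4 : derivX _ G = δ G + ∑ j, v j * D j G := by rw [hδ_apply]; ring
  rw [h4, hG, add_sub_assoc, add_assoc]
  congr 1
  rw [Finset.mul_sum, Finset.mul_sum, ← Finset.sum_sub_distrib, ← Finset.sum_add_distrib]
  refine Finset.sum_congr rfl fun j _ => ?_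
  have h5 : D j (v j * G) = v j * D j G + G * D j (v j) := by
    rw [Derivation.leibniz, smul_eq_mul, smul_eq_mul]
  change _ = D j (v j * G) - _
  rw [h5]
  ring

/-- The change of variables formula for formal integrals against a linear functional which
vanishes on total derivatives with respect to the weight `exp (-Q)`. -/
theorem formal_change_of_variables (u : σ → (MvPolynomial σ ℂ)⟦X⟧)
    (hu : IsUnit (jacobian u).det) {Q Q₂ : MvPolynomial σ ℂ} {W : (MvPolynomial σ ℂ)⟦X⟧}
    (hW : constantCoeff W = 0) (hQ : MvPolynomial.aeval u Q₂ = C Q + W)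
    (L L₂ : MvPolynomial σ ℂ →ₗ[ℂ] ℂ)
    (hL : ∀ j P, L (MvPolynomial.pderiv j P - P * MvPolynomial.pderiv j Q) = 0)
    (hLL₂ : ∀ P, L (constantCoeff (MvPolynomial.aeval u P) * constantCoeff (jacobian u).det) =
      L₂ P) (m : ℕ) (F : (MvPolynomial σ ℂ)⟦X⟧) :
    L (coeff m (substPoly u F * (jacobian u).det * expSeries (-W))) = L₂ (coeff m F) := by
  obtain ⟨v, hv⟩ := derivX_transported_integrand u hu hW hQ
  induction m generalizing F with
  | zero =>
    rw [coeff_zero_eq_constantCoeff_apply, coeff_zero_eq_constantCoeff_apply,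
      map_mul constantCoeff, map_mul constantCoeff,
      constantCoeff_expSeries (by simp [hW]), mul_one, substPoly, constantCoeff_substHom]
    exact hLL₂ _
  | succ m ih =>
    -- Coefficient m of a derivative is m + 1 times coefficient m + 1 of the series. The divergence
    -- terms fall under `hL`, and the factor m + 1 is cancelled at the end.
    have h1 := ih (derivX _ F)
    have h2 := congrArg (fun G => L (coeff m G)) (hv F)
    simp only [map_add, map_sum, map_sub, coeff_coeffDerivation, coeff_mul_C] at h2
    simp only [← map_sub, hL, Finset.sum_const_zero, add_zero] at h2
    rw [h1, coeff_derivX, coeff_derivX] at h2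
    have hsm : ∀ P : MvPolynomial σ ℂ, P * ((m : MvPolynomial σ ℂ) + 1) = ((m : ℂ) + 1) • P := by
      intro P
      rw [MvPolynomial.smul_eq_C_mul, mul_comm]
      simp
    rw [hsm, hsm, map_smul, map_smul, smul_eq_mul, smul_eq_mul] at h2
    exact mul_left_cancel₀ (Nat.cast_add_one_ne_zero m) h2

end ChangeOfVariables

end FormalKahler
end

noncomputable section
namespace FormalKahler
open PowerSeries

/-! ### Wirtinger calculus -/

section Wirtinger

variable {n : ℕ}

/-- The Wirtinger derivatives `∂_i` (`inl i`) and `∂̄_i` (`inr i`). -/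
def wirtinger (s : Fin n ⊕ Fin n) (f : (Fin n → ℂ) → ℂ) (z : Fin n → ℂ) : ℂ :=
  Sum.elim (fun i => dz i f z) (fun i => dzbar i f z) s

/-- The coordinate functions `z^i` (`inl i`) and `z̄^i` (`inr i`). -/
def coord (s : Fin n ⊕ Fin n) (z : Fin n → ℂ) : ℂ :=
  Sum.elim (fun i => z i) (fun i => conj (z i)) s

@[simp] theorem coord_inl (i : Fin n) (z : Fin n → ℂ) : coord (.inl i) z = z i := rfl
@[simp] theorem coord_inr (i : Fin n) (z : Fin n → ℂ) : coord (.inr i) z = conj (z i) := rfl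
@[simp] theorem wirtinger_inl (i : Fin n) (f : (Fin n → ℂ) → ℂ) :
    wirtinger (.inl i) f = dz i f := rfl
@[simp] theorem wirtinger_inr (i : Fin n) (f : (Fin n → ℂ) → ℂ) :
    wirtinger (.inr i) f = dzbar i f := rfl

/-- The index of the coordinate direction belonging to a Wirtinger derivative. -/
def dirIndex (s : Fin n ⊕ Fin n) : Fin n := Sum.elim id id s

/-- The coefficient of the derivative in the imaginary direction in a Wirtinger derivative. -/
def imCoeff (s : Fin n ⊕ Fin n) : ℂ := Sum.elim (fun _ => -Complex.I) (fun _ => Complex.I) s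

/-- One formula for both types of derivative, so that the calculus rules are proved once. -/
theorem wirtinger_eq (s : Fin n ⊕ Fin n) (f : (Fin n → ℂ) → ℂ) (z : Fin n → ℂ) :
    wirtinger s f z = (1 / 2 : ℂ) * (fderiv ℝ f z (Pi.single (dirIndex s) 1) +
      imCoeff s * fderiv ℝ f z (Pi.single (dirIndex s) Complex.I)) := by
  cases s
  · simp only [wirtinger, dz, dirIndex, imCoeff, Sum.elim_inl, id]; ring
  · simp only [wirtinger, dzbar, dirIndex, imCoeff, Sum.elim_inr, id]

theorem fderiv_eq_sum_wirtinger (f : (Fin n → ℂ) → ℂ) (z v : Fin n → ℂ) :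
    fderiv ℝ f z v = ∑ s, wirtinger s f z * coord s v := by
  have hv : v = ∑ k, ((v k).re • (Pi.single k 1 : Fin n → ℂ) +
      (v k).im • (Pi.single k Complex.I : Fin n → ℂ)) := by
    conv_lhs => rw [← Finset.univ_sum_single v]
    refine Finset.sum_congr rfl fun k _ => ?_
    rw [← Pi.single_smul, ← Pi.single_smul, ← Pi.single_add]
    congr 1
    simp
  conv_lhs => rw [hv]
  rw [Fintype.sum_sum_type, map_sum, ← Finset.sum_add_distrib]
  refine Finset.sum_congr rfl fun k _ => ?_
  rw [map_add, map_smul, map_smul]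
  simp only [wirtinger_inl, wirtinger_inr, coord_inl, coord_inr, dz, dzbar, Complex.real_smul]
  have h1 : v k = (v k).re + (v k).im * Complex.I := (Complex.re_add_im _).symm
  have h2 : conj (v k) = (v k).re - (v k).im * Complex.I := by
    apply Complex.ext <;> simp
  generalize ((v k).re : ℂ) = a at *
  generalize ((v k).im : ℂ) = b at *
  rw [h2, h1]
  linear_combination (b * fderiv ℝ f z (Pi.single k Complex.I)) * Complex.I_sq

variable {U : Set (Fin n → ℂ)}

theorem wirtinger_congr (hU : IsOpen U) {f f' : (Fin n → ℂ) → ℂ} (h : Set.EqOn f f' U)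
    (s : Fin n ⊕ Fin n) : Set.EqOn (wirtinger s f) (wirtinger s f') U := by
  intro z hz
  rw [wirtinger_eq, wirtinger_eq, (h.eventuallyEq_of_mem (hU.mem_nhds hz)).fderiv_eq]

theorem contDiffOn_wirtinger (hU : IsOpen U) {f : (Fin n → ℂ) → ℂ} (hf : ContDiffOn ℝ ∞ f U)
    (s : Fin n ⊕ Fin n) : ContDiffOn ℝ ∞ (wirtinger s f) U := by
  have h : ∀ v, ContDiffOn ℝ ∞ (fun z => fderiv ℝ f z v) U := fun v =>
    (hf.fderiv_of_isOpen hU (by simp)).clm_apply contDiffOn_const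
  refine ContDiffOn.congr ?_ fun z _ => wirtinger_eq s f z
  exact contDiffOn_const.mul ((h _).add (contDiffOn_const.mul (h _)))

theorem differentiableAt_of_contDiffOn {E F : Type*} [NormedAddCommGroup E] [NormedSpace ℝ E]
    [NormedAddCommGroup F] [NormedSpace ℝ F] {U : Set E} (hU : IsOpen U) {f : E → F}
    (hf : ContDiffOn ℝ ∞ f U) {z : E} (hz : z ∈ U) :
    DifferentiableAt ℝ f z :=
  (hf.contDiffAt (hU.mem_nhds hz)).differentiableAt (by simp)

theorem wirtinger_const (s : Fin n ⊕ Fin n) (c : ℂ) (z : Fin n → ℂ) :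
    wirtinger s (fun _ => c) z = 0 := by
  rw [wirtinger_eq]; simp

theorem wirtinger_add (s : Fin n ⊕ Fin n) {f g : (Fin n → ℂ) → ℂ} {z : Fin n → ℂ}
    (hf : DifferentiableAt ℝ f z) (hg : DifferentiableAt ℝ g z) :
    wirtinger s (fun w => f w + g w) z = wirtinger s f z + wirtinger s g z := by
  simp only [wirtinger_eq, fderiv_fun_add hf hg, add_apply]; ring

theorem wirtinger_mul (s : Fin n ⊕ Fin n) {f g : (Fin n → ℂ) → ℂ} {z : Fin n → ℂ}
    (hf : DifferentiableAt ℝ f z) (hg : DifferentiableAt ℝ g z) :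
    wirtinger s (fun w => f w * g w) z = wirtinger s f z * g z + f z * wirtinger s g z := by
  simp only [wirtinger_eq, fderiv_fun_mul hf hg, add_apply,
    smul_apply, smul_eq_mul]
  ring

theorem wirtinger_const_mul (s : Fin n ⊕ Fin n) (c : ℂ) {f : (Fin n → ℂ) → ℂ} {z : Fin n → ℂ}
    (hf : DifferentiableAt ℝ f z) :
    wirtinger s (fun w => c * f w) z = c * wirtinger s f z := by
  rw [wirtinger_mul s (differentiableAt_const c) hf, wirtinger_const]; ring

/-- Both sides expand into four values of the second real derivative, which is symmetric. -/
theorem wirtinger_comm (hU : IsOpen U) {f : (Fin n → ℂ) → ℂ} (hf : ContDiffOn ℝ ∞ f U)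
    (s t : Fin n ⊕ Fin n) :
    Set.EqOn (wirtinger s (wirtinger t f)) (wirtinger t (wirtinger s f)) U := by
  intro z hz
  have hd : DifferentiableAt ℝ (fderiv ℝ f) z :=
    differentiableAt_of_contDiffOn hU (hf.fderiv_of_isOpen hU (by simp)) hz
  have hsym : IsSymmSndFDerivAt ℝ f z :=
    (hf.contDiffAt (hU.mem_nhds hz)).isSymmSndFDerivAt
      (by simp only [minSmoothness_of_isRCLikeNormedField]; exact ENat.LEInfty.out)
  have hv : ∀ v, DifferentiableAt ℝ (fun w => fderiv ℝ f w v) z := fun v =>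
    hd.clm_apply (differentiableAt_const v)
  have h2 : ∀ v w, fderiv ℝ (fun x => fderiv ℝ f x v) z w = fderiv ℝ (fderiv ℝ f) z w v := by
    intro v w
    rw [fderiv_clm_apply hd (differentiableAt_const v)]
    simp
  have key : ∀ a b : Fin n ⊕ Fin n, wirtinger a (wirtinger b f) z = (1 / 4 : ℂ) *
      (fderiv ℝ (fderiv ℝ f) z (Pi.single (dirIndex a) 1) (Pi.single (dirIndex b) 1) +
      imCoeff b * fderiv ℝ (fderiv ℝ f) z (Pi.single (dirIndex a) 1)
        (Pi.single (dirIndex b) Complex.I) +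
      imCoeff a * fderiv ℝ (fderiv ℝ f) z (Pi.single (dirIndex a) Complex.I)
        (Pi.single (dirIndex b) 1) +
      imCoeff a * imCoeff b * fderiv ℝ (fderiv ℝ f) z (Pi.single (dirIndex a) Complex.I)
        (Pi.single (dirIndex b) Complex.I)) := by
    intro a b
    have h3 : wirtinger b f = fun w => (1 / 2 : ℂ) * (fderiv ℝ f w (Pi.single (dirIndex b) 1) +
      imCoeff b * fderiv ℝ f w (Pi.single (dirIndex b) Complex.I)) := funext (wirtinger_eq b f)
    rw [h3, wirtinger_const_mul a _ (DifferentiableAt.fun_add (hv _) ((hv _).const_mul _)),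
      wirtinger_add a (hv _) ((hv _).const_mul _), wirtinger_const_mul a _ (hv _),
      wirtinger_eq, wirtinger_eq]
    simp only [h2]
    ring
  rw [key, key, hsym.eq (Pi.single (dirIndex s) 1) (Pi.single (dirIndex t) 1),
    hsym.eq (Pi.single (dirIndex s) 1) (Pi.single (dirIndex t) Complex.I),
    hsym.eq (Pi.single (dirIndex s) Complex.I) (Pi.single (dirIndex t) 1),
    hsym.eq (Pi.single (dirIndex s) Complex.I) (Pi.single (dirIndex t) Complex.I)]
  ring

theorem contDiff_coord (s : Fin n ⊕ Fin n) : ContDiff ℝ ∞ (coord s) := by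
  cases s with
  | inl i => exact contDiff_apply ℝ ℂ i
  | inr i => exact Complex.conjCLE.contDiff.comp (contDiff_apply ℝ ℂ i)

theorem fderiv_coord_comp (s : Fin n ⊕ Fin n) {m : ℕ} {g : (Fin m → ℂ) → (Fin n → ℂ)}
    {z : Fin m → ℂ} (hg : DifferentiableAt ℝ g z) (v : Fin m → ℂ) :
    fderiv ℝ (fun w => coord s (g w)) z v = coord s (fderiv ℝ g z v) := by
  cases s with
  | inl i =>
    have h := ((ContinuousLinearMap.proj i : (Fin n → ℂ) →L[ℝ] ℂ).hasFDerivAt.comp z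
      hg.hasFDerivAt).fderiv
    exact congrArg (fun L : (Fin m → ℂ) →L[ℝ] ℂ => L v) h
  | inr i =>
    have h := (((Complex.conjCLE : ℂ →L[ℝ] ℂ).comp
      (ContinuousLinearMap.proj i : (Fin n → ℂ) →L[ℝ] ℂ)).hasFDerivAt.comp z
      hg.hasFDerivAt).fderiv
    exact congrArg (fun L : (Fin m → ℂ) →L[ℝ] ℂ => L v) h

/-- The chain rule for Wirtinger derivatives. -/
theorem wirtinger_comp {m : ℕ} {f : (Fin n → ℂ) → ℂ} {g : (Fin m → ℂ) → (Fin n → ℂ)}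
    {z : Fin m → ℂ} (hf : DifferentiableAt ℝ f (g z)) (hg : DifferentiableAt ℝ g z)
    (s : Fin m ⊕ Fin m) :
    wirtinger s (fun w => f (g w)) z =
      ∑ t, wirtinger t f (g z) * wirtinger s (fun w => coord t (g w)) z := by
  have h : ∀ v, fderiv ℝ (fun w => f (g w)) z v =
      ∑ t, wirtinger t f (g z) * fderiv ℝ (fun w => coord t (g w)) z v := by
    intro v
    have := (hf.hasFDerivAt.comp z hg.hasFDerivAt).fderiv
    have h2 : fderiv ℝ (fun w => f (g w)) z v = fderiv ℝ f (g z) (fderiv ℝ g z v) :=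
      congrArg (fun L => L v) this
    rw [h2, fderiv_eq_sum_wirtinger]
    exact Finset.sum_congr rfl fun t _ => by rw [fderiv_coord_comp t hg]
  simp only [wirtinger_eq s, h, Finset.mul_sum, ← Finset.sum_add_distrib]
  exact Finset.sum_congr rfl fun t _ => by ring

/-- The conjugate index: `∂_i ↔ ∂̄_i`. -/
theorem wirtinger_conj (s : Fin n ⊕ Fin n) {f : (Fin n → ℂ) → ℂ} {z : Fin n → ℂ}
    (hf : DifferentiableAt ℝ f z) :
    wirtinger s (fun w => conj (f w)) z = conj (wirtinger s.swap f z) := by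
  have h : ∀ v, fderiv ℝ (fun w => conj (f w)) z v = conj (fderiv ℝ f z v) := by
    intro v
    have := ((Complex.conjCLE : ℂ →L[ℝ] ℂ).hasFDerivAt.comp z hf.hasFDerivAt).fderiv
    exact congrArg (fun L : (Fin n → ℂ) →L[ℝ] ℂ => L v) this
  have h2 : conj (2 : ℂ) = 2 := Complex.conj_ofNat 2
  cases s <;> simp [wirtinger_eq, h, imCoeff, dirIndex, h2]

theorem wirtinger_coord (s t : Fin n ⊕ Fin n) (z : Fin n → ℂ) :
    wirtinger s (coord t) z = if s = t then 1 else 0 := by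
  have h : ∀ v, fderiv ℝ (coord t) z v = coord t v := by
    intro v
    have := fderiv_coord_comp t (differentiableAt_id (𝕜 := ℝ) (x := z)) v
    simpa using this
  rw [wirtinger_eq, h, h]
  rcases s with i | i <;> rcases t with j | j <;> rcases eq_or_ne i j with rfl | hij <;>
    simp [imCoeff, dirIndex, *] <;> norm_num

theorem fderiv_apply_of_differentiableAt {m : ℕ} {g : (Fin m → ℂ) → (Fin n → ℂ)}
    {z : Fin m → ℂ} (hg : DifferentiableAt ℂ g z) (k : Fin n) (v : Fin m → ℂ) :
    fderiv ℝ (fun w => g w k) z v = fderiv ℂ g z v k := by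
  have h := fderiv_coord_comp (.inl k) (hg.restrictScalars ℝ) v
  rw [hg.fderiv_restrictScalars ℝ] at h
  exact h

theorem single_I_eq_smul {m : ℕ} (i : Fin m) :
    (Pi.single i Complex.I : Fin m → ℂ) = Complex.I • (Pi.single i 1 : Fin m → ℂ) := by
  rw [← Pi.single_smul, smul_eq_mul, mul_one]

/-- The antiholomorphic derivatives of a holomorphic map vanish. -/
theorem dzbar_apply_of_differentiableAt {m : ℕ} {g : (Fin m → ℂ) → (Fin n → ℂ)} {z : Fin m → ℂ}
    (hg : DifferentiableAt ℂ g z) (i : Fin m) (k : Fin n) : dzbar i (fun w => g w k) z = 0 := by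
  rw [dzbar, fderiv_apply_of_differentiableAt hg, fderiv_apply_of_differentiableAt hg,
    single_I_eq_smul, map_smul, Pi.smul_apply, smul_eq_mul, ← mul_assoc, Complex.I_mul_I]
  ring

theorem dz_apply_of_differentiableAt {m : ℕ} {g : (Fin m → ℂ) → (Fin n → ℂ)} {z : Fin m → ℂ}
    (hg : DifferentiableAt ℂ g z) (i : Fin m) (k : Fin n) :
    dz i (fun w => g w k) z = fderiv ℂ g z (Pi.single i 1) k := by
  rw [dz, fderiv_apply_of_differentiableAt hg, fderiv_apply_of_differentiableAt hg,
    single_I_eq_smul, map_smul, Pi.smul_apply, smul_eq_mul, ← mul_assoc, Complex.I_mul_I]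
  ring

end Wirtinger

end FormalKahler
end

noncomputable section
namespace FormalKahler
open PowerSeries

/-! ### Formal Taylor expansions with increments in an algebra -/

section FormalTaylor

/-- A family of power series without constant terms, the derivatives of which are combinations of
members of the family, vanishes. -/
theorem eq_zero_of_derivX_mem_span {ι A : Type*} [CommRing A] [Algebra ℂ A] (E : ι → A⟦X⟧)
    (h0 : ∀ i, constantCoeff (E i) = 0)
    (h : ∀ i, derivX A (E i) ∈ Ideal.span (Set.range E)) (i : ι) : E i = 0 := by
  -- Divisibility by X ^ m is proved for all members at once: it passes to the ideal they span,
  -- hence to the derivatives, and integration gains one power of X.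
  have key : ∀ m i, X ^ m ∣ E i := by
    intro m
    induction m with
    | zero => intro i; simp
    | succ m ih =>
      intro i
      have hle : Ideal.span (Set.range E) ≤ Ideal.span {X ^ m} := by
        rw [Ideal.span_le]
        rintro _ ⟨j, rfl⟩
        exact Ideal.mem_span_singleton.mpr (ih j)
      have hd := X_pow_dvd_iff.mp (Ideal.mem_span_singleton.mp (hle (h i)))
      rw [X_pow_dvd_iff]
      intro k hk
      cases k with
      | zero => simpa using h0 i
      | succ k => exact coeff_succ_of_derivX (hd k (by omega))
  ext m
  simpa using X_pow_dvd_iff.mp (key (m + 1) i) m (by omega)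

variable {n : ℕ} {R : Type*} [CommRing R] [Algebra ℂ R]

/-- The coefficients of the formal Taylor expansion of `ε ↦ f(z + εp, z̄ + εp̄)`, where the
increments `p` of the variables `z` and `z̄` are arbitrary elements of a commutative algebra. -/
def taylorCoeff (p : Fin n ⊕ Fin n → R) : ℕ → ((Fin n → ℂ) → ℂ) → (Fin n → ℂ) → R
  | 0, f, z => algebraMap ℂ R (f z)
  | N + 1, f, z => algebraMap ℂ R (((N : ℂ) + 1)⁻¹) *
      ∑ s, p s * taylorCoeff p N (wirtinger s f) z

/-- The formal Taylor expansion of `ε ↦ f(z + εp, z̄ + εp̄)`. -/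
def formalTaylor (p : Fin n ⊕ Fin n → R) (f : (Fin n → ℂ) → ℂ) (z : Fin n → ℂ) : R⟦X⟧ :=
  mk fun N => taylorCoeff p N f z

@[simp]
theorem constantCoeff_formalTaylor (p : Fin n ⊕ Fin n → R) (f : (Fin n → ℂ) → ℂ)
    (z : Fin n → ℂ) : constantCoeff (formalTaylor p f z) = algebraMap ℂ R (f z) := by
  rw [← coeff_zero_eq_constantCoeff_apply, formalTaylor, coeff_mk, taylorCoeff]

/-- The factor 1/(N + 1) in `taylorCoeff` is chosen for this equation, from which the expansion's
calculus rules follow. -/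
theorem derivX_formalTaylor (p : Fin n ⊕ Fin n → R) (f : (Fin n → ℂ) → ℂ) (z : Fin n → ℂ) :
    derivX R (formalTaylor p f z) = ∑ s, C (p s) * formalTaylor p (wirtinger s f) z := by
  ext N
  rw [coeff_derivX, formalTaylor, coeff_mk, taylorCoeff, map_sum]
  simp only [coeff_C_mul, formalTaylor, coeff_mk]
  have h : algebraMap ℂ R (((N : ℂ) + 1)⁻¹) * ((N : R) + 1) = 1 := by
    have : (N : R) + 1 = algebraMap ℂ R ((N : ℂ) + 1) := by simp
    rw [this, ← map_mul, inv_mul_cancel₀ (Nat.cast_add_one_ne_zero N), map_one]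
  rw [mul_right_comm, h, one_mul]

variable {U : Set (Fin n → ℂ)}

theorem formalTaylor_congr (hU : IsOpen U) (p : Fin n ⊕ Fin n → R) {f f' : (Fin n → ℂ) → ℂ}
    (h : Set.EqOn f f' U) {z : Fin n → ℂ} (hz : z ∈ U) :
    formalTaylor p f z = formalTaylor p f' z := by
  have key : ∀ N (f f' : (Fin n → ℂ) → ℂ), Set.EqOn f f' U →
      taylorCoeff p N f z = taylorCoeff p N f' z := by
    intro N
    induction N with
    | zero => intro f f' h; rw [taylorCoeff, taylorCoeff, h hz]
    | succ N ih =>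
      intro f f' h
      rw [taylorCoeff, taylorCoeff]
      congr 1
      exact Finset.sum_congr rfl fun s _ => by rw [ih _ _ (wirtinger_congr hU h s)]
  ext N
  simp only [formalTaylor, coeff_mk, key N f f' h]

theorem map_formalTaylor {R' : Type*} [CommRing R'] [Algebra ℂ R'] (φ : R →ₐ[ℂ] R')
    (p : Fin n ⊕ Fin n → R) (f : (Fin n → ℂ) → ℂ) (z : Fin n → ℂ) :
    PowerSeries.map (φ : R →+* R') (formalTaylor p f z) = formalTaylor (fun s => φ (p s)) f z := by
  have key : ∀ N (f : (Fin n → ℂ) → ℂ),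
      φ (taylorCoeff p N f z) = taylorCoeff (fun s => φ (p s)) N f z := by
    intro N
    induction N with
    | zero => intro f; rw [taylorCoeff, taylorCoeff, φ.commutes]
    | succ N ih =>
      intro f
      rw [taylorCoeff, taylorCoeff, map_mul, φ.commutes, map_sum]
      simp only [map_mul, ih]
  ext N
  simp [formalTaylor, key]

theorem formalTaylor_const (p : Fin n ⊕ Fin n → R) (c : ℂ) (z : Fin n → ℂ) :
    formalTaylor p (fun _ => c) z = C (algebraMap ℂ R c) := by
  have hw : ∀ (s : Fin n ⊕ Fin n) (c : ℂ), wirtinger s (fun _ => c) = fun _ => 0 :=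
    fun s c => funext (wirtinger_const s c)
  have h0 : formalTaylor p (fun _ => 0) z = 0 := by
    refine eq_zero_of_derivX_eq_mul (a := ∑ s, C (p s)) ?_ (by simp)
    rw [derivX_formalTaylor, Finset.sum_mul]
    simp only [hw]
  refine sub_eq_zero.mp (eq_zero_of_derivX_eq_mul (a := 0) ?_ (by simp))
  rw [map_sub, derivX_formalTaylor]
  simp [hw, h0]

theorem formalTaylor_zero (hU : IsOpen U) (p : Fin n ⊕ Fin n → R) {f : (Fin n → ℂ) → ℂ}
    (h : ∀ w ∈ U, f w = 0) {z : Fin n → ℂ} (hz : z ∈ U) : formalTaylor p f z = 0 := by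
  rw [formalTaylor_congr hU p (f' := fun _ => 0) h hz, formalTaylor_const]
  simp

/-- The family of errors is indexed by pairs of smooth functions, because differentiation in ε
replaces the pair (f, g) by (∂_s f, ∂_s g). -/
theorem formalTaylor_add (hU : IsOpen U) (p : Fin n ⊕ Fin n → R) {f g : (Fin n → ℂ) → ℂ}
    (hf : ContDiffOn ℝ ∞ f U) (hg : ContDiffOn ℝ ∞ g U) {z : Fin n → ℂ} (hz : z ∈ U) :
    formalTaylor p (fun w => f w + g w) z = formalTaylor p f z + formalTaylor p g z := by
  let ι := {f : (Fin n → ℂ) → ℂ // ContDiffOn ℝ ∞ f U}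
  have key := eq_zero_of_derivX_mem_span (fun q : ι × ι => formalTaylor p
    (fun w => q.1.1 w + q.2.1 w) z - (formalTaylor p q.1.1 z + formalTaylor p q.2.1 z))
    (fun q => by simp) ?_ (⟨f, hf⟩, ⟨g, hg⟩)
  · exact sub_eq_zero.mp key
  rintro ⟨⟨f, hf⟩, ⟨g, hg⟩⟩
  dsimp only
  rw [map_sub, map_add, derivX_formalTaylor, derivX_formalTaylor, derivX_formalTaylor,
    ← Finset.sum_add_distrib, ← Finset.sum_sub_distrib]
  refine Ideal.sum_mem _ fun s _ => ?_
  rw [← mul_add, ← mul_sub]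
  refine Ideal.mul_mem_left _ _ (Ideal.subset_span ⟨(⟨_, contDiffOn_wirtinger hU hf s⟩,
    ⟨_, contDiffOn_wirtinger hU hg s⟩), ?_⟩)
  dsimp only
  congr 1
  refine formalTaylor_congr hU p (fun w hw => ?_) hz
  exact (wirtinger_add s (differentiableAt_of_contDiffOn hU hf hw)
    (differentiableAt_of_contDiffOn hU hg hw)).symm

/-- By the Leibniz rule the derivative of the error of (f, g) combines the errors of (∂_s f, g) and
(f, ∂_s g). -/
theorem formalTaylor_mul (hU : IsOpen U) (p : Fin n ⊕ Fin n → R) {f g : (Fin n → ℂ) → ℂ}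
    (hf : ContDiffOn ℝ ∞ f U) (hg : ContDiffOn ℝ ∞ g U) {z : Fin n → ℂ} (hz : z ∈ U) :
    formalTaylor p (fun w => f w * g w) z = formalTaylor p f z * formalTaylor p g z := by
  let ι := {f : (Fin n → ℂ) → ℂ // ContDiffOn ℝ ∞ f U}
  have key := eq_zero_of_derivX_mem_span (fun q : ι × ι => formalTaylor p
    (fun w => q.1.1 w * q.2.1 w) z - formalTaylor p q.1.1 z * formalTaylor p q.2.1 z)
    (fun q => by simp) ?_ (⟨f, hf⟩, ⟨g, hg⟩)
  · exact sub_eq_zero.mp key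
  rintro ⟨⟨f, hf⟩, ⟨g, hg⟩⟩
  dsimp only
  rw [map_sub, Derivation.leibniz, derivX_formalTaylor, derivX_formalTaylor, derivX_formalTaylor,
    smul_eq_mul, smul_eq_mul, Finset.mul_sum, Finset.mul_sum, ← Finset.sum_add_distrib,
    ← Finset.sum_sub_distrib]
  refine Ideal.sum_mem _ fun s _ => ?_
  have hfs := contDiffOn_wirtinger hU hf s
  have hgs := contDiffOn_wirtinger hU hg s
  have h1 : formalTaylor p (wirtinger s fun w => f w * g w) z =
      formalTaylor p (fun w => wirtinger s f w * g w) z +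
      formalTaylor p (fun w => f w * wirtinger s g w) z := by
    rw [← formalTaylor_add hU p (hfs.mul hg) (hf.mul hgs) hz]
    refine formalTaylor_congr hU p (fun w hw => ?_) hz
    exact wirtinger_mul s (differentiableAt_of_contDiffOn hU hf hw)
      (differentiableAt_of_contDiffOn hU hg hw)
  have h2 : C (p s) * formalTaylor p (wirtinger s fun w => f w * g w) z -
      (formalTaylor p f z * (C (p s) * formalTaylor p (wirtinger s g) z) +
        formalTaylor p g z * (C (p s) * formalTaylor p (wirtinger s f) z)) =
      C (p s) * (formalTaylor p (fun w => wirtinger s f w * g w) z -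
        formalTaylor p (wirtinger s f) z * formalTaylor p g z) +
      C (p s) * (formalTaylor p (fun w => f w * wirtinger s g w) z -
        formalTaylor p f z * formalTaylor p (wirtinger s g) z) := by
    rw [h1]; ring
  rw [h2]
  exact add_mem (Ideal.mul_mem_left _ _ (Ideal.subset_span ⟨(⟨_, hfs⟩, ⟨_, hg⟩), rfl⟩))
    (Ideal.mul_mem_left _ _ (Ideal.subset_span ⟨(⟨_, hf⟩, ⟨_, hgs⟩), rfl⟩))

variable (U) in
/-- The ring of functions which are smooth on `U`. -/
def smoothSubring : Subring ((Fin n → ℂ) → ℂ) where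
  carrier := {f | ContDiffOn ℝ ∞ f U}
  mul_mem' hf hg := ContDiffOn.mul hf hg
  one_mem' := contDiffOn_const
  add_mem' hf hg := ContDiffOn.add hf hg
  zero_mem' := contDiffOn_const
  neg_mem' hf := ContDiffOn.neg hf

/-- The formal Taylor expansion as a ring homomorphism. -/
def formalTaylorHom (hU : IsOpen U) (p : Fin n ⊕ Fin n → R) {z : Fin n → ℂ} (hz : z ∈ U) :
    smoothSubring U →+* R⟦X⟧ where
  toFun f := formalTaylor p f.1 z
  map_one' := (formalTaylor_const p 1 z).trans (by simp)
  map_mul' f g := formalTaylor_mul hU p f.2 g.2 hz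
  map_zero' := (formalTaylor_const p 0 z).trans (by simp)
  map_add' f g := formalTaylor_add hU p f.2 g.2 hz

theorem formalTaylor_sub (hU : IsOpen U) (p : Fin n ⊕ Fin n → R) {f g : (Fin n → ℂ) → ℂ}
    (hf : ContDiffOn ℝ ∞ f U) (hg : ContDiffOn ℝ ∞ g U) {z : Fin n → ℂ} (hz : z ∈ U) :
    formalTaylor p (fun w => f w - g w) z = formalTaylor p f z - formalTaylor p g z :=
  map_sub (formalTaylorHom hU p hz) ⟨f, hf⟩ ⟨g, hg⟩

theorem formalTaylor_sum (hU : IsOpen U) (p : Fin n ⊕ Fin n → R) {ι : Type*} (S : Finset ι)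
    {f : ι → (Fin n → ℂ) → ℂ} (hf : ∀ i, ContDiffOn ℝ ∞ (f i) U) {z : Fin n → ℂ} (hz : z ∈ U) :
    formalTaylor p (fun w => ∑ i ∈ S, f i w) z = ∑ i ∈ S, formalTaylor p (f i) z := by
  have h := map_sum (formalTaylorHom hU p hz)
    (fun i => (⟨f i, hf i⟩ : smoothSubring U)) S
  refine Eq.trans ?_ h
  change _ = formalTaylor p _ z
  congr 1
  ext w
  rw [AddSubmonoidClass.coe_finsetSum, Finset.sum_apply]

theorem formalTaylor_det (hU : IsOpen U) (p : Fin n ⊕ Fin n → R) {ι : Type*} [Fintype ι]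
    [DecidableEq ι] {M : ι → ι → (Fin n → ℂ) → ℂ} (hM : ∀ i j, ContDiffOn ℝ ∞ (M i j) U)
    {z : Fin n → ℂ} (hz : z ∈ U) :
    formalTaylor p (fun w => (Matrix.of fun i j => M i j w).det) z =
      (Matrix.of fun i j => formalTaylor p (M i j) z).det := by
  have h := RingHom.map_det (formalTaylorHom hU p hz)
    (Matrix.of fun i j => (⟨M i j, hM i j⟩ : smoothSubring U))
  refine Eq.trans ?_ h
  change _ = formalTaylor p _ z
  congr 1
  ext w
  have h2 := RingHom.map_det ((Pi.evalRingHom (fun _ : Fin n → ℂ => ℂ) w).comp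
    (smoothSubring U).subtype) (Matrix.of fun i j => (⟨M i j, hM i j⟩ : smoothSubring U))
  exact h2.symm

/-- The formal Taylor expansion does not depend on the increments in directions in which the
function is constant. -/
theorem formalTaylor_eq_of_wirtinger_eq_zero (hU : IsOpen U) (S : Set (Fin n ⊕ Fin n))
    {p p' : Fin n ⊕ Fin n → R} (hp : ∀ s, s ∉ S → p s = p' s) {f : (Fin n → ℂ) → ℂ}
    (hf : ContDiffOn ℝ ∞ f U) (h : ∀ s ∈ S, ∀ w ∈ U, wirtinger s f w = 0)
    {z : Fin n → ℂ} (hz : z ∈ U) : formalTaylor p f z = formalTaylor p' f z := by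
  let ι := {f : (Fin n → ℂ) → ℂ // ContDiffOn ℝ ∞ f U ∧ ∀ s ∈ S, ∀ w ∈ U, wirtinger s f w = 0}
  have key := eq_zero_of_derivX_mem_span (fun f : ι => formalTaylor p f.1 z -
    formalTaylor p' f.1 z) (fun q => by simp) ?_ ⟨f, hf, h⟩
  · exact sub_eq_zero.mp key
  rintro ⟨f, hf, h⟩
  dsimp only
  rw [map_sub, derivX_formalTaylor, derivX_formalTaylor, ← Finset.sum_sub_distrib]
  refine Ideal.sum_mem _ fun s _ => ?_
  -- Directions in S contribute nothing. In the others the increments agree, and ∂_s f is again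
  -- annihilated by S because the derivatives commute.
  by_cases hs : s ∈ S
  · rw [formalTaylor_zero hU p (h s hs) hz, formalTaylor_zero hU p' (h s hs) hz]
    simp
  · rw [hp s hs, ← mul_sub]
    refine Ideal.mul_mem_left _ _ (Ideal.subset_span ⟨⟨_, contDiffOn_wirtinger hU hf s, ?_⟩, rfl⟩)
    intro t ht w hw
    rw [wirtinger_comm hU hf t s hw, wirtinger_congr hU (f' := fun _ => 0) (h t ht) s hw,
      wirtinger_const]

/-- The mixed part of the expansion of a function annihilated by all `∂_i ∂̄_j` vanishes. -/
theorem formalTaylor_pluriharmonic (hU : IsOpen U) (p : Fin n ⊕ Fin n → R)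
    {f : (Fin n → ℂ) → ℂ} (hf : ContDiffOn ℝ ∞ f U)
    (h : ∀ i j, ∀ w ∈ U, dz i (dzbar j f) w = 0) {z : Fin n → ℂ} (hz : z ∈ U) :
    formalTaylor (Sum.elim (fun _ => 0) fun i => p (.inr i)) f z +
      formalTaylor (Sum.elim (fun i => p (.inl i)) fun _ => 0) f z - C (algebraMap ℂ R (f z)) -
      formalTaylor p f z = 0 := by
  -- Since ∂̄_j ∂_i f = 0, the expansion of ∂_i f involves only y, and likewise that of ∂̄_i f only
  -- ȳ. Therefore the combination has zero ε-derivative.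
  have h1 : ∀ i, formalTaylor p (dz i f) z =
      formalTaylor (Sum.elim (fun i => p (.inl i)) fun _ => 0) (dz i f) z := by
    intro i
    refine formalTaylor_eq_of_wirtinger_eq_zero hU (Set.range Sum.inr) ?_
      (contDiffOn_wirtinger hU hf (.inl i)) ?_ hz
    · rintro (j | j) hj
      · rfl
      · exact absurd ⟨j, rfl⟩ hj
    · rintro _ ⟨j, rfl⟩ w hw
      exact (wirtinger_comm hU hf (.inr j) (.inl i) hw).trans (h i j w hw)
  have h2 : ∀ i, formalTaylor p (dzbar i f) z =
      formalTaylor (Sum.elim (fun _ => 0) fun i => p (.inr i)) (dzbar i f) z := by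
    intro i
    refine formalTaylor_eq_of_wirtinger_eq_zero hU (Set.range Sum.inl) ?_
      (contDiffOn_wirtinger hU hf (.inr i)) ?_ hz
    · rintro (j | j) hj
      · exact absurd ⟨j, rfl⟩ hj
      · rfl
    · rintro _ ⟨j, rfl⟩ w hw
      exact h j i w hw
  refine eq_zero_of_derivX_eq_mul (a := 0) ?_ (by simp)
  simp only [map_sub, map_add, derivX_formalTaylor, derivX_C, Fintype.sum_sum_type, Sum.elim_inl,
    Sum.elim_inr, wirtinger_inl, wirtinger_inr, h1, h2]
  simp only [map_zero, zero_mul, Finset.sum_const_zero]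
  ring

/-! ### The universal expansion, with the variables (y, ȳ) as increments -/

section Universal

local notation "𝓡" => MvPolynomial (Fin n ⊕ Fin n) ℂ

/-- The expansion depends on y only through εy, whence the factor X on the right. -/
theorem coeffDerivation_formalTaylor (hU : IsOpen U) {f : (Fin n → ℂ) → ℂ}
    (hf : ContDiffOn ℝ ∞ f U) {z : Fin n → ℂ} (hz : z ∈ U) (s : Fin n ⊕ Fin n) :
    coeffDerivation (MvPolynomial.pderiv s) (formalTaylor (R := 𝓡) MvPolynomial.X f z) =
      X * formalTaylor MvPolynomial.X (wirtinger s f) z := by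
  let ι := {f : (Fin n → ℂ) → ℂ // ContDiffOn ℝ ∞ f U}
  have key := eq_zero_of_derivX_mem_span (fun f : ι => coeffDerivation (MvPolynomial.pderiv s)
    (formalTaylor (R := 𝓡) MvPolynomial.X f.1 z) -
      X * formalTaylor (R := 𝓡) MvPolynomial.X (wirtinger s f.1) z) ?_ ?_ ⟨f, hf⟩
  · exact sub_eq_zero.mp key
  · intro f
    have : constantCoeff (coeffDerivation (MvPolynomial.pderiv s)
        (formalTaylor (R := 𝓡) MvPolynomial.X f.1 z)) = 0 := by
      rw [← coeff_zero_eq_constantCoeff_apply, coeff_coeffDerivation,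
        coeff_zero_eq_constantCoeff_apply, constantCoeff_formalTaylor]
      exact Derivation.map_algebraMap _ _
    simp [this]
  rintro ⟨f, hf⟩
  dsimp only
  have h1 : ∀ t, formalTaylor (R := 𝓡) MvPolynomial.X (wirtinger t (wirtinger s f)) z =
      formalTaylor (R := 𝓡) MvPolynomial.X (wirtinger s (wirtinger t f)) z := fun t =>
    formalTaylor_congr hU _ (wirtinger_comm hU hf t s) hz
  have h2 : derivX 𝓡 (coeffDerivation (MvPolynomial.pderiv s)
      (formalTaylor (R := 𝓡) MvPolynomial.X f z) -
      X * formalTaylor (R := 𝓡) MvPolynomial.X (wirtinger s f) z) =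
      ∑ t, C (MvPolynomial.X t) * (coeffDerivation (MvPolynomial.pderiv s)
        (formalTaylor (R := 𝓡) MvPolynomial.X (wirtinger t f) z) -
        X * formalTaylor (R := 𝓡) MvPolynomial.X (wirtinger s (wirtinger t f)) z) := by
    rw [map_sub, ← coeffDerivation_derivX, derivX_formalTaylor, map_sum, Derivation.leibniz,
      derivX_formalTaylor]
    simp only [Derivation.leibniz, smul_eq_mul, coeffDerivation_C, derivX_X, h1,
      Finset.sum_add_distrib, mul_one, mul_sub, Finset.sum_sub_distrib, MvPolynomial.pderiv_X]
    -- The term from differentiating the increment y_s cancels the one from differentiating the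
    -- factor X in ε.
    have h3 : ∑ t, formalTaylor (R := 𝓡) MvPolynomial.X (wirtinger t f) z *
        C ((Pi.single s 1 : Fin n ⊕ Fin n → 𝓡) t) =
        formalTaylor MvPolynomial.X (wirtinger s f) z := by
      rw [Finset.sum_eq_single s]
      · simp
      · intro t _ ht
        simp [ht]
      · simp
    rw [h3, Finset.mul_sum]
    simp only [mul_left_comm X]
    ring
  rw [h2]
  exact Ideal.sum_mem _ fun t _ => Ideal.mul_mem_left _ _
    (Ideal.subset_span ⟨⟨_, contDiffOn_wirtinger hU hf t⟩, rfl⟩)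

/-- The formal Taylor expansion of a composition is obtained by substitution. -/
theorem substPoly_formalTaylor {m : ℕ} {V : Set (Fin m → ℂ)} (hU : IsOpen U) (hV : IsOpen V)
    {g : (Fin m → ℂ) → (Fin n → ℂ)} (hg : ContDiffOn ℝ ∞ g V) (hgU : Set.MapsTo g V U)
    {f : (Fin n → ℂ) → ℂ} (hf : ContDiffOn ℝ ∞ f U) {z : Fin m → ℂ} (hz : z ∈ V)
    (p : Fin m ⊕ Fin m → R) (u : Fin n ⊕ Fin n → R⟦X⟧)
    (hu : ∀ t, formalTaylor p (fun w => coord t (g w)) z =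
      C (algebraMap ℂ R (coord t (g z))) + X * u t) :
    substPoly u (formalTaylor MvPolynomial.X f (g z)) = formalTaylor p (fun w => f (g w)) z := by
  have hgt : ∀ t : Fin n ⊕ Fin n, ContDiffOn ℝ ∞ (fun w => coord t (g w)) V := fun t =>
    (contDiff_coord t).comp_contDiffOn hg
  let ι := {f : (Fin n → ℂ) → ℂ // ContDiffOn ℝ ∞ f U}
  have key := eq_zero_of_derivX_mem_span (fun f : ι => substPoly u
    (formalTaylor (R := 𝓡) MvPolynomial.X f.1 (g z)) -
      formalTaylor p (fun w => f.1 (g w)) z) ?_ ?_ ⟨f, hf⟩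
  · exact sub_eq_zero.mp key
  · intro f
    have : constantCoeff (substPoly u (formalTaylor (R := 𝓡) MvPolynomial.X f.1 (g z))) =
        algebraMap ℂ R (f.1 (g z)) := by
      rw [substPoly, constantCoeff_substHom, constantCoeff_formalTaylor]
      rw [RingHom.coe_coe, AlgHom.commutes]
      exact constantCoeff_C _
    simp [this]
  rintro ⟨f, hf⟩
  dsimp only
  -- This is the ε-derivative of εu, that is, the velocity of the formal curve g(z + εp). Both sides
  -- of the claim have derivatives contracted with it, so the error for f reduces to the errors for
  -- the ∂_t f.
  have hd : ∀ t, u t + X * derivX R (u t) =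
      derivX R (formalTaylor p (fun w => coord t (g w)) z) := by
    intro t
    rw [hu, map_add, derivX_C, Derivation.leibniz, derivX_X]
    simp only [smul_eq_mul]
    ring
  have h1 : derivX R (substPoly u (formalTaylor (R := 𝓡) MvPolynomial.X f (g z))) =
      ∑ t, substPoly u (formalTaylor (R := 𝓡) MvPolynomial.X (wirtinger t f) (g z)) *
        derivX R (formalTaylor p (fun w => coord t (g w)) z) := by
    rw [derivation_substPoly, derivX_formalTaylor, derivX_X, mul_one, map_sum,
      ← Finset.sum_add_distrib]
    refine Finset.sum_congr rfl fun t _ => ?_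
    rw [coeffDerivation_formalTaylor hU hf (hgU hz), ← hd, map_mul, map_mul, substPoly_X,
      substPoly_C, MvPolynomial.aeval_X]
    ring
  have h2 : derivX R (formalTaylor p (fun w => f (g w)) z) =
      ∑ t, formalTaylor p (fun w => wirtinger t f (g w)) z *
        derivX R (formalTaylor p (fun w => coord t (g w)) z) := by
    rw [derivX_formalTaylor]
    have h3 : ∀ s, formalTaylor p (wirtinger s fun w => f (g w)) z =
        ∑ t, formalTaylor p (fun w => wirtinger t f (g w)) z *
          formalTaylor p (wirtinger s fun w => coord t (g w)) z := by
      intro s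
      have hft : ∀ t, ContDiffOn ℝ ∞ (fun w => wirtinger t f (g w)) V := fun t =>
        (contDiffOn_wirtinger hU hf t).comp hg hgU
      have hgs : ∀ t, ContDiffOn ℝ ∞ (wirtinger s fun w => coord t (g w)) V := fun t =>
        contDiffOn_wirtinger hV (hgt t) s
      simp only [← formalTaylor_mul hV p (hft _) (hgs _) hz]
      rw [← formalTaylor_sum hV p _ (fun t => (hft t).mul (hgs t)) hz]
      refine formalTaylor_congr hV p (fun w hw => ?_) hz
      exact wirtinger_comp (differentiableAt_of_contDiffOn hU hf (hgU hw))
        (differentiableAt_of_contDiffOn hV hg hw) s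
    simp only [h3, derivX_formalTaylor, Finset.mul_sum]
    rw [Finset.sum_comm]
    exact Finset.sum_congr rfl fun t _ => Finset.sum_congr rfl fun s _ => by ring
  rw [map_sub, h1, h2, ← Finset.sum_sub_distrib]
  refine Ideal.sum_mem _ fun t _ => ?_
  rw [← sub_mul]
  exact Ideal.mul_mem_right _ _ (Ideal.subset_span ⟨⟨_, contDiffOn_wirtinger hU hf t⟩, rfl⟩)

end Universal

end FormalTaylor

end FormalKahler
end

noncomputable section
namespace FormalKahler
open PowerSeries

/-! ### Agreement of the multi-index jets with the recursive expansion -/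

section MultiIndex

variable {n : ℕ} {U : Set (Fin n → ℂ)}

theorem contDiffOn_iterate_wirtinger (hU : IsOpen U) (s : Fin n ⊕ Fin n) (k : ℕ)
    {f : (Fin n → ℂ) → ℂ} (hf : ContDiffOn ℝ ∞ f U) :
    ContDiffOn ℝ ∞ ((wirtinger s)^[k] f) U := by
  induction k with
  | zero => exact hf
  | succ k ih => rw [Function.iterate_succ_apply']; exact contDiffOn_wirtinger hU ih s

theorem iterate_wirtinger_congr (hU : IsOpen U) (s : Fin n ⊕ Fin n) (k : ℕ)
    {f f' : (Fin n → ℂ) → ℂ} (h : Set.EqOn f f' U) :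
    Set.EqOn ((wirtinger s)^[k] f) ((wirtinger s)^[k] f') U := by
  induction k with
  | zero => exact h
  | succ k ih =>
    rw [Function.iterate_succ_apply', Function.iterate_succ_apply']
    exact wirtinger_congr hU ih s

theorem wirtinger_iterate_comm (hU : IsOpen U) (s t : Fin n ⊕ Fin n) (k : ℕ)
    {f : (Fin n → ℂ) → ℂ} (hf : ContDiffOn ℝ ∞ f U) :
    Set.EqOn (wirtinger t ((wirtinger s)^[k] f)) ((wirtinger s)^[k] (wirtinger t f)) U := by
  induction k with
  | zero => exact fun _ _ => rfl
  | succ k ih =>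
    rw [Function.iterate_succ_apply', Function.iterate_succ_apply']
    exact (wirtinger_comm hU (contDiffOn_iterate_wirtinger hU s k hf) t s).trans
      (wirtinger_congr hU ih s)

/-- Iterated Wirtinger derivatives along a list of directions. -/
def listDeriv (e : Fin n → Fin n ⊕ Fin n) (l : List (Fin n)) (I : Fin n → ℕ)
    (f : (Fin n → ℂ) → ℂ) : (Fin n → ℂ) → ℂ :=
  l.foldr (fun i F => (wirtinger (e i))^[I i] F) f

theorem listDeriv_cons (e : Fin n → Fin n ⊕ Fin n) (a : Fin n) (l : List (Fin n)) (I : Fin n → ℕ)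
    (f : (Fin n → ℂ) → ℂ) :
    listDeriv e (a :: l) I f = (wirtinger (e a))^[I a] (listDeriv e l I f) := rfl

theorem contDiffOn_listDeriv (hU : IsOpen U) (e : Fin n → Fin n ⊕ Fin n) (l : List (Fin n))
    (I : Fin n → ℕ) {f : (Fin n → ℂ) → ℂ} (hf : ContDiffOn ℝ ∞ f U) :
    ContDiffOn ℝ ∞ (listDeriv e l I f) U := by
  induction l with
  | nil => exact hf
  | cons a l ih => exact contDiffOn_iterate_wirtinger hU _ _ ih

theorem listDeriv_congr (hU : IsOpen U) (e : Fin n → Fin n ⊕ Fin n) (l : List (Fin n))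
    (I : Fin n → ℕ) {f f' : (Fin n → ℂ) → ℂ} (h : Set.EqOn f f' U) :
    Set.EqOn (listDeriv e l I f) (listDeriv e l I f') U := by
  induction l with
  | nil => exact h
  | cons a l ih => exact iterate_wirtinger_congr hU _ _ ih

theorem wirtinger_listDeriv_comm (hU : IsOpen U) (e : Fin n → Fin n ⊕ Fin n) (l : List (Fin n))
    (I : Fin n → ℕ) {f : (Fin n → ℂ) → ℂ} (hf : ContDiffOn ℝ ∞ f U) (t : Fin n ⊕ Fin n) :
    Set.EqOn (wirtinger t (listDeriv e l I f)) (listDeriv e l I (wirtinger t f)) U := by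
  induction l with
  | nil => exact fun _ _ => rfl
  | cons a l ih =>
    exact (wirtinger_iterate_comm hU _ _ _ (contDiffOn_listDeriv hU e l I hf)).trans
      (iterate_wirtinger_congr hU _ _ ih)

theorem listDeriv_add_single_of_notMem (e : Fin n → Fin n ⊕ Fin n) {l : List (Fin n)} {i : Fin n}
    (hi : i ∉ l) (I : Fin n → ℕ) (f : (Fin n → ℂ) → ℂ) :
    listDeriv e l (I + Pi.single i 1) f = listDeriv e l I f := by
  induction l with
  | nil => rfl
  | cons a l ih =>
    rw [List.mem_cons, not_or] at hi
    rw [listDeriv_cons, listDeriv_cons, ih hi.2, Pi.add_apply, Pi.single_eq_of_ne (Ne.symm hi.1),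
      add_zero]

/-- The extra derivative is moved innermost by commutativity; `l.Nodup` ensures that it occurs only
once. -/
theorem listDeriv_add_single (hU : IsOpen U) (e : Fin n → Fin n ⊕ Fin n) {l : List (Fin n)}
    (hl : l.Nodup) {i : Fin n} (hi : i ∈ l) (I : Fin n → ℕ) {f : (Fin n → ℂ) → ℂ}
    (hf : ContDiffOn ℝ ∞ f U) :
    Set.EqOn (listDeriv e l (I + Pi.single i 1) f) (listDeriv e l I (wirtinger (e i) f)) U := by
  induction l with
  | nil => exact absurd hi (by simp)
  | cons a l ih =>
    rw [List.nodup_cons] at hl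
    rw [listDeriv_cons, listDeriv_cons]
    rcases eq_or_ne i a with rfl | hia
    · rw [listDeriv_add_single_of_notMem e hl.1, Pi.add_apply, Pi.single_eq_same,
        Function.iterate_succ_apply]
      exact iterate_wirtinger_congr hU _ _ (wirtinger_listDeriv_comm hU e l I hf _)
    · rw [Pi.add_apply, Pi.single_eq_of_ne hia.symm, add_zero]
      exact iterate_wirtinger_congr hU _ _ (ih hl.2 ((List.mem_cons.mp hi).resolve_left hia))

/-- Euler's identity: write N + 1 as the sum of the I i, then shift I by a unit vector, using I_i /
I! = 1 / (I - e_i)!. -/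
theorem sum_piAntidiag_succ (N : ℕ) (x : Fin n → ℂ) (G : (Fin n → ℕ) → ℂ) :
    ((N : ℂ) + 1) * ∑ I ∈ Finset.piAntidiag (Finset.univ : Finset (Fin n)) (N + 1),
      G I / (∏ i, ((I i).factorial : ℂ)) * ∏ i, x i ^ I i =
    ∑ i, x i * ∑ I ∈ Finset.piAntidiag (Finset.univ : Finset (Fin n)) N,
      G (I + Pi.single i 1) / (∏ i, ((I i).factorial : ℂ)) * ∏ i, x i ^ I i := by
  have h1 : ((N : ℂ) + 1) * ∑ I ∈ Finset.piAntidiag (Finset.univ : Finset (Fin n)) (N + 1),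
      G I / (∏ i, ((I i).factorial : ℂ)) * ∏ i, x i ^ I i =
      ∑ I ∈ Finset.piAntidiag (Finset.univ : Finset (Fin n)) (N + 1), ∑ i,
        (I i : ℂ) * (G I / (∏ i, ((I i).factorial : ℂ)) * ∏ i, x i ^ I i) := by
    rw [Finset.mul_sum]
    refine Finset.sum_congr rfl fun I hI => ?_
    rw [← Finset.sum_mul]
    congr 1
    rw [Finset.mem_piAntidiag] at hI
    exact_mod_cast hI.1.symm
  rw [h1, Finset.sum_comm]
  refine Finset.sum_congr rfl fun i _ => ?_
  rw [Finset.mul_sum]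
  symm
  refine Finset.sum_of_injOn (fun I => I + Pi.single i 1) ?_ ?_ ?_ ?_
  · exact fun I _ J _ h => add_right_cancel h
  · intro I hI
    rw [Finset.mem_coe, Finset.mem_piAntidiag] at hI ⊢
    refine ⟨?_, fun _ _ => Finset.mem_univ _⟩
    simp [Finset.sum_add_distrib, hI.1]
  -- A multi-index outside the image of the shift has I i = 0, so its weighted term vanishes.
  · intro I hI hI'
    have : I i = 0 := by
      by_contra hne
      refine hI' ⟨I - Pi.single i 1, ?_, ?_⟩
      · rw [Finset.mem_coe, Finset.mem_piAntidiag] at *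
        refine ⟨?_, fun _ _ => Finset.mem_univ _⟩
        have h2 : ∑ j, (I - Pi.single i 1 : Fin n → ℕ) j + ∑ j, (Pi.single i 1 : Fin n → ℕ) j = ∑ j, I j := by
          rw [← Finset.sum_add_distrib]
          refine Finset.sum_congr rfl fun j _ => ?_
          rcases eq_or_ne j i with rfl | hj
          · simp; omega
          · simp [hj]
        have h3 : ∑ j, (Pi.single i 1 : Fin n → ℕ) j = 1 := by simp
        have h4 : ∑ j, I j = N + 1 := hI.1
        rw [h3, h4] at h2
        exact Nat.succ_injective h2
      · ext j
        rcases eq_or_ne j i with rfl | hj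
        · simp; omega
        · simp [hj]
    simp [this]
  · intro I _
    have h2 : (∏ j, (((I + Pi.single i 1 : Fin n → ℕ) j).factorial : ℂ)) =
        ((I i : ℂ) + 1) * ∏ j, ((I j).factorial : ℂ) := by
      rw [← Finset.mul_prod_erase _ _ (Finset.mem_univ i),
        ← Finset.mul_prod_erase _ (fun j => ((I j).factorial : ℂ)) (Finset.mem_univ i),
        ← mul_assoc]
      congr 1
      · simp [Nat.factorial_succ]
      · refine Finset.prod_congr rfl fun j hj => ?_
        simp [(Finset.mem_erase.mp hj).1]
    have h3 : (∏ j, x j ^ (I + Pi.single i 1 : Fin n → ℕ) j) = x i * ∏ j, x j ^ I j := by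
      rw [← Finset.mul_prod_erase _ _ (Finset.mem_univ i),
        ← Finset.mul_prod_erase _ (fun j => x j ^ I j) (Finset.mem_univ i), ← mul_assoc]
      congr 1
      · simp [pow_succ, mul_comm]
      · refine Finset.prod_congr rfl fun j hj => ?_
        simp [(Finset.mem_erase.mp hj).1]
    have h4 : (∏ j, ((I j).factorial : ℂ)) ≠ 0 :=
      Finset.prod_ne_zero_iff.mpr fun j _ => Nat.cast_ne_zero.mpr (Nat.factorial_ne_zero _)
    have h5 : ((I i : ℂ) + 1) ≠ 0 := Nat.cast_add_one_ne_zero _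
    rw [h2, h3]
    simp only [Pi.add_apply, Pi.single_eq_same, Nat.cast_add, Nat.cast_one]
    field_simp

/-- The part of bidegree `(P, Q)` of the formal Taylor expansion with increments `p`. -/
def bidegreeTerm (p : Fin n ⊕ Fin n → ℂ) (f : (Fin n → ℂ) → ℂ) (z : Fin n → ℂ) (P Q : ℕ) : ℂ :=
  ∑ I ∈ Finset.piAntidiag (Finset.univ : Finset (Fin n)) P,
    ∑ J ∈ Finset.piAntidiag (Finset.univ : Finset (Fin n)) Q,
      dzMulti I (dzbarMulti J f) z / ((∏ i, ((I i).factorial : ℂ)) * ∏ j, ((J j).factorial : ℂ)) *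
        ((∏ i, p (.inl i) ^ I i) * ∏ j, p (.inr j) ^ J j)

theorem bidegreeTerm_succ_left (hU : IsOpen U) (p : Fin n ⊕ Fin n → ℂ) {f : (Fin n → ℂ) → ℂ}
    (hf : ContDiffOn ℝ ∞ f U) {z : Fin n → ℂ} (hz : z ∈ U) (P Q : ℕ) :
    ((P : ℂ) + 1) * bidegreeTerm p f z (P + 1) Q =
      ∑ i, p (.inl i) * bidegreeTerm p (dz i f) z P Q := by
  have h : ∀ (f : (Fin n → ℂ) → ℂ) (P : ℕ), bidegreeTerm p f z P Q =
      ∑ I ∈ Finset.piAntidiag (Finset.univ : Finset (Fin n)) P,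
        (∑ J ∈ Finset.piAntidiag (Finset.univ : Finset (Fin n)) Q,
          dzMulti I (dzbarMulti J f) z / (∏ j, ((J j).factorial : ℂ)) *
            ∏ j, p (.inr j) ^ J j) / (∏ i, ((I i).factorial : ℂ)) * ∏ i, p (.inl i) ^ I i := by
    intro f P
    refine Finset.sum_congr rfl fun I _ => ?_
    rw [Finset.sum_div, Finset.sum_mul]
    exact Finset.sum_congr rfl fun J _ => by ring
  rw [h, sum_piAntidiag_succ P (fun i => p (.inl i)) (fun I =>
    ∑ J ∈ Finset.piAntidiag (Finset.univ : Finset (Fin n)) Q,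
      dzMulti I (dzbarMulti J f) z / (∏ j, ((J j).factorial : ℂ)) * ∏ j, p (.inr j) ^ J j)]
  refine Finset.sum_congr rfl fun i _ => ?_
  rw [h]
  congr 1
  refine Finset.sum_congr rfl fun I _ => ?_
  congr 2
  refine Finset.sum_congr rfl fun J _ => ?_
  congr 2
  have h1 : dzMulti (I + Pi.single i 1) (dzbarMulti J f) z =
      dzMulti I (dz i (dzbarMulti J f)) z :=
    listDeriv_add_single hU Sum.inl (List.nodup_finRange n) (List.mem_finRange i) I
      (contDiffOn_listDeriv hU Sum.inr (List.finRange n) J hf) hz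
  rw [h1]
  exact listDeriv_congr hU Sum.inl (List.finRange n) I
    (wirtinger_listDeriv_comm hU Sum.inr (List.finRange n) J hf (.inl i)) hz

theorem bidegreeTerm_succ_right (hU : IsOpen U) (p : Fin n ⊕ Fin n → ℂ) {f : (Fin n → ℂ) → ℂ}
    (hf : ContDiffOn ℝ ∞ f U) {z : Fin n → ℂ} (hz : z ∈ U) (P Q : ℕ) :
    ((Q : ℂ) + 1) * bidegreeTerm p f z P (Q + 1) =
      ∑ j, p (.inr j) * bidegreeTerm p (dzbar j f) z P Q := by
  have h : ∀ (f : (Fin n → ℂ) → ℂ) (Q : ℕ), bidegreeTerm p f z P Q =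
      ∑ J ∈ Finset.piAntidiag (Finset.univ : Finset (Fin n)) Q,
        (∑ I ∈ Finset.piAntidiag (Finset.univ : Finset (Fin n)) P,
          dzMulti I (dzbarMulti J f) z / (∏ i, ((I i).factorial : ℂ)) *
            ∏ i, p (.inl i) ^ I i) / (∏ j, ((J j).factorial : ℂ)) * ∏ j, p (.inr j) ^ J j := by
    intro f Q
    rw [bidegreeTerm, Finset.sum_comm]
    refine Finset.sum_congr rfl fun J _ => ?_
    rw [Finset.sum_div, Finset.sum_mul]
    exact Finset.sum_congr rfl fun I _ => by ring
  rw [h, sum_piAntidiag_succ Q (fun j => p (.inr j)) (fun J =>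
    ∑ I ∈ Finset.piAntidiag (Finset.univ : Finset (Fin n)) P,
      dzMulti I (dzbarMulti J f) z / (∏ i, ((I i).factorial : ℂ)) * ∏ i, p (.inl i) ^ I i)]
  refine Finset.sum_congr rfl fun j _ => ?_
  rw [h]
  congr 1
  refine Finset.sum_congr rfl fun J _ => ?_
  congr 2
  refine Finset.sum_congr rfl fun I _ => ?_
  congr 2
  exact listDeriv_congr hU Sum.inl (List.finRange n) I
    (listDeriv_add_single hU Sum.inr (List.nodup_finRange n) (List.mem_finRange j) J hf) hz

theorem bidegreeTerm_zero_zero (p : Fin n ⊕ Fin n → ℂ) (f : (Fin n → ℂ) → ℂ) (z : Fin n → ℂ) :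
    bidegreeTerm p f z 0 0 = f z := by
  have h : ∀ (e : Fin n → Fin n ⊕ Fin n) (l : List (Fin n)), listDeriv e l 0 f = f := by
    intro e l
    induction l with
    | nil => rfl
    | cons a l ih => rw [listDeriv_cons, ih]; rfl
  have h2 : dzMulti 0 (dzbarMulti 0 f) = f := by
    change listDeriv Sum.inl _ 0 (listDeriv Sum.inr _ 0 f) = f
    rw [h, h]
  simp [bidegreeTerm, h2]

/-- Multiplying by N + 1 = P + Q splits the sum into a part that lowers P and a part that lowers Q,
which is the recursion of `taylorCoeff`. -/
theorem sum_bidegreeTerm (hU : IsOpen U) (p : Fin n ⊕ Fin n → ℂ) {z : Fin n → ℂ} (hz : z ∈ U)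
    (N : ℕ) {f : (Fin n → ℂ) → ℂ} (hf : ContDiffOn ℝ ∞ f U) :
    ∑ pq ∈ Finset.HasAntidiagonal.antidiagonal N, bidegreeTerm p f z pq.1 pq.2 =
      taylorCoeff p N f z := by
  induction N generalizing f with
  | zero => simp [bidegreeTerm_zero_zero, taylorCoeff]
  | succ N ih =>
    have hN : ((N : ℂ) + 1) ≠ 0 := Nat.cast_add_one_ne_zero N
    refine mul_left_cancel₀ hN ?_
    rw [taylorCoeff, Algebra.algebraMap_self_apply, mul_inv_cancel_left₀ hN]
    have h1 : ((N : ℂ) + 1) *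
        ∑ pq ∈ Finset.HasAntidiagonal.antidiagonal (N + 1), bidegreeTerm p f z pq.1 pq.2 =
        ∑ pq ∈ Finset.HasAntidiagonal.antidiagonal (N + 1),
          (pq.1 : ℂ) * bidegreeTerm p f z pq.1 pq.2 +
        ∑ pq ∈ Finset.HasAntidiagonal.antidiagonal (N + 1),
          (pq.2 : ℂ) * bidegreeTerm p f z pq.1 pq.2 := by
      rw [Finset.mul_sum, ← Finset.sum_add_distrib]
      refine Finset.sum_congr rfl fun pq hpq => ?_
      rw [Finset.HasAntidiagonal.mem_antidiagonal] at hpq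
      have : (N : ℂ) + 1 = pq.1 + pq.2 := by exact_mod_cast hpq.symm
      rw [this, add_mul]
    rw [h1, Finset.Nat.sum_antidiagonal_succ, Finset.Nat.sum_antidiagonal_succ']
    simp only [Nat.cast_zero, zero_mul, zero_add, Nat.cast_add, Nat.cast_one,
      bidegreeTerm_succ_left hU p hf hz, bidegreeTerm_succ_right hU p hf hz]
    rw [Finset.sum_comm, Finset.sum_comm (t := Finset.univ), Fintype.sum_sum_type]
    simp only [← Finset.mul_sum, wirtinger_inl, wirtinger_inr]
    congr 1
    · exact Finset.sum_congr rfl fun i _ => congrArg _ (ih (contDiffOn_wirtinger hU hf (.inl i)))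
    · exact Finset.sum_congr rfl fun i _ => congrArg _ (ih (contDiffOn_wirtinger hU hf (.inr i)))

theorem jet_eq_formalTaylor (hU : IsOpen U) {f : (Fin n → ℂ) → ℂ} (hf : ContDiffOn ℝ ∞ f U)
    {z : Fin n → ℂ} (hz : z ∈ U) (y : Fin n → ℂ) :
    jet f z y = formalTaylor (fun s => coord s y) f z := by
  ext N
  rw [jet, formalTaylor, coeff_mk, coeff_mk, ← sum_bidegreeTerm hU _ hz N hf]
  rfl

theorem bidegreeTerm_eq_zero_right {p : Fin n ⊕ Fin n → ℂ} (hp : ∀ j, p (.inr j) = 0)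
    (f : (Fin n → ℂ) → ℂ) (z : Fin n → ℂ) (P : ℕ) {Q : ℕ} (hQ : Q ≠ 0) :
    bidegreeTerm p f z P Q = 0 := by
  refine Finset.sum_eq_zero fun I _ => Finset.sum_eq_zero fun J hJ => ?_
  obtain ⟨j, hj⟩ : ∃ j, J j ≠ 0 := by
    by_contra! h
    rw [Finset.mem_piAntidiag] at hJ
    exact hQ (by rw [← hJ.1]; simp [h])
  have : ∏ j, p (.inr j) ^ J j = 0 :=
    Finset.prod_eq_zero (Finset.mem_univ j) (by rw [hp, zero_pow hj])
  rw [this, mul_zero, mul_zero]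

theorem bidegreeTerm_eq_zero_left {p : Fin n ⊕ Fin n → ℂ} (hp : ∀ j, p (.inl j) = 0)
    (f : (Fin n → ℂ) → ℂ) (z : Fin n → ℂ) {P : ℕ} (hP : P ≠ 0) (Q : ℕ) :
    bidegreeTerm p f z P Q = 0 := by
  refine Finset.sum_eq_zero fun I hI => Finset.sum_eq_zero fun J _ => ?_
  obtain ⟨j, hj⟩ : ∃ j, I j ≠ 0 := by
    by_contra! h
    rw [Finset.mem_piAntidiag] at hI
    exact hP (by rw [← hI.1]; simp [h])
  have : ∏ j, p (.inl j) ^ I j = 0 :=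
    Finset.prod_eq_zero (Finset.mem_univ j) (by rw [hp, zero_pow hj])
  rw [this, zero_mul, mul_zero]

theorem jetHol_eq_formalTaylor (hU : IsOpen U) {f : (Fin n → ℂ) → ℂ} (hf : ContDiffOn ℝ ∞ f U)
    {z : Fin n → ℂ} (hz : z ∈ U) (y : Fin n → ℂ) :
    jetHol f z y = formalTaylor (Sum.elim y fun _ => 0) f z := by
  ext N
  rw [jetHol, formalTaylor, coeff_mk, coeff_mk, ← sum_bidegreeTerm hU _ hz N hf,
    Finset.sum_eq_single (N, 0)]
  · refine Finset.sum_congr rfl fun I _ => Finset.sum_congr rfl fun J hJ => ?_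
    simp only [Finset.piAntidiag_zero, Finset.mem_singleton] at hJ
    simp [hJ]
  · rintro ⟨P, Q⟩ hPQ hne
    rw [Finset.HasAntidiagonal.mem_antidiagonal] at hPQ
    refine bidegreeTerm_eq_zero_right (fun _ => rfl) f z P ?_
    rintro rfl
    exact hne (by simpa using hPQ)
  · intro h; exact absurd (by simp) h

theorem jetAntihol_eq_formalTaylor (hU : IsOpen U) {f : (Fin n → ℂ) → ℂ}
    (hf : ContDiffOn ℝ ∞ f U) {z : Fin n → ℂ} (hz : z ∈ U) (y : Fin n → ℂ) :
    jetAntihol f z y = formalTaylor (Sum.elim (fun _ => 0) fun j => conj (y j)) f z := by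
  ext N
  rw [jetAntihol, formalTaylor, coeff_mk, coeff_mk, ← sum_bidegreeTerm hU _ hz N hf,
    Finset.sum_eq_single (0, N)]
  · refine Finset.sum_congr rfl fun I hI => Finset.sum_congr rfl fun J _ => ?_
    simp only [Finset.piAntidiag_zero, Finset.mem_singleton] at hI
    simp [hI]
  · rintro ⟨P, Q⟩ hPQ hne
    rw [Finset.HasAntidiagonal.mem_antidiagonal] at hPQ
    refine bidegreeTerm_eq_zero_left (fun _ => rfl) f z ?_ Q
    rintro rfl
    exact hne (by simpa using hPQ)
  · intro h; exact absurd (by simp) h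

end MultiIndex

end FormalKahler
end

noncomputable section
namespace FormalKahler
open PowerSeries

/-! ### Gaussian integrals of polynomials in (y, ȳ) -/

section Gaussian

variable {n : ℕ}

/-- Evaluation of a polynomial in `(y, ȳ)`. -/
def evalPoly (y : Fin n → ℂ) : MvPolynomial (Fin n ⊕ Fin n) ℂ →ₐ[ℂ] ℂ :=
  MvPolynomial.aeval fun s => coord s y

@[simp]
theorem evalPoly_X (y : Fin n → ℂ) (s : Fin n ⊕ Fin n) :
    evalPoly y (MvPolynomial.X s) = coord s y := by simp [evalPoly]

@[simp]
theorem evalPoly_C (y : Fin n → ℂ) (c : ℂ) : evalPoly y (MvPolynomial.C c) = c := by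
  simp [evalPoly]

theorem contDiff_evalPoly (P : MvPolynomial (Fin n ⊕ Fin n) ℂ) :
    ContDiff ℝ ∞ fun y => evalPoly y P := by
  induction P using MvPolynomial.induction_on with
  | C c => simpa using contDiff_const
  | add p q hp hq => simpa using hp.add hq
  | mul_X p s hp => simpa using hp.mul (contDiff_coord s)

/-- The bridge from algebra to analysis: for ∂ and ∂̄ the functions y and ȳ behave as independent
variables. -/
theorem wirtinger_evalPoly (s : Fin n ⊕ Fin n) (P : MvPolynomial (Fin n ⊕ Fin n) ℂ)
    (y : Fin n → ℂ) :
    wirtinger s (fun y => evalPoly y P) y = evalPoly y (MvPolynomial.pderiv s P) := by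
  have hd : ∀ P : MvPolynomial (Fin n ⊕ Fin n) ℂ,
      DifferentiableAt ℝ (fun y => evalPoly y P) y := fun P =>
    (contDiff_evalPoly P).differentiable (by simp) y
  induction P using MvPolynomial.induction_on with
  | C c => simpa using wirtinger_const s c y
  | add p q hp hq =>
    simp only [map_add]
    rw [wirtinger_add s (hd p) (hd q), hp, hq]
  | mul_X p t hp =>
    simp only [map_mul, evalPoly_X, Derivation.leibniz, smul_eq_mul, map_add,
      MvPolynomial.pderiv_X]
    rw [wirtinger_mul s (hd p) ((contDiff_coord t).differentiable (by simp) y), hp,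
      wirtinger_coord]
    rcases eq_or_ne s t with rfl | hst
    · simp; ring
    · simp [hst, mul_comm]

theorem norm_coord_le (s : Fin n ⊕ Fin n) (y : Fin n → ℂ) : ‖coord s y‖ ≤ ‖y‖ := by
  cases s with
  | inl i => exact norm_le_pi_norm y i
  | inr i => rw [coord_inr, RCLike.norm_conj]; exact norm_le_pi_norm y i

theorem exists_norm_evalPoly_le (P : MvPolynomial (Fin n ⊕ Fin n) ℂ) :
    ∃ C : ℝ, ∃ K : ℕ, 0 ≤ C ∧ ∀ y, ‖evalPoly y P‖ ≤ C * (1 + ‖y‖) ^ K := by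
  induction P using MvPolynomial.induction_on with
  | C c => exact ⟨‖c‖, 0, norm_nonneg _, fun y => by simp⟩
  | add p q hp hq =>
    obtain ⟨C₁, K₁, h₁, hp⟩ := hp
    obtain ⟨C₂, K₂, h₂, hq⟩ := hq
    refine ⟨C₁ + C₂, K₁ + K₂, by positivity, fun y => ?_⟩
    have hy : 1 ≤ 1 + ‖y‖ := by linarith [norm_nonneg y]
    calc ‖evalPoly y (p + q)‖ ≤ ‖evalPoly y p‖ + ‖evalPoly y q‖ := by
          rw [map_add]; exact norm_add_le _ _
      _ ≤ C₁ * (1 + ‖y‖) ^ K₁ + C₂ * (1 + ‖y‖) ^ K₂ := add_le_add (hp y) (hq y)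
      _ ≤ C₁ * (1 + ‖y‖) ^ (K₁ + K₂) + C₂ * (1 + ‖y‖) ^ (K₁ + K₂) := by
          gcongr <;> first | exact hy | omega
      _ = _ := by ring
  | mul_X p s hp =>
    obtain ⟨C, K, h, hp⟩ := hp
    refine ⟨C, K + 1, h, fun y => ?_⟩
    rw [map_mul, norm_mul, evalPoly_X, pow_succ, ← mul_assoc]
    have := norm_coord_le s y
    exact mul_le_mul (hp y) (by linarith) (norm_nonneg _) (by positivity)

/-- The Hermitian form `∑ M_{ij} y^i ȳ^j`, as a polynomial. -/
def hermPoly (M : Matrix (Fin n) (Fin n) ℂ) : MvPolynomial (Fin n ⊕ Fin n) ℂ :=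
  ∑ i, ∑ j, MvPolynomial.C (M i j) * MvPolynomial.X (.inl i) * MvPolynomial.X (.inr j)

theorem evalPoly_hermPoly (M : Matrix (Fin n) (Fin n) ℂ) (y : Fin n → ℂ) :
    evalPoly y (hermPoly M) = ∑ i, ∑ j, M i j * y i * conj (y j) := by
  simp [hermPoly]

/-- The form `∑ M_{ij} y^i ȳ^j` is positive. -/
def IsPosForm (M : Matrix (Fin n) (Fin n) ℂ) : Prop :=
  ∀ y : Fin n → ℂ, y ≠ 0 → 0 < (evalPoly y (hermPoly M)).re

/-- The form is homogeneous of degree two and has a positive minimum on the compact unit sphere. -/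
theorem IsPosForm.exists_le {M : Matrix (Fin n) (Fin n) ℂ} (hM : IsPosForm M) :
    ∃ c : ℝ, 0 < c ∧ ∀ y, c * ‖y‖ ^ 2 ≤ (evalPoly y (hermPoly M)).re := by
  have hsmul : ∀ (r : ℝ) (y : Fin n → ℂ), (evalPoly (r • y) (hermPoly M)).re =
      r ^ 2 * (evalPoly y (hermPoly M)).re := by
    intro r y
    have : evalPoly (r • y) (hermPoly M) = ((r ^ 2 : ℝ) : ℂ) * evalPoly y (hermPoly M) := by
      simp only [evalPoly_hermPoly, Finset.mul_sum, Pi.smul_apply, Complex.real_smul, map_mul,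
        Complex.conj_ofReal]
      refine Finset.sum_congr rfl fun i _ => Finset.sum_congr rfl fun j _ => ?_
      push_cast
      ring
    rw [this, Complex.re_ofReal_mul]
  have hcont : Continuous fun y => (evalPoly y (hermPoly M)).re :=
    Complex.continuous_re.comp (contDiff_evalPoly (hermPoly M)).continuous
  obtain ⟨c, hc, h⟩ : ∃ c : ℝ, 0 < c ∧
      ∀ y ∈ Metric.sphere (0 : Fin n → ℂ) 1, c ≤ (evalPoly y (hermPoly M)).re := by
    -- The sphere is empty when n = 0.
    rcases (Metric.sphere (0 : Fin n → ℂ) 1).eq_empty_or_nonempty with he | hne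
    · exact ⟨1, one_pos, fun y hy => by simp [he] at hy⟩
    · obtain ⟨x, hx, hmin⟩ := (isCompact_sphere (0 : Fin n → ℂ) 1).exists_isMinOn hne
        hcont.continuousOn
      refine ⟨_, hM x ?_, fun y hy => hmin hy⟩
      rintro rfl
      simp at hx
  refine ⟨c, hc, fun y => ?_⟩
  rcases eq_or_ne y 0 with rfl | hy
  · have := hsmul 0 0
    simp at this
    simp [this]
  · have hy' : ‖y‖ ≠ 0 := norm_ne_zero_iff.mpr hy
    have h1 := h (‖y‖⁻¹ • y) (by simp [norm_smul, hy'])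
    have h2 : y = ‖y‖ • (‖y‖⁻¹ • y) := by rw [smul_smul, mul_inv_cancel₀ hy', one_smul]
    rw [h2, hsmul, ← h2, mul_comm]
    gcongr

theorem integrable_evalPoly_mul_exp {M : Matrix (Fin n) (Fin n) ℂ} (hM : IsPosForm M)
    (P : MvPolynomial (Fin n ⊕ Fin n) ℂ) :
    MeasureTheory.Integrable fun y : Fin n → ℂ =>
      evalPoly y P * Complex.exp (-evalPoly y (hermPoly M)) := by
  obtain ⟨c, hc, hle⟩ := hM.exists_le
  obtain ⟨D, K, hD, hP⟩ := exists_norm_evalPoly_le P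
  -- An exponent above the real dimension makes (1 + ‖y‖)^(-r) an integrable majorant.
  set r : ℕ := Module.finrank ℝ (Fin n → ℂ) + 1 with hr
  have hint : MeasureTheory.Integrable
      (fun y : Fin n → ℂ => (1 + ‖y‖) ^ (-(r : ℝ))) MeasureTheory.volume :=
    integrable_one_add_norm (by rw [hr]; push_cast; linarith)
  refine (hint.const_mul (D * ((K + r).factorial * Real.exp (1 + 1 / (4 * c))))).mono' ?_ ?_
  · exact (((contDiff_evalPoly P).continuous).mul (Complex.continuous_exp.comp
      (contDiff_evalPoly (hermPoly M)).continuous.neg)).aestronglyMeasurable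
  · refine Filter.Eventually.of_forall fun y => ?_
    have ht : 0 ≤ ‖y‖ := norm_nonneg y
    set t := ‖y‖
    have h1 : (1 + t) ^ (K + r) ≤ (K + r).factorial * Real.exp (1 + t) := by
      have := Real.pow_div_factorial_le_exp (1 + t) (by positivity) (K + r)
      rwa [div_le_iff₀ (by positivity), mul_comm] at this
    have h2 : (1 + t) ^ (K + r) * Real.exp (-(c * t ^ 2)) ≤
        (K + r).factorial * Real.exp (1 + 1 / (4 * c)) := by
      calc (1 + t) ^ (K + r) * Real.exp (-(c * t ^ 2))
          ≤ (K + r).factorial * Real.exp (1 + t) * Real.exp (-(c * t ^ 2)) := by gcongr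
        _ = (K + r).factorial * Real.exp (1 + t + -(c * t ^ 2)) := by rw [mul_assoc, ← Real.exp_add]
        _ ≤ _ := by
          refine mul_le_mul_of_nonneg_left (Real.exp_le_exp.mpr ?_) (by positivity)
          -- Completing the square: t - c t² is at most 1/(4c).
          have h3 : 1 / (4 * c) - (t - c * t ^ 2) = c * (t - 1 / (2 * c)) ^ 2 := by
            field_simp; ring
          have h4 : 0 ≤ c * (t - 1 / (2 * c)) ^ 2 := by positivity
          linarith
    have h5 : (1 + t) ^ (-(r : ℝ)) = ((1 + t) ^ r)⁻¹ := by
      rw [Real.rpow_neg (by positivity), Real.rpow_natCast]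
    rw [norm_mul, Complex.norm_exp, Complex.neg_re, h5]
    calc ‖evalPoly y P‖ * Real.exp (-(evalPoly y (hermPoly M)).re)
        ≤ D * (1 + t) ^ K * Real.exp (-(c * t ^ 2)) := by
          gcongr
          · exact hP y
          · exact hle y
      _ = D * ((1 + t) ^ (K + r) * Real.exp (-(c * t ^ 2))) * ((1 + t) ^ r)⁻¹ := by
          rw [pow_add]
          field_simp
      _ ≤ _ := by gcongr

/-- The Gaussian integral of polynomials against `exp (-(My, y))`. -/
def gaussian {M : Matrix (Fin n) (Fin n) ℂ} (hM : IsPosForm M) :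
    MvPolynomial (Fin n ⊕ Fin n) ℂ →ₗ[ℂ] ℂ where
  toFun P := ∫ y : Fin n → ℂ, evalPoly y P * Complex.exp (-evalPoly y (hermPoly M))
  map_add' P Q := by
    simp only [map_add, add_mul]
    exact MeasureTheory.integral_add (integrable_evalPoly_mul_exp hM P)
      (integrable_evalPoly_mul_exp hM Q)
  map_smul' c P := by
    simp only [map_smul, smul_mul_assoc, RingHom.id_apply]
    exact MeasureTheory.integral_smul c _

theorem gaussian_apply {M : Matrix (Fin n) (Fin n) ℂ} (hM : IsPosForm M)
    (P : MvPolynomial (Fin n ⊕ Fin n) ℂ) : gaussian hM P =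
      ∫ y : Fin n → ℂ, evalPoly y P * Complex.exp (-evalPoly y (hermPoly M)) := rfl

theorem wirtinger_exp_neg (s : Fin n ⊕ Fin n) {f : (Fin n → ℂ) → ℂ} {z : Fin n → ℂ}
    (hf : DifferentiableAt ℝ f z) :
    wirtinger s (fun w => Complex.exp (-f w)) z = -(wirtinger s f z * Complex.exp (-f z)) := by
  have h : ∀ v, fderiv ℝ (fun w => Complex.exp (-f w)) z v =
      -(fderiv ℝ f z v * Complex.exp (-f z)) := by
    intro v
    have h := hf.hasFDerivAt.fun_neg.cexp.fderiv
    rw [h]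
    simp [mul_comm]
  simp only [wirtinger_eq, h]
  ring

/-- Integration by parts against the constant function 1. -/
theorem integral_fderiv_eq_zero {F : (Fin n → ℂ) → ℂ} (hF : Differentiable ℝ F)
    (hint : MeasureTheory.Integrable F) (v : Fin n → ℂ)
    (hint' : MeasureTheory.Integrable fun y => fderiv ℝ F y v) :
    ∫ y, fderiv ℝ F y v = 0 := by
  have h := integral_mul_fderiv_eq_neg_fderiv_mul_of_integrable (μ := MeasureTheory.volume)
    (f := fun _ : Fin n → ℂ => (1 : ℂ)) (g := F) (v := v) (by simp) (by simpa using hint')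
    (by simpa using hint) (fun x _ => differentiableAt_const _) (fun x _ => hF x)
  simpa using h

/-- Integration by parts against the Gaussian weight. -/
theorem gaussian_pderiv {M : Matrix (Fin n) (Fin n) ℂ} (hM : IsPosForm M) (s : Fin n ⊕ Fin n)
    (P : MvPolynomial (Fin n ⊕ Fin n) ℂ) :
    gaussian hM (MvPolynomial.pderiv s P - P * MvPolynomial.pderiv s (hermPoly M)) = 0 := by
  set F : (Fin n → ℂ) → ℂ := fun y => evalPoly y P * Complex.exp (-evalPoly y (hermPoly M)) with hF
  have hd : ∀ P : MvPolynomial (Fin n ⊕ Fin n) ℂ,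
      Differentiable ℝ (fun y => evalPoly y P) := fun P =>
    (contDiff_evalPoly P).differentiable (by simp)
  have hde : Differentiable ℝ fun y => Complex.exp (-evalPoly y (hermPoly M)) :=
    fun y => ((hd (hermPoly M) y).neg).cexp
  have hFd : Differentiable ℝ F := (hd P).mul hde
  have hw : ∀ t y, wirtinger t F y = evalPoly y (MvPolynomial.pderiv t P -
      P * MvPolynomial.pderiv t (hermPoly M)) * Complex.exp (-evalPoly y (hermPoly M)) := by
    intro t y
    rw [hF, wirtinger_mul t (hd P y) (hde y), wirtinger_exp_neg t (hd _ y), wirtinger_evalPoly,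
      wirtinger_evalPoly, map_sub, map_mul]
    ring
  have hint' : ∀ v, MeasureTheory.Integrable fun y => fderiv ℝ F y v := by
    intro v
    simp only [fderiv_eq_sum_wirtinger, hw]
    exact MeasureTheory.integrable_finsetSum _ fun t _ =>
      (integrable_evalPoly_mul_exp hM _).mul_const _
  have h0 : ∀ v, ∫ y, fderiv ℝ F y v = 0 := fun v =>
    integral_fderiv_eq_zero hFd (integrable_evalPoly_mul_exp hM P) v (hint' v)
  rw [gaussian_apply]
  simp only [← hw, wirtinger_eq]
  rw [MeasureTheory.integral_const_mul, MeasureTheory.integral_add (hint' _)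
    ((hint' _).const_mul _), MeasureTheory.integral_const_mul, h0, h0]
  simp

/-- Linear change of variables on `ℂⁿ`. -/
theorem integral_comp_mulVec {A : Matrix (Fin n) (Fin n) ℂ} (hA : IsUnit A.det)
    (F : (Fin n → ℂ) → ℂ) :
    ∫ y : Fin n → ℂ, F (A.mulVec y) * (A.det * conj A.det) = ∫ y, F y := by
  set L : (Fin n → ℂ) →L[ℝ] (Fin n → ℂ) :=
    LinearMap.toContinuousLinearMap ((Matrix.mulVecLin A).restrictScalars ℝ) with hL
  have hLA : ∀ y, L y = A.mulVec y := fun y => rfl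
  have hbij : Function.Bijective L :=
    ⟨Matrix.mulVec_injective_of_isUnit ((Matrix.isUnit_iff_isUnit_det A).mpr hA),
      Matrix.mulVec_surjective_iff_isUnit.mpr ((Matrix.isUnit_iff_isUnit_det A).mpr hA)⟩
  -- The real determinant of a complex linear map is the norm from ℂ to ℝ of its complex
  -- determinant.
  have hdet : L.det = Complex.normSq A.det := by
    have h : L.det = LinearMap.det ((Matrix.mulVecLin A).restrictScalars ℝ) := rfl
    rw [h, LinearMap.det_restrictScalars, Algebra.norm_complex_apply, ← Matrix.toLin'_apply',
      LinearMap.det_toLin']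
  have h := MeasureTheory.integral_image_eq_integral_abs_det_fderiv_smul MeasureTheory.volume
    MeasurableSet.univ (f := L) (f' := fun _ => L)
    (fun x _ => L.hasFDerivAt.hasFDerivWithinAt) hbij.1.injOn F
  rw [Set.image_univ, hbij.2.range_eq, MeasureTheory.setIntegral_univ,
    MeasureTheory.setIntegral_univ, hdet, abs_of_nonneg (Complex.normSq_nonneg _)] at h
  rw [h]
  refine MeasureTheory.integral_congr_ae (Filter.Eventually.of_forall fun y => ?_)
  simp only [hLA, Complex.real_smul, Complex.mul_conj]
  ring

/-- The matrix of the form `M` in linearly changed coordinates. -/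
def pullbackForm (M A : Matrix (Fin n) (Fin n) ℂ) : Matrix (Fin n) (Fin n) ℂ :=
  Matrix.of fun i j => ∑ k, ∑ l, A k i * M k l * conj (A l j)

theorem evalPoly_hermPoly_pullbackForm (M A : Matrix (Fin n) (Fin n) ℂ) (y : Fin n → ℂ) :
    evalPoly y (hermPoly (pullbackForm M A)) = evalPoly (A.mulVec y) (hermPoly M) := by
  simp only [evalPoly_hermPoly, pullbackForm, Matrix.of_apply, Matrix.mulVec, dotProduct, map_sum,
    map_mul, Finset.sum_mul, Finset.mul_sum]
  have h1 : ∀ G : Fin n → Fin n → Fin n → Fin n → ℂ,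
      ∑ i, ∑ j, ∑ k, ∑ l, G i j k l = ∑ k, ∑ l, ∑ i, ∑ j, G i j k l := by
    intro G
    calc ∑ i, ∑ j, ∑ k, ∑ l, G i j k l = ∑ i, ∑ k, ∑ j, ∑ l, G i j k l :=
          Finset.sum_congr rfl fun i _ => Finset.sum_comm
      _ = ∑ k, ∑ i, ∑ j, ∑ l, G i j k l := Finset.sum_comm
      _ = ∑ k, ∑ i, ∑ l, ∑ j, G i j k l :=
          Finset.sum_congr rfl fun i _ => Finset.sum_congr rfl fun j _ => Finset.sum_comm
      _ = _ := Finset.sum_congr rfl fun i _ => Finset.sum_comm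
  rw [h1]
  refine Finset.sum_congr rfl fun k _ => Finset.sum_congr rfl fun l _ => ?_
  rw [Finset.sum_comm]
  refine Finset.sum_congr rfl fun j _ => Finset.sum_congr rfl fun i _ => ?_
  ring

theorem IsPosForm.pullbackForm {M A : Matrix (Fin n) (Fin n) ℂ} (hM : IsPosForm M)
    (hA : IsUnit A.det) : IsPosForm (pullbackForm M A) := by
  intro y hy
  rw [evalPoly_hermPoly_pullbackForm]
  refine hM _ fun h => hy ?_
  refine Matrix.mulVec_injective_of_isUnit ((Matrix.isUnit_iff_isUnit_det A).mpr hA) ?_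
  rw [h, Matrix.mulVec_zero]

/-- The Gaussian integrals in linearly changed coordinates. -/
theorem gaussian_pullbackForm {M A : Matrix (Fin n) (Fin n) ℂ} (hM : IsPosForm M)
    (hA : IsUnit A.det) (hM' : IsPosForm (FormalKahler.pullbackForm M A))
    {P P' : MvPolynomial (Fin n ⊕ Fin n) ℂ}
    (h : ∀ y, evalPoly y P' = evalPoly (A.mulVec y) P * (A.det * conj A.det)) :
    gaussian hM' P' = gaussian hM P := by
  rw [gaussian_apply, gaussian_apply, ← integral_comp_mulVec hA fun y =>
    evalPoly y P * Complex.exp (-evalPoly y (hermPoly M))]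
  refine MeasureTheory.integral_congr_ae (Filter.Eventually.of_forall fun y => ?_)
  simp only [h, evalPoly_hermPoly_pullbackForm]
  ring

end Gaussian

end FormalKahler
end

noncomputable section
namespace FormalKahler

/-! ### Smoothness of holomorphic maps of several variables -/

section Holomorphic

open Metric MeasureTheory

variable {n : ℕ} {U : Set (Fin n → ℂ)}

/-- The directional derivatives of a holomorphic function of several variables are holomorphic. -/
theorem differentiableOn_fderiv_apply (hU : IsOpen U) {f : (Fin n → ℂ) → ℂ}
    (hf : DifferentiableOn ℂ f U) (v : Fin n → ℂ) :
    DifferentiableOn ℂ (fun z => fderiv ℂ f z v) U := by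
  intro z₀ hz₀
  refine DifferentiableAt.differentiableWithinAt ?_
  -- Room for three moves: z varies within s of z₀, the Cauchy circle adds at most s, and the bound
  -- on the derivative uses a further ball of radius s.
  obtain ⟨s, hs, hsU⟩ : ∃ s : ℝ, 0 < s ∧ closedBall z₀ (4 * s) ⊆ U := by
    obtain ⟨ε, hε, h⟩ := Metric.isOpen_iff.mp hU z₀ hz₀
    refine ⟨ε / 8, by positivity, (closedBall_subset_ball ?_).trans h⟩
    linarith
  obtain ⟨B, hB⟩ := (isCompact_closedBall z₀ (4 * s)).exists_bound_of_continuousOn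
    (hf.continuousOn.mono hsU)
  have hbound : ∀ x ∈ closedBall z₀ (2 * s), ‖fderiv ℂ f x‖ ≤ (2 * B) / s := by
    intro x hx
    have hsub : ball x s ⊆ closedBall z₀ (4 * s) := by
      intro w hw
      rw [mem_closedBall] at hx ⊢
      rw [mem_ball] at hw
      linarith [dist_triangle w x z₀]
    refine Complex.norm_fderiv_le_div_of_mapsTo_ball (hf.mono (hsub.trans hsU)) ?_ hs
    intro w hw
    rw [mem_closedBall, dist_eq_norm]
    linarith [norm_sub_le (f w) (f x), hB w (hsub hw), hB x (hsub (mem_ball_self hs))]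
  set δ : ℝ := s / (‖v‖ + 1) with hδ
  have hδ0 : 0 < δ := by positivity
  have hδv : δ * ‖v‖ ≤ s := by
    rw [hδ, div_mul_eq_mul_div, div_le_iff₀ (by positivity)]
    nlinarith [norm_nonneg v]
  have hmem : ∀ x ∈ ball z₀ s, ∀ t : ℂ, ‖t‖ ≤ δ → x + t • v ∈ closedBall z₀ (2 * s) := by
    intro x hx t ht
    rw [mem_ball, dist_eq_norm] at hx
    rw [mem_closedBall, dist_eq_norm]
    have h1 : ‖t • v‖ ≤ s := by
      rw [norm_smul]
      exact (mul_le_mul_of_nonneg_right ht (norm_nonneg v)).trans hδv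
    calc ‖x + t • v - z₀‖ = ‖(x - z₀) + t • v‖ := by congr 1; abel
      _ ≤ ‖x - z₀‖ + ‖t • v‖ := norm_add_le _ _
      _ ≤ 2 * s := by linarith
  have hsub2 : closedBall z₀ (2 * s) ⊆ U := (closedBall_subset_closedBall (by linarith)).trans hsU
  have hdiff : ∀ x ∈ ball z₀ s, ∀ t : ℂ, ‖t‖ ≤ δ → DifferentiableAt ℂ f (x + t • v) :=
    fun x hx t ht => hf.differentiableAt (hU.mem_nhds (hsub2 (hmem x hx t ht)))
  set w : ℝ → ℂ := fun θ => circleMap 0 δ θ with hw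
  have hwn : ∀ θ, ‖w θ‖ = δ := fun θ => by simp [hw, abs_of_pos hδ0]
  have hw0 : ∀ θ, w θ ≠ 0 := fun θ => by rw [← norm_ne_zero_iff, hwn]; exact hδ0.ne'
  have hwc : Continuous w := continuous_circleMap 0 δ
  set c : ℝ → ℂ := fun θ => (w θ * Complex.I) * (1 / (w θ) ^ 2) with hc
  have hcc : Continuous c := (hwc.mul continuous_const).mul
    (continuous_const.div (hwc.pow 2) fun θ => pow_ne_zero 2 (hw0 θ))
  have hcn : ∀ θ, ‖c θ‖ = δ⁻¹ := by
    intro θ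
    simp only [hc, norm_mul, norm_div, norm_pow, hwn, Complex.norm_I, norm_one]
    field_simp
  -- Cauchy's formula on the complex line through x in direction v. Its integrand contains f alone,
  -- so it can be differentiated in x under the integral sign.
  have hformula : ∀ x ∈ ball z₀ s, fderiv ℂ f x v =
      (2 * Real.pi * Complex.I)⁻¹ * ∫ θ in (0 : ℝ)..2 * Real.pi, c θ * f (x + w θ • v) := by
    intro x hx
    have hline : ∀ t : ℂ, HasDerivAt (fun t : ℂ => x + t • v) v t := by
      intro t
      simpa using ((hasDerivAt_id t).smul_const v).const_add x
    have hd : DifferentiableOn ℂ (fun t : ℂ => f (x + t • v)) (closedBall 0 δ) := by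
      intro t ht
      rw [mem_closedBall_zero_iff] at ht
      exact ((hdiff x hx t ht).comp t (hline t).differentiableAt).differentiableWithinAt
    have h1 := hd.deriv_eq_smul_circleIntegral hδ0
    have h2 : deriv (fun t : ℂ => f (x + t • v)) 0 = fderiv ℂ f x v := by
      have h3 := hdiff x hx 0 (by simpa using hδ0.le)
      have h4 := (h3.hasFDerivAt.comp_hasDerivAt (0 : ℂ) (hline 0)).deriv
      rw [zero_smul, add_zero] at h4
      exact h4
    rw [h2, circleIntegral] at h1
    rw [eq_inv_mul_iff_mul_eq₀ (by simp [Real.pi_ne_zero]), ← smul_eq_mul, ← h1]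
    refine intervalIntegral.integral_congr fun θ _ => ?_
    simp only [deriv_circleMap, hc, hw, smul_eq_mul, sub_zero, mul_assoc]
  have hcont : ∀ x ∈ ball z₀ s, Continuous fun θ => c θ * f (x + w θ • v) := by
    intro x hx
    refine hcc.mul (continuous_iff_continuousAt.mpr fun θ => ?_)
    exact (hdiff x hx (w θ) (hwn θ).le).continuousAt.comp (f := fun θ => x + w θ • v)
      (continuous_const.add (hwc.smul continuous_const)).continuousAt
  have hball : ball z₀ s ∈ nhds z₀ := ball_mem_nhds z₀ hs
  have hint := intervalIntegral.hasFDerivAt_integral_of_dominated_of_fderiv_le (𝕜 := ℂ)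
    (μ := volume) (a := 0) (b := 2 * Real.pi) (F := fun x θ => c θ * f (x + w θ • v))
    (F' := fun x θ => c θ • fderiv ℂ f (x + w θ • v)) (x₀ := z₀)
    (bound := fun _ => δ⁻¹ * ((2 * B) / s)) hball
    (Filter.eventually_of_mem hball fun x hx => (hcont x hx).aestronglyMeasurable)
    ((hcont z₀ (mem_ball_self hs)).intervalIntegrable _ _) ?_ ?_ (by simp) ?_
  · have h2 : DifferentiableAt ℂ (fun x => (2 * Real.pi * Complex.I)⁻¹ *
        ∫ θ in (0 : ℝ)..2 * Real.pi, c θ * f (x + w θ • v)) z₀ :=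
      hint.differentiableAt.const_mul _
    exact h2.congr_of_eventuallyEq (Filter.eventually_of_mem hball hformula)
  · refine AEStronglyMeasurable.smul hcc.aestronglyMeasurable ?_
    refine Measurable.aestronglyMeasurable ?_
    exact (measurable_fderiv ℂ f).comp
      (continuous_const.add (hwc.smul continuous_const)).measurable
  · refine Filter.Eventually.of_forall fun θ _ x hx => ?_
    rw [norm_smul, hcn]
    exact mul_le_mul_of_nonneg_left (hbound _ (hmem x hx _ (hwn θ).le)) (by positivity)
  · refine Filter.Eventually.of_forall fun θ _ x hx => ?_
    have h1 := (hdiff x hx (w θ) (hwn θ).le).hasFDerivAt.comp x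
      ((hasFDerivAt_id x).add_const (w θ • v))
    exact h1.const_mul (c θ)

/-- Induction on the order of differentiability, since directional derivatives of holomorphic
functions are again holomorphic. -/
theorem contDiffOn_of_differentiableOn_complex (hU : IsOpen U) {m : ℕ}
    {g : (Fin n → ℂ) → (Fin m → ℂ)} (hg : DifferentiableOn ℂ g U) : ContDiffOn ℝ ∞ g U := by
  have key : ∀ (k : ℕ) (f : (Fin n → ℂ) → ℂ), DifferentiableOn ℂ f U → ContDiffOn ℂ k f U := by
    intro k
    induction k with
    | zero => exact fun f hf => contDiffOn_zero.mpr hf.continuousOn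
    | succ k ih =>
      intro f hf
      rw [Nat.cast_add, Nat.cast_one, contDiffOn_succ_iff_fderiv_of_isOpen hU]
      refine ⟨hf, by simp, contDiffOn_clm_apply.mpr fun v => ih _ ?_⟩
      exact differentiableOn_fderiv_apply hU hf v
  refine contDiffOn_pi.mpr fun i => (contDiffOn_infty.mpr fun k => ?_)
  refine ContDiffOn.restrict_scalars ℝ (𝕜' := ℂ) (key k _ ?_)
  exact fun z hz => differentiableWithinAt_pi.mp (hg z hz) i

end Holomorphic

end FormalKahler
end

noncomputable section
namespace FormalKahler
open PowerSeries

/-! ### The integrand as a series with polynomial coefficients -/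

section UniversalIntegrand

variable {n : ℕ} {U : Set (Fin n → ℂ)}

/-- The increments `(y, 0)` in the polynomial ring in `(y, ȳ)`. -/
def holIncr : Fin n ⊕ Fin n → MvPolynomial (Fin n ⊕ Fin n) ℂ :=
  Sum.elim (fun i => MvPolynomial.X (.inl i)) fun _ => 0

/-- The increments `(0, ȳ)` in the polynomial ring in `(y, ȳ)`. -/
def antiholIncr : Fin n ⊕ Fin n → MvPolynomial (Fin n ⊕ Fin n) ℂ :=
  Sum.elim (fun _ => 0) fun i => MvPolynomial.X (.inr i)

/-- The Calabi function of the potential `f`, with polynomial coefficients. -/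
def calabiPoly (f : (Fin n → ℂ) → ℂ) (z : Fin n → ℂ) : (MvPolynomial (Fin n ⊕ Fin n) ℂ)⟦X⟧ :=
  formalTaylor antiholIncr f z + formalTaylor holIncr f z -
    C (algebraMap ℂ (MvPolynomial (Fin n ⊕ Fin n) ℂ) (f z)) - formalTaylor MvPolynomial.X f z

/-- The non-Gaussian part of the exponent, with polynomial coefficients. -/
def interactionPoly (f : (Fin n → ℂ) → ℂ) (z : Fin n → ℂ) :
    (MvPolynomial (Fin n ⊕ Fin n) ℂ)⟦X⟧ :=
  mk fun N => if N = 0 then 0 else coeff (N + 2) (calabiPoly f z)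

/-- The non-Gaussian part of the integrand, with polynomial coefficients. -/
def integrandPoly (Φ : (Fin n → ℂ) → ℝ) (f₁ f₂ : (Fin n → ℂ) → ℂ) (z : Fin n → ℂ) :
    (MvPolynomial (Fin n ⊕ Fin n) ℂ)⟦X⟧ :=
  formalTaylor antiholIncr f₁ z * formalTaylor holIncr f₂ z *
    expSeries (interactionPoly (fun w => (Φ w : ℂ)) z) *
    formalTaylor MvPolynomial.X (fun w => (metric Φ w).det) z

theorem constantCoeff_interactionPoly (f : (Fin n → ℂ) → ℂ) (z : Fin n → ℂ) :
    constantCoeff (interactionPoly f z) = 0 := by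
  rw [← coeff_zero_eq_constantCoeff_apply, interactionPoly, coeff_mk, if_pos rfl]

theorem map_formalTaylor_X (y : Fin n → ℂ) (f : (Fin n → ℂ) → ℂ) (z : Fin n → ℂ) :
    PowerSeries.map (evalPoly y : MvPolynomial (Fin n ⊕ Fin n) ℂ →+* ℂ)
      (formalTaylor MvPolynomial.X f z) = formalTaylor (fun s => coord s y) f z := by
  rw [map_formalTaylor]
  simp only [evalPoly_X]

theorem map_formalTaylor_holIncr (y : Fin n → ℂ) (f : (Fin n → ℂ) → ℂ) (z : Fin n → ℂ) :
    PowerSeries.map (evalPoly y : MvPolynomial (Fin n ⊕ Fin n) ℂ →+* ℂ)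
      (formalTaylor holIncr f z) = formalTaylor (Sum.elim y fun _ => 0) f z := by
  rw [map_formalTaylor]
  congr 1
  ext s
  rcases s with i | i <;> simp [holIncr]

theorem map_formalTaylor_antiholIncr (y : Fin n → ℂ) (f : (Fin n → ℂ) → ℂ) (z : Fin n → ℂ) :
    PowerSeries.map (evalPoly y : MvPolynomial (Fin n ⊕ Fin n) ℂ →+* ℂ)
      (formalTaylor antiholIncr f z) =
        formalTaylor (Sum.elim (fun _ => 0) fun j => conj (y j)) f z := by
  rw [map_formalTaylor]
  congr 1
  ext s
  rcases s with i | i <;> simp [antiholIncr]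

theorem contDiffOn_metric (hU : IsOpen U) {Φ : (Fin n → ℂ) → ℝ} (hΦ : ContDiffOn ℝ ∞ Φ U)
    (i j : Fin n) : ContDiffOn ℝ ∞ (fun w => metric Φ w i j) U :=
  contDiffOn_wirtinger hU (contDiffOn_wirtinger hU
    (Complex.ofRealCLM.contDiff.comp_contDiffOn hΦ) (.inr j)) (.inl i)

theorem contDiffOn_det {M : Fin n → Fin n → (Fin n → ℂ) → ℂ}
    (hM : ∀ i j, ContDiffOn ℝ ∞ (M i j) U) :
    ContDiffOn ℝ ∞ (fun w => (Matrix.of fun i j => M i j w).det) U := by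
  simp only [Matrix.det_apply']
  exact ContDiffOn.sum fun e _ => contDiffOn_const.mul (contDiffOn_prod fun i _ => hM _ _)

theorem map_calabiPoly (hU : IsOpen U) {Φ : (Fin n → ℂ) → ℝ} (hΦ : ContDiffOn ℝ ∞ Φ U)
    {z : Fin n → ℂ} (hz : z ∈ U) (y : Fin n → ℂ) :
    PowerSeries.map (evalPoly y : MvPolynomial (Fin n ⊕ Fin n) ℂ →+* ℂ)
      (calabiPoly (fun w => (Φ w : ℂ)) z) = calabi Φ z y := by
  have hΦ' : ContDiffOn ℝ ∞ (fun w => (Φ w : ℂ)) U :=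
    Complex.ofRealCLM.contDiff.comp_contDiffOn hΦ
  rw [calabiPoly, calabi, jet_eq_formalTaylor hU hΦ' hz, jetHol_eq_formalTaylor hU hΦ' hz,
    jetAntihol_eq_formalTaylor hU hΦ' hz, map_sub, map_sub, map_add, map_formalTaylor_X,
    map_formalTaylor_holIncr, map_formalTaylor_antiholIncr, map_C, RingHom.coe_coe,
    AlgHom.commutes]
  rfl

/-- This transfers the problem from each fixed y to the polynomial ring, where one can differentiate
in y and substitute for it. -/
theorem map_integrandPoly (hU : IsOpen U) {Φ : (Fin n → ℂ) → ℝ} (hΦ : ContDiffOn ℝ ∞ Φ U)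
    {f₁ f₂ : (Fin n → ℂ) → ℂ} (hf₁ : ContDiffOn ℝ ∞ f₁ U) (hf₂ : ContDiffOn ℝ ∞ f₂ U)
    {z : Fin n → ℂ} (hz : z ∈ U) (y : Fin n → ℂ) :
    PowerSeries.map (evalPoly y : MvPolynomial (Fin n ⊕ Fin n) ℂ →+* ℂ)
      (integrandPoly Φ f₁ f₂ z) = integrand Φ f₁ f₂ z y := by
  have hint : PowerSeries.map (evalPoly y : MvPolynomial (Fin n ⊕ Fin n) ℂ →+* ℂ)
      (interactionPoly (fun w => (Φ w : ℂ)) z) = interaction Φ z y := by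
    ext N
    rw [coeff_map, interactionPoly, interaction, coeff_mk, coeff_mk, ← map_calabiPoly hU hΦ hz,
      coeff_map]
    split_ifs <;> simp
  have hdet : ContDiffOn ℝ ∞ (fun w => (metric Φ w).det) U :=
    contDiffOn_det (contDiffOn_metric hU hΦ)
  rw [integrandPoly, integrand, map_mul, map_mul, map_mul, map_formalTaylor_X,
    map_formalTaylor_holIncr, map_formalTaylor_antiholIncr, jet_eq_formalTaylor hU hdet hz,
    jetHol_eq_formalTaylor hU hf₂ hz, jetAntihol_eq_formalTaylor hU hf₁ hz,
    map_expSeries _ (constantCoeff_interactionPoly _ _), hint]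
  rfl

theorem isPosForm_of_posDef {M : Matrix (Fin n) (Fin n) ℂ} (hM : M.PosDef) : IsPosForm M := by
  intro y hy
  -- Positive definiteness is tested on conj(y), since `Matrix.PosDef` conjugates the left vector
  -- while the form here conjugates the right one.
  have hy' : (star y : Fin n → ℂ) ≠ 0 := by simpa using hy
  have h := hM.re_dotProduct_pos hy'
  rw [evalPoly_hermPoly]
  refine lt_of_lt_of_eq h ?_
  rw [star_star]
  simp only [Matrix.mulVec, dotProduct, Finset.mul_sum, Pi.star_apply]
  change Complex.re _ = _
  congr 1
  refine Finset.sum_congr rfl fun i _ => Finset.sum_congr rfl fun j _ => ?_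
  change y i * (M i j * conj (y j)) = _
  ring

theorem bulletCoeff_eq_gaussian (hU : IsOpen U) {Φ : (Fin n → ℂ) → ℝ} (hΦ : ContDiffOn ℝ ∞ Φ U)
    {f₁ f₂ : (Fin n → ℂ) → ℂ} (hf₁ : ContDiffOn ℝ ∞ f₁ U) (hf₂ : ContDiffOn ℝ ∞ f₂ U)
    {z : Fin n → ℂ} (hz : z ∈ U) (hM : IsPosForm (metric Φ z)) (m : ℕ) :
    bulletCoeff Φ m f₁ f₂ z =
      ((Real.pi : ℂ) ^ n)⁻¹ * gaussian hM (coeff (2 * m) (integrandPoly Φ f₁ f₂ z)) := by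
  rw [bulletCoeff, gaussian_apply]
  congr 1
  refine MeasureTheory.integral_congr_ae (Filter.Eventually.of_forall fun y => ?_)
  dsimp only
  rw [← map_integrandPoly hU hΦ hf₁ hf₂ hz, coeff_map, hermForm, evalPoly_hermPoly]
  rfl

/-- The Calabi function begins with the quadratic term `-(Hy, y)`. -/
theorem calabiPoly_eq (hU : IsOpen U) {f : (Fin n → ℂ) → ℂ} (hf : ContDiffOn ℝ ∞ f U)
    {z : Fin n → ℂ} (hz : z ∈ U) {M : Matrix (Fin n) (Fin n) ℂ}
    (hM : ∀ i j, M i j = dz i (dzbar j f) z) :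
    calabiPoly f z = X ^ 2 * (interactionPoly f z - C (hermPoly M)) := by
  have hcomm : ∀ i j, dzbar j (dz i f) z = dz i (dzbar j f) z := fun i j =>
    wirtinger_comm hU hf (.inr j) (.inl i) hz
  ext1 N
  -- Orders 0 and 1 cancel among the four expansions, order 2 leaves the mixed term, and from order
  -- 3 on the identity is the definition of `interactionPoly`.
  match N with
  | 0 =>
    rw [coeff_X_pow_mul', if_neg (by norm_num), coeff_zero_eq_constantCoeff_apply]
    simp [calabiPoly]
  | 1 =>
    rw [coeff_X_pow_mul', if_neg (by norm_num)]
    simp [calabiPoly, formalTaylor, taylorCoeff, Fintype.sum_sum_type, holIncr, antiholIncr]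
    ring
  | 2 =>
    rw [coeff_X_pow_mul', if_pos le_rfl, Nat.sub_self, coeff_zero_eq_constantCoeff_apply, map_sub,
      constantCoeff_interactionPoly, constantCoeff_C, zero_sub]
    -- The mixed term occurs twice, as ∂∂̄ and as ∂̄∂, which cancels the 1/2 of the second Taylor
    -- coefficient.
    have h2 : (MvPolynomial.C (σ := Fin n ⊕ Fin n) ((1 + 1 : ℂ)⁻¹)) * 2 = 1 := by
      have : (2 : MvPolynomial (Fin n ⊕ Fin n) ℂ) = MvPolynomial.C 2 :=
        (map_ofNat MvPolynomial.C 2).symm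
      rw [this, ← map_mul, one_add_one_eq_two, inv_mul_cancel₀ two_ne_zero, map_one]
    have h3 : ∑ i, MvPolynomial.X (.inl i) * ∑ j, MvPolynomial.X (.inr j) *
        MvPolynomial.C (dz i (dzbar j f) z) = hermPoly M := by
      rw [hermPoly]
      refine Finset.sum_congr rfl fun i _ => ?_
      rw [Finset.mul_sum]
      refine Finset.sum_congr rfl fun j _ => ?_
      rw [hM]
      ring
    have h4 : ∑ j, MvPolynomial.X (.inr j) * ∑ i, MvPolynomial.X (.inl i) *
        MvPolynomial.C (dz i (dzbar j f) z) = hermPoly M := by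
      rw [hermPoly, Finset.sum_comm]
      refine Finset.sum_congr rfl fun i _ => ?_
      rw [Finset.mul_sum]
      refine Finset.sum_congr rfl fun j _ => ?_
      rw [hM]
      ring
    simp only [calabiPoly, formalTaylor, taylorCoeff, Fintype.sum_sum_type, holIncr, antiholIncr,
      map_add, map_sub, coeff_mk, coeff_C, Sum.elim_inl, Sum.elim_inr, zero_mul,
      Finset.sum_const_zero, zero_add, add_zero, wirtinger_inl, wirtinger_inr, Nat.cast_zero,
      Nat.cast_one, inv_one, map_one, one_mul, mul_add, Finset.sum_add_distrib, hcomm,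
      MvPolynomial.algebraMap_eq, h3, h4, OfNat.ofNat_ne_zero, if_false]
    linear_combination (-hermPoly M) * h2
  | N + 3 =>
    rw [coeff_X_pow_mul', if_pos (by omega), map_sub, coeff_C, if_neg (by omega), sub_zero,
      interactionPoly, coeff_mk, if_neg (by omega)]
    congr 1

end UniversalIntegrand

end FormalKahler
end

noncomputable section
namespace FormalKahler
open PowerSeries

/-! ### Behaviour of the integrand under a holomorphic map -/

section Functoriality

variable {n : ℕ} {U V : Set (Fin n → ℂ)} {g : (Fin n → ℂ) → (Fin n → ℂ)}

/-- The formal increment `(g(z + εy) - g(z)) / ε` and its conjugate. -/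
def formalIncrement (g : (Fin n → ℂ) → (Fin n → ℂ)) (z : Fin n → ℂ) (t : Fin n ⊕ Fin n) :
    (MvPolynomial (Fin n ⊕ Fin n) ℂ)⟦X⟧ :=
  mk fun k => coeff (k + 1) (formalTaylor MvPolynomial.X (fun w => coord t (g w)) z)

theorem formalTaylor_coord_comp (g : (Fin n → ℂ) → (Fin n → ℂ)) (z : Fin n → ℂ)
    (t : Fin n ⊕ Fin n) :
    formalTaylor MvPolynomial.X (fun w => coord t (g w)) z =
      C (algebraMap ℂ (MvPolynomial (Fin n ⊕ Fin n) ℂ) (coord t (g z))) +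
        X * formalIncrement g z t := by
  conv_lhs => rw [eq_X_mul_shift_add_const (formalTaylor MvPolynomial.X _ z)]
  rw [constantCoeff_formalTaylor, add_comm]
  rfl

theorem dzbar_apply_eq_zero (hg : DifferentiableOn ℂ g U) (hU : IsOpen U) (i k : Fin n)
    {w : Fin n → ℂ} (hw : w ∈ U) : dzbar i (fun w => g w k) w = 0 :=
  dzbar_apply_of_differentiableAt (hg.differentiableAt (hU.mem_nhds hw)) i k

theorem differentiableAt_apply (hg : DifferentiableOn ℂ g U) (hU : IsOpen U) (k : Fin n)
    {w : Fin n → ℂ} (hw : w ∈ U) : DifferentiableAt ℝ (fun w => g w k) w :=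
  differentiableAt_pi.mp ((hg.differentiableAt (hU.mem_nhds hw)).restrictScalars ℝ) k

theorem dz_conj_apply (hg : DifferentiableOn ℂ g U) (hU : IsOpen U) (i k : Fin n)
    {w : Fin n → ℂ} (hw : w ∈ U) : dz i (fun w => conj (g w k)) w = 0 := by
  have h := wirtinger_conj (.inl i) (differentiableAt_apply hg hU k hw)
  rw [Sum.swap_inl, wirtinger_inr, dzbar_apply_eq_zero hg hU i k hw, map_zero] at h
  exact h

theorem dzbar_conj_apply (hg : DifferentiableOn ℂ g U) (hU : IsOpen U) (i k : Fin n)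
    {w : Fin n → ℂ} (hw : w ∈ U) :
    dzbar i (fun w => conj (g w k)) w = conj (dz i (fun w => g w k) w) :=
  wirtinger_conj (.inr i) (differentiableAt_apply hg hU k hw)

theorem contDiffOn_apply_comp (hg : DifferentiableOn ℂ g U) (hU : IsOpen U) (k : Fin n) :
    ContDiffOn ℝ ∞ (fun w => g w k) U :=
  contDiffOn_pi.mp (contDiffOn_of_differentiableOn_complex hU hg) k

theorem contDiffOn_conj {f : (Fin n → ℂ) → ℂ} (hf : ContDiffOn ℝ ∞ f U) :
    ContDiffOn ℝ ∞ (fun w => conj (f w)) U :=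
  Complex.conjCLE.contDiff.comp_contDiffOn hf

/-- Differentiating g(z + εy) = g(z) + εu in y gives a factor ε on both sides, which cancels. -/
theorem coeffDerivation_formalIncrement (hg : DifferentiableOn ℂ g U) (hU : IsOpen U)
    {z : Fin n → ℂ} (hz : z ∈ U) (s t : Fin n ⊕ Fin n) :
    coeffDerivation (MvPolynomial.pderiv s) (formalIncrement g z t) =
      formalTaylor MvPolynomial.X (wirtinger s fun w => coord t (g w)) z := by
  have hgt : ContDiffOn ℝ ∞ (fun w => coord t (g w)) U :=
    (contDiff_coord t).comp_contDiffOn (contDiffOn_of_differentiableOn_complex hU hg)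
  have h := coeffDerivation_formalTaylor hU hgt hz s
  rw [formalTaylor_coord_comp, map_add, coeffDerivation_C, Derivation.map_algebraMap, map_zero,
    zero_add, Derivation.leibniz, coeffDerivation_X, smul_zero, add_zero, smul_eq_mul] at h
  exact X_mul_cancel h

/-- The determinant of the holomorphic Jacobian matrix. -/
def holJacobianDet (g : (Fin n → ℂ) → (Fin n → ℂ)) (w : Fin n → ℂ) : ℂ :=
  (Matrix.of fun k i => dz i (fun w => g w k) w).det

theorem contDiffOn_holJacobianDet (hg : DifferentiableOn ℂ g U) (hU : IsOpen U) :
    ContDiffOn ℝ ∞ (holJacobianDet g) U :=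
  contDiffOn_det (M := fun k i => dz i fun w => g w k) fun k i =>
    contDiffOn_wirtinger hU (contDiffOn_apply_comp hg hU k) (.inl i)

/-- Holomorphy makes the Jacobian block diagonal, with the second block conjugate to the first. -/
theorem det_jacobian_formalIncrement (hg : DifferentiableOn ℂ g U) (hU : IsOpen U)
    {z : Fin n → ℂ} (hz : z ∈ U) :
    (jacobian (formalIncrement g z)).det =
      formalTaylor MvPolynomial.X (holJacobianDet g) z *
        formalTaylor MvPolynomial.X (fun w => conj (holJacobianDet g w)) z := by
  have hdz : ∀ k i, ContDiffOn ℝ ∞ (dz i fun w => g w k) U := fun k i =>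
    contDiffOn_wirtinger hU (contDiffOn_apply_comp hg hU k) (.inl i)
  have hblock : jacobian (formalIncrement g z) = Matrix.fromBlocks
      (Matrix.of fun k i => formalTaylor MvPolynomial.X (dz i fun w => g w k) z) 0 0
      (Matrix.of fun k i => formalTaylor MvPolynomial.X
        (fun w => conj (dz i (fun w => g w k) w)) z) := by
    ext1 t s
    rw [jacobian, Matrix.of_apply, coeffDerivation_formalIncrement hg hU hz]
    rcases t with k | k <;> rcases s with i | i
    · rfl
    · exact formalTaylor_zero hU _ (fun w hw => dzbar_apply_eq_zero hg hU i k hw) hz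
    · exact formalTaylor_zero hU _ (fun w hw => dz_conj_apply hg hU i k hw) hz
    · exact formalTaylor_congr hU _ (fun w hw => dzbar_conj_apply hg hU i k hw) hz
  rw [hblock, Matrix.det_fromBlocks_zero₂₁]
  congr 1
  · exact (formalTaylor_det hU _ hdz hz).symm
  · rw [← formalTaylor_det hU _ (fun k i => contDiffOn_conj (hdz k i)) hz]
    congr 1
    ext w
    exact (RingHom.map_det (starRingEnd ℂ) (Matrix.of fun k i => dz i (fun w => g w k) w)).symm

theorem formalTaylor_zero_incr {R : Type*} [CommRing R] [Algebra ℂ R] (f : (Fin n → ℂ) → ℂ)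
    (z : Fin n → ℂ) : formalTaylor (fun _ => (0 : R)) f z = C (algebraMap ℂ R (f z)) := by
  refine sub_eq_zero.mp (eq_zero_of_derivX_eq_mul (a := 0) ?_ (by simp))
  rw [map_sub, derivX_formalTaylor]
  simp

theorem substPoly_formalIncrement (hg : DifferentiableOn ℂ g U) (hU : IsOpen U) (hV : IsOpen V)
    (hgV : Set.MapsTo g U V) {z : Fin n → ℂ} (hz : z ∈ U) {f : (Fin n → ℂ) → ℂ}
    (hf : ContDiffOn ℝ ∞ f V) :
    substPoly (formalIncrement g z) (formalTaylor MvPolynomial.X f (g z)) =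
      formalTaylor MvPolynomial.X (fun w => f (g w)) z :=
  substPoly_formalTaylor hV hU (contDiffOn_of_differentiableOn_complex hU hg) hgV hf hz _ _
    (formalTaylor_coord_comp g z)

/-- Substitution into the expansion in some of the variables only. -/
theorem substPoly_formalTaylor_incr (hg : DifferentiableOn ℂ g U) (hU : IsOpen U) (hV : IsOpen V)
    (hgV : Set.MapsTo g U V) {z : Fin n → ℂ} (hz : z ∈ U) {f : (Fin n → ℂ) → ℂ}
    (hf : ContDiffOn ℝ ∞ f V) (p : Fin n ⊕ Fin n → MvPolynomial (Fin n ⊕ Fin n) ℂ)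
    (hp : ∀ t, formalTaylor p (fun w => coord t (g w)) z =
      C (algebraMap ℂ (MvPolynomial (Fin n ⊕ Fin n) ℂ) (coord t (g z))) +
        X * MvPolynomial.aeval (formalIncrement g z) (p t)) :
    substPoly (formalIncrement g z) (formalTaylor p f (g z)) =
      formalTaylor p (fun w => f (g w)) z := by
  have h := substPoly_formalTaylor hV hU (contDiffOn_of_differentiableOn_complex hU hg) hgV hf hz
    p (fun t => MvPolynomial.aeval (formalIncrement g z) (p t)) hp
  -- Expansions with special increments are specialisations of the universal one, so both sides are
  -- compositions of substitutions and need comparing only on variables.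
  have h2 : formalTaylor p f (g z) = PowerSeries.map
      ((MvPolynomial.aeval p : MvPolynomial (Fin n ⊕ Fin n) ℂ →ₐ[ℂ] MvPolynomial (Fin n ⊕ Fin n) ℂ) :
        MvPolynomial (Fin n ⊕ Fin n) ℂ →+* MvPolynomial (Fin n ⊕ Fin n) ℂ)
      (formalTaylor MvPolynomial.X f (g z)) := by
    rw [map_formalTaylor]
    simp only [MvPolynomial.aeval_X]
  rw [← h, h2, substPoly, substHom_map, substPoly, ← AlgHom.comp_toRingHom]
  congr 3
  refine MvPolynomial.algHom_ext fun t => ?_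
  simp

/-- This is where the holomorphy of g matters: its components do not see ȳ and their conjugates do
not see y, so setting ȳ = 0 commutes with the substitution. -/
theorem substPoly_holIncr (hg : DifferentiableOn ℂ g U) (hU : IsOpen U) (hV : IsOpen V)
    (hgV : Set.MapsTo g U V) {z : Fin n → ℂ} (hz : z ∈ U) {f : (Fin n → ℂ) → ℂ}
    (hf : ContDiffOn ℝ ∞ f V) :
    substPoly (formalIncrement g z) (formalTaylor holIncr f (g z)) =
      formalTaylor holIncr (fun w => f (g w)) z := by
  refine substPoly_formalTaylor_incr hg hU hV hgV hz hf holIncr fun t => ?_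
  have hgt : ContDiffOn ℝ ∞ (fun w => coord t (g w)) U :=
    (contDiff_coord t).comp_contDiffOn (contDiffOn_of_differentiableOn_complex hU hg)
  rcases t with k | k
  · rw [holIncr, Sum.elim_inl, MvPolynomial.aeval_X, ← formalTaylor_coord_comp]
    refine formalTaylor_eq_of_wirtinger_eq_zero hU (Set.range Sum.inr) ?_ hgt ?_ hz
    · rintro (j | j) hj
      · rfl
      · exact absurd ⟨j, rfl⟩ hj
    · rintro _ ⟨i, rfl⟩ w hw
      exact dzbar_apply_eq_zero hg hU i k hw
  · rw [holIncr, Sum.elim_inr, map_zero, mul_zero, add_zero,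
      ← formalTaylor_zero_incr (R := MvPolynomial (Fin n ⊕ Fin n) ℂ) fun w => coord _ (g w)]
    refine formalTaylor_eq_of_wirtinger_eq_zero hU (Set.range Sum.inl) ?_ hgt ?_ hz
    · rintro (j | j) hj
      · exact absurd ⟨j, rfl⟩ hj
      · rfl
    · rintro _ ⟨i, rfl⟩ w hw
      exact dz_conj_apply hg hU i k hw

theorem substPoly_antiholIncr (hg : DifferentiableOn ℂ g U) (hU : IsOpen U) (hV : IsOpen V)
    (hgV : Set.MapsTo g U V) {z : Fin n → ℂ} (hz : z ∈ U) {f : (Fin n → ℂ) → ℂ}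
    (hf : ContDiffOn ℝ ∞ f V) :
    substPoly (formalIncrement g z) (formalTaylor antiholIncr f (g z)) =
      formalTaylor antiholIncr (fun w => f (g w)) z := by
  refine substPoly_formalTaylor_incr hg hU hV hgV hz hf antiholIncr fun t => ?_
  have hgt : ContDiffOn ℝ ∞ (fun w => coord t (g w)) U :=
    (contDiff_coord t).comp_contDiffOn (contDiffOn_of_differentiableOn_complex hU hg)
  rcases t with k | k
  · rw [antiholIncr, Sum.elim_inl, map_zero, mul_zero, add_zero,
      ← formalTaylor_zero_incr (R := MvPolynomial (Fin n ⊕ Fin n) ℂ) fun w => coord _ (g w)]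
    refine formalTaylor_eq_of_wirtinger_eq_zero hU (Set.range Sum.inr) ?_ hgt ?_ hz
    · rintro (j | j) hj
      · rfl
      · exact absurd ⟨j, rfl⟩ hj
    · rintro _ ⟨i, rfl⟩ w hw
      exact dzbar_apply_eq_zero hg hU i k hw
  · rw [antiholIncr, Sum.elim_inr, MvPolynomial.aeval_X, ← formalTaylor_coord_comp]
    refine formalTaylor_eq_of_wirtinger_eq_zero hU (Set.range Sum.inl) ?_ hgt ?_ hz
    · rintro (j | j) hj
      · exact absurd ⟨j, rfl⟩ hj
      · rfl
    · rintro _ ⟨i, rfl⟩ w hw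
      exact dz_conj_apply hg hU i k hw

theorem algebraMap_eq_C {R : Type*} [CommRing R] [Algebra ℂ R] (c : ℂ) :
    algebraMap ℂ R⟦X⟧ c = C (algebraMap ℂ R c) :=
  PowerSeries.algebraMap_apply

theorem substPoly_calabiPoly (hg : DifferentiableOn ℂ g U) (hU : IsOpen U) (hV : IsOpen V)
    (hgV : Set.MapsTo g U V) {z : Fin n → ℂ} (hz : z ∈ U) {f : (Fin n → ℂ) → ℂ}
    (hf : ContDiffOn ℝ ∞ f V) :
    substPoly (formalIncrement g z) (calabiPoly f (g z)) = calabiPoly (fun w => f (g w)) z := by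
  rw [calabiPoly, calabiPoly, map_sub, map_sub, map_add, substPoly_holIncr hg hU hV hgV hz hf,
    substPoly_antiholIncr hg hU hV hgV hz hf, substPoly_formalIncrement hg hU hV hgV hz hf,
    substPoly_C, AlgHom.commutes, algebraMap_eq_C]

/-- The Calabi function depends only on the mixed second derivatives of the potential. -/
theorem calabiPoly_congr (hU : IsOpen U) {f f' : (Fin n → ℂ) → ℂ} (hf : ContDiffOn ℝ ∞ f U)
    (hf' : ContDiffOn ℝ ∞ f' U)
    (h : ∀ i j, ∀ w ∈ U, dz i (dzbar j f) w = dz i (dzbar j f') w) {z : Fin n → ℂ} (hz : z ∈ U) :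
    calabiPoly f z = calabiPoly f' z := by
  have hsub : ∀ (s : Fin n ⊕ Fin n) {f f' : (Fin n → ℂ) → ℂ}, ContDiffOn ℝ ∞ f U →
      ContDiffOn ℝ ∞ f' U → ∀ w ∈ U,
      wirtinger s (fun w => f w - f' w) w = wirtinger s f w - wirtinger s f' w := by
    intro s f f' hf hf' w hw
    have hd := differentiableAt_of_contDiffOn hU hf hw
    have hd' := differentiableAt_of_contDiffOn hU hf' hw
    simp only [wirtinger_eq, fderiv_fun_sub hd hd', sub_apply]
    ring
  -- The difference of the two potentials is pluriharmonic, and the Calabi function is additive in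
  -- the potential.
  have h0 := formalTaylor_pluriharmonic hU
    (MvPolynomial.X : Fin n ⊕ Fin n → MvPolynomial (Fin n ⊕ Fin n) ℂ) (hf.sub hf')
    (fun i j w hw => by
      have h1 : dz i (dzbar j fun w => f w - f' w) w =
          dz i (fun w => dzbar j f w - dzbar j f' w) w :=
        wirtinger_congr hU (hsub (.inr j) hf hf') (.inl i) hw
      refine h1.trans ?_
      have h2 := hsub (.inl i) (contDiffOn_wirtinger hU hf (.inr j))
        (contDiffOn_wirtinger hU hf' (.inr j)) w hw
      exact h2.trans (sub_eq_zero.mpr (h i j w hw))) hz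
  change formalTaylor antiholIncr (fun w => f w - f' w) z +
    formalTaylor holIncr (fun w => f w - f' w) z - C (algebraMap ℂ _ (f z - f' z)) -
    formalTaylor MvPolynomial.X (fun w => f w - f' w) z = 0 at h0
  rw [formalTaylor_sub hU _ hf hf' hz, formalTaylor_sub hU _ hf hf' hz,
    formalTaylor_sub hU _ hf hf' hz, map_sub, map_sub] at h0
  rw [calabiPoly, calabiPoly]
  linear_combination h0

theorem wirtinger_finsetSum (s : Fin n ⊕ Fin n) {ι : Type*} (S : Finset ι)
    {F : ι → (Fin n → ℂ) → ℂ} {w : Fin n → ℂ} (hF : ∀ i, DifferentiableAt ℝ (F i) w) :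
    wirtinger s (fun w => ∑ i ∈ S, F i w) w = ∑ i ∈ S, wirtinger s (F i) w := by
  classical
  induction S using Finset.induction_on with
  | empty => simpa using wirtinger_const s 0 w
  | insert a S ha ih =>
    simp only [Finset.sum_insert ha]
    rw [wirtinger_add s (hF a) (DifferentiableAt.fun_sum fun i _ => hF i), ih]

/-- The mixed second derivatives of the pullback of a function under a holomorphic map. -/
theorem dz_dzbar_comp (hg : DifferentiableOn ℂ g U) (hU : IsOpen U) (hV : IsOpen V)
    (hgV : Set.MapsTo g U V) {w : Fin n → ℂ} (hw : w ∈ U) {f : (Fin n → ℂ) → ℂ}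
    (hf : ContDiffOn ℝ ∞ f V) (i j : Fin n) :
    dz i (dzbar j fun w => f (g w)) w = ∑ k, ∑ l,
      fderiv ℂ g w (Pi.single i 1) k * dz k (dzbar l f) (g w) *
        conj (fderiv ℂ g w (Pi.single j 1) l) := by
  have hgs := contDiffOn_of_differentiableOn_complex hU hg
  have hdz : ∀ i k, ContDiffOn ℝ ∞ (dz i fun w => g w k) U := fun i k =>
    contDiffOn_wirtinger hU (contDiffOn_apply_comp hg hU k) (.inl i)
  have hfl : ∀ l, ContDiffOn ℝ ∞ (fun w => dzbar l f (g w)) U := fun l =>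
    (contDiffOn_wirtinger hV hf (.inr l)).comp hgs hgV
  have h1 : Set.EqOn (dzbar j fun w => f (g w))
      (fun w => ∑ l, dzbar l f (g w) * conj (dz j (fun w => g w l) w)) U := by
    intro x hx
    have h := wirtinger_comp (differentiableAt_of_contDiffOn hV hf (hgV hx))
      (differentiableAt_of_contDiffOn hU hgs hx) (.inr j)
    rw [Fintype.sum_sum_type] at h
    simp only [wirtinger_inl, wirtinger_inr, coord_inl, coord_inr,
      dzbar_apply_eq_zero hg hU _ _ hx, dzbar_conj_apply hg hU _ _ hx, mul_zero,
      Finset.sum_const_zero, zero_add] at h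
    exact h
  refine (wirtinger_congr hU h1 (.inl i) hw).trans ?_
  rw [wirtinger_finsetSum _ _ fun l => (differentiableAt_of_contDiffOn hU (hfl l) hw).fun_mul
    (differentiableAt_of_contDiffOn hU (contDiffOn_conj (hdz j l)) hw), Finset.sum_comm]
  refine Finset.sum_congr rfl fun l _ => ?_
  rw [wirtinger_mul _ (differentiableAt_of_contDiffOn hU (hfl l) hw)
    (differentiableAt_of_contDiffOn hU (contDiffOn_conj (hdz j l)) hw),
    wirtinger_conj _ (differentiableAt_of_contDiffOn hU (hdz j l) hw)]
  -- The factor conj(∂_j g^l) is antiholomorphic, so ∂_i acts only on the other factor.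
  have h2 : wirtinger (Sum.inl i : Fin n ⊕ Fin n).swap (dz j fun w => g w l) w = 0 := by
    have h3 := wirtinger_comm hU (contDiffOn_apply_comp hg hU l) (.inr i) (.inl j) hw
    refine h3.trans ?_
    exact (wirtinger_congr hU (f' := fun _ => 0)
      (fun x hx => dzbar_apply_eq_zero hg hU i l hx) (.inl j) hw).trans (wirtinger_const _ _ _)
  have h4 := wirtinger_comp
    (differentiableAt_of_contDiffOn hV (contDiffOn_wirtinger hV hf (.inr l)) (hgV hw))
    (differentiableAt_of_contDiffOn hU hgs hw) (.inl i)
  rw [Fintype.sum_sum_type] at h4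
  simp only [wirtinger_inl, wirtinger_inr, coord_inl, coord_inr,
    dz_conj_apply hg hU _ _ hw, mul_zero, Finset.sum_const_zero, add_zero] at h4
  have hgw := hg.differentiableAt (hU.mem_nhds hw)
  rw [h2, wirtinger_inl, h4, map_zero, mul_zero, add_zero, Finset.sum_mul]
  refine Finset.sum_congr rfl fun k _ => ?_
  rw [dz_apply_of_differentiableAt hgw, dz_apply_of_differentiableAt hgw]
  ring

/-- The complex Jacobian matrix of `g` at `z`. -/
def jacobianAt (g : (Fin n → ℂ) → (Fin n → ℂ)) (z : Fin n → ℂ) : Matrix (Fin n) (Fin n) ℂ :=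
  Matrix.of fun k i => fderiv ℂ g z (Pi.single i 1) k

theorem pullbackMetric_eq (Φ : (Fin n → ℂ) → ℝ) (g : (Fin n → ℂ) → (Fin n → ℂ))
    (z : Fin n → ℂ) :
    pullbackMetric Φ g z = pullbackForm (metric Φ (g z)) (jacobianAt g z) := rfl

theorem det_pullbackForm (M A : Matrix (Fin n) (Fin n) ℂ) :
    (pullbackForm M A).det = A.det * conj A.det * M.det := by
  have h : pullbackForm M A = A.transpose * M * A.map (starRingEnd ℂ) := by
    ext i j
    simp only [pullbackForm, Matrix.of_apply, Matrix.mul_apply, Matrix.transpose_apply,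
      Matrix.map_apply, Finset.sum_mul]
    exact Finset.sum_comm
  have h2 : (A.map (starRingEnd ℂ)).det = conj A.det := (RingHom.map_det (starRingEnd ℂ) A).symm
  rw [h, Matrix.det_mul, Matrix.det_mul, Matrix.det_transpose, h2]
  ring

theorem mulVec_jacobianAt (g : (Fin n → ℂ) → (Fin n → ℂ)) (z y : Fin n → ℂ) :
    (jacobianAt g z).mulVec y = fderiv ℂ g z y := by
  have hy : y = ∑ i, y i • (Pi.single i 1 : Fin n → ℂ) := by
    conv_lhs => rw [← Finset.univ_sum_single y]
    refine Finset.sum_congr rfl fun i _ => ?_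
    rw [← Pi.single_smul, smul_eq_mul, mul_one]
  have h : fderiv ℂ g z y = ∑ i, y i • fderiv ℂ g z (Pi.single i 1) := by
    refine (congrArg (fderiv ℂ g z) hy).trans ?_
    simp only [map_sum, map_smul]
  rw [h]
  ext k
  rw [Finset.sum_apply]
  change ∑ i, jacobianAt g z k i * y i = _
  refine Finset.sum_congr rfl fun i _ => ?_
  rw [Pi.smul_apply, smul_eq_mul, mul_comm]
  rfl

theorem holJacobianDet_eq (hg : DifferentiableOn ℂ g U) (hU : IsOpen U) {w : Fin n → ℂ}
    (hw : w ∈ U) : holJacobianDet g w = (jacobianAt g w).det := by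
  rw [holJacobianDet, jacobianAt]
  congr 2
  ext k i
  exact dz_apply_of_differentiableAt (hg.differentiableAt (hU.mem_nhds hw)) i k

/-- The leading term of the formal increment is the differential of g, so at order ε⁰ the
substitution is linear. -/
theorem evalPoly_constantCoeff_aeval (hg : DifferentiableOn ℂ g U) (hU : IsOpen U)
    {z : Fin n → ℂ} (hz : z ∈ U) (y : Fin n → ℂ) (P : MvPolynomial (Fin n ⊕ Fin n) ℂ) :
    evalPoly y (constantCoeff (MvPolynomial.aeval (formalIncrement g z) P)) =
      evalPoly ((jacobianAt g z).mulVec y) P := by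
  have hgz := hg.differentiableAt (hU.mem_nhds hz)
  have hX : ∀ t, evalPoly y (constantCoeff (formalIncrement g z t)) =
      coord t ((jacobianAt g z).mulVec y) := by
    intro t
    rw [mulVec_jacobianAt, ← coeff_zero_eq_constantCoeff_apply, formalIncrement, coeff_mk,
      formalTaylor, coeff_mk, taylorCoeff]
    have h := fderiv_coord_comp t (hgz.restrictScalars ℝ) y
    rw [fderiv_eq_sum_wirtinger, hgz.fderiv_restrictScalars ℝ] at h
    simp only [taylorCoeff, map_mul, map_sum, evalPoly_X, AlgHom.commutes]
    simp only [Nat.cast_zero, zero_add, inv_one, Algebra.algebraMap_self_apply, one_mul]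
    refine Eq.trans ?_ h
    exact Finset.sum_congr rfl fun s _ => mul_comm _ _
  induction P using MvPolynomial.induction_on with
  | C c =>
    have h1 : MvPolynomial.aeval (formalIncrement g z) (MvPolynomial.C c) =
        C (algebraMap ℂ (MvPolynomial (Fin n ⊕ Fin n) ℂ) c) := by
      rw [MvPolynomial.aeval_C, algebraMap_eq_C]
    rw [h1, constantCoeff_C, AlgHom.commutes, evalPoly_C]
    rfl
  | add p q hp hq => rw [map_add, map_add, map_add, map_add, hp, hq]
  | mul_X p t hp =>
    rw [map_mul, map_mul, map_mul, map_mul, hp, MvPolynomial.aeval_X, hX, evalPoly_X]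

theorem constantCoeff_det_jacobian (hg : DifferentiableOn ℂ g U) (hU : IsOpen U)
    {z : Fin n → ℂ} (hz : z ∈ U) :
    constantCoeff (jacobian (formalIncrement g z)).det = algebraMap ℂ _
      ((jacobianAt g z).det * conj (jacobianAt g z).det) := by
  rw [det_jacobian_formalIncrement hg hU hz, map_mul, constantCoeff_formalTaylor,
    constantCoeff_formalTaylor, holJacobianDet_eq hg hU hz, map_mul]

/-- The formal change of variables `v = g(z + εy)` in the integrand of the star product. -/
theorem integrandPoly_comp (hg : DifferentiableOn ℂ g U) (hU : IsOpen U) (hV : IsOpen V)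
    (hgV : Set.MapsTo g U V) {z : Fin n → ℂ} (hz : z ∈ U) {Φ Φ' : (Fin n → ℂ) → ℝ}
    (hΦ : ContDiffOn ℝ ∞ Φ V) (hΦ' : ContDiffOn ℝ ∞ Φ' U)
    (hΦΦ' : ∀ z ∈ U, metric Φ' z = pullbackMetric Φ g z) {f₁ f₂ : (Fin n → ℂ) → ℂ}
    (hf₁ : ContDiffOn ℝ ∞ f₁ V) (hf₂ : ContDiffOn ℝ ∞ f₂ V) :
    ∃ W : (MvPolynomial (Fin n ⊕ Fin n) ℂ)⟦X⟧, constantCoeff W = 0 ∧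
      MvPolynomial.aeval (formalIncrement g z) (hermPoly (metric Φ (g z))) =
        C (hermPoly (metric Φ' z)) + W ∧
      integrandPoly Φ' (fun w => f₁ (g w)) (fun w => f₂ (g w)) z =
        substPoly (formalIncrement g z) (integrandPoly Φ f₁ f₂ (g z)) *
          (jacobian (formalIncrement g z)).det * expSeries (-W) := by
  have hgs := contDiffOn_of_differentiableOn_complex hU hg
  have hΦc : ContDiffOn ℝ ∞ (fun w => (Φ w : ℂ)) V :=
    Complex.ofRealCLM.contDiff.comp_contDiffOn hΦ
  have hΦc' : ContDiffOn ℝ ∞ (fun w => (Φ' w : ℂ)) U :=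
    Complex.ofRealCLM.contDiff.comp_contDiffOn hΦ'
  set u := formalIncrement g z with hu
  have hcal : calabiPoly (fun w => (Φ' w : ℂ)) z =
      substPoly u (calabiPoly (fun w => (Φ w : ℂ)) (g z)) := by
    rw [substPoly_calabiPoly hg hU hV hgV hz hΦc]
    refine calabiPoly_congr hU hΦc' (hΦc.comp hgs hgV) (fun i j w hw => ?_) hz
    have h1 := dz_dzbar_comp hg hU hV hgV hw hΦc i j
    refine Eq.trans ?_ h1.symm
    exact congrFun (congrFun (hΦΦ' w hw) i) j
  rw [calabiPoly_eq hU hΦc' hz (M := metric Φ' z) fun _ _ => rfl,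
    calabiPoly_eq hV hΦc (hgV hz) (M := metric Φ (g z)) fun _ _ => rfl, map_mul, map_pow,
    substPoly_X] at hcal
  -- The equality of Calabi functions is divided by ε². The old quadratic form in the new variables
  -- exceeds the new one by W, and this excess moves into the exponent.
  have hV' : interactionPoly (fun w => (Φ' w : ℂ)) z =
      substPoly u (interactionPoly (fun w => (Φ w : ℂ)) (g z)) +
        -(MvPolynomial.aeval u (hermPoly (metric Φ (g z))) - C (hermPoly (metric Φ' z))) := by
    have h := X_pow_mul_cancel hcal
    rw [map_sub, substPoly_C] at h
    linear_combination h
  set W := MvPolynomial.aeval u (hermPoly (metric Φ (g z))) - C (hermPoly (metric Φ' z))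
  have hsub0 : constantCoeff (substPoly u (interactionPoly (fun w => (Φ w : ℂ)) (g z))) = 0 := by
    rw [substPoly, constantCoeff_substHom, constantCoeff_interactionPoly]
    simp
  -- Neither interaction has a constant term, so W has none.
  have hW : constantCoeff W = 0 := by
    have h := congrArg constantCoeff hV'
    rw [map_add, hsub0, constantCoeff_interactionPoly, zero_add, map_neg] at h
    exact neg_eq_zero.mp h.symm
  refine ⟨W, hW, by ring, ?_⟩
  -- The pulled-back metric has determinant |det ∂g|² det H, and the expansion of |det ∂g|² is
  -- exactly the formal Jacobian.
  have hdet : formalTaylor MvPolynomial.X (fun w => (metric Φ' w).det) z =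
      (jacobian u).det *
        substPoly u (formalTaylor MvPolynomial.X (fun w => (metric Φ w).det) (g z)) := by
    have hD := contDiffOn_holJacobianDet hg hU
    have hdet : ContDiffOn ℝ ∞ (fun w => (metric Φ w).det) V :=
      contDiffOn_det (contDiffOn_metric hV hΦ)
    have hdet' : ContDiffOn ℝ ∞ (fun w => (metric Φ (g w)).det) U := hdet.comp hgs hgV
    rw [hu, det_jacobian_formalIncrement hg hU hz,
      substPoly_formalIncrement hg hU hV hgV hz hdet,
      ← formalTaylor_mul hU _ hD (contDiffOn_conj hD) hz,
      ← formalTaylor_mul hU _ (hD.mul (contDiffOn_conj hD)) hdet' hz]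
    refine formalTaylor_congr hU _ (fun w hw => ?_) hz
    rw [hΦΦ' w hw, pullbackMetric_eq, det_pullbackForm, holJacobianDet_eq hg hU hw]
  have hexp := substPoly_expSeries u (constantCoeff_interactionPoly (fun w => (Φ w : ℂ)) (g z))
  have hexp' : expSeries (interactionPoly (fun w => (Φ' w : ℂ)) z) =
      substPoly u (expSeries (interactionPoly (fun w => (Φ w : ℂ)) (g z))) * expSeries (-W) := by
    rw [hV', expSeries_add hsub0 (by rw [map_neg, hW, neg_zero]), hexp]
  rw [integrandPoly, integrandPoly, hexp', hdet, map_mul, map_mul, map_mul,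
    substPoly_holIncr hg hU hV hgV hz hf₂, substPoly_antiholIncr hg hU hV hgV hz hf₁]
  ring

theorem gaussian_comp (hg : DifferentiableOn ℂ g U) (hU : IsOpen U) {z : Fin n → ℂ} (hz : z ∈ U)
    (hdet : IsUnit (jacobianAt g z).det) {M M' : Matrix (Fin n) (Fin n) ℂ} (hM : IsPosForm M)
    (hM' : IsPosForm M') (hMM' : M' = pullbackForm M (jacobianAt g z))
    (P : MvPolynomial (Fin n ⊕ Fin n) ℂ) :
    gaussian hM' (constantCoeff (MvPolynomial.aeval (formalIncrement g z) P) *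
      constantCoeff (jacobian (formalIncrement g z)).det) = gaussian hM P := by
  subst hMM'
  refine gaussian_pullbackForm hM hdet hM' fun y => ?_
  rw [map_mul, evalPoly_constantCoeff_aeval hg hU hz, constantCoeff_det_jacobian hg hU hz,
    AlgHom.commutes, Algebra.algebraMap_self_apply]

theorem bulletCoeff_comp (hg : DifferentiableOn ℂ g U) (hU : IsOpen U) (hV : IsOpen V)
    (hgV : Set.MapsTo g U V) {z : Fin n → ℂ} (hz : z ∈ U) (hdet : IsUnit (jacobianAt g z).det)
    {Φ Φ' : (Fin n → ℂ) → ℝ} (hΦ : IsKahlerPotential Φ V) (hΦ' : ContDiffOn ℝ ∞ Φ' U)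
    (hΦΦ' : ∀ z ∈ U, metric Φ' z = pullbackMetric Φ g z) {f₁ f₂ : (Fin n → ℂ) → ℂ}
    (hf₁ : ContDiffOn ℝ ∞ f₁ V) (hf₂ : ContDiffOn ℝ ∞ f₂ V) (m : ℕ) :
    bulletCoeff Φ m f₁ f₂ (g z) =
      bulletCoeff Φ' m (fun w => f₁ (g w)) (fun w => f₂ (g w)) z := by
  have hgs := contDiffOn_of_differentiableOn_complex hU hg
  have hM : IsPosForm (metric Φ (g z)) := isPosForm_of_posDef (hΦ.posDef _ (hgV hz))
  have hMM' : metric Φ' z = pullbackForm (metric Φ (g z)) (jacobianAt g z) := hΦΦ' z hz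
  have hM' : IsPosForm (metric Φ' z) := by
    rw [hMM']
    exact hM.pullbackForm hdet
  obtain ⟨W, hW, hQ, hint⟩ :=
    integrandPoly_comp hg hU hV hgV hz hΦ.smooth hΦ' hΦΦ' hf₁ hf₂
  have hf₁' : ContDiffOn ℝ ∞ (fun w => f₁ (g w)) U := hf₁.comp hgs hgV
  have hf₂' : ContDiffOn ℝ ∞ (fun w => f₂ (g w)) U := hf₂.comp hgs hgV
  -- The constant term |det ∂g(z)|² is a nonzero scalar, and that suffices for a power series to be
  -- a unit.
  have hJ : IsUnit (jacobian (formalIncrement g z)).det := by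
    rw [isUnit_iff_constantCoeff, constantCoeff_det_jacobian hg hU hz]
    exact (hdet.mul (hdet.map (starRingEnd ℂ))).map _
  rw [bulletCoeff_eq_gaussian hV hΦ.smooth hf₁ hf₂ (hgV hz) hM,
    bulletCoeff_eq_gaussian hU hΦ' hf₁' hf₂' hz hM', hint]
  have h := formal_change_of_variables (formalIncrement g z) hJ hW hQ (gaussian hM') (gaussian hM)
    (gaussian_pderiv hM') (gaussian_comp hg hU hz hdet hM hM' hMM') (2 * m)
    (integrandPoly Φ f₁ f₂ (g z))
  rw [h]

/-- By the chain rule the Jacobian matrix of the local inverse is a left inverse. -/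
theorem isUnit_det_jacobianAt {g' : (Fin n → ℂ) → (Fin n → ℂ)} {z : Fin n → ℂ}
    (hg : DifferentiableAt ℂ g z) (hg' : DifferentiableAt ℂ g' (g z))
    (h : ∀ᶠ w in nhds z, g' (g w) = w) : IsUnit (jacobianAt g z).det := by
  have h1 : (fderiv ℂ g' (g z)).comp (fderiv ℂ g z) = ContinuousLinearMap.id ℂ _ := by
    have h2 := (hg'.hasFDerivAt.comp z hg.hasFDerivAt)
    exact (h2.congr_of_eventuallyEq (h.mono fun w hw => hw.symm)).unique (hasFDerivAt_id z)
  have h3 : jacobianAt g' (g z) * jacobianAt g z = 1 := by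
    rw [← Matrix.mulVec_injective.eq_iff]
    ext1 y
    rw [← Matrix.mulVec_mulVec, mulVec_jacobianAt, mulVec_jacobianAt, Matrix.one_mulVec]
    exact congrArg (fun L : (Fin n → ℂ) →L[ℂ] (Fin n → ℂ) => L y) h1
  exact (Matrix.isUnit_iff_isUnit_det _).mp (IsUnit.of_mul_eq_one_right _ h3)

end Functoriality

end FormalKahler
end

/-- Functoriality of `•` under a holomorphic change of coordinates `w = g(z)`, i.e. a biholomorphic
map `g` from the open set `U = g.source` onto the open set `g.target`. The product on the left is
that of the metric with potential `Φ`, the product on the right is that of the same metric written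
in the coordinates `z`, with an arbitrary potential `Φ'` of it on `U`. -/
theorem theorem3p13 {n : ℕ} (V : Set (Fin n → ℂ)) (hV : IsOpen V)
    (Φ : (Fin n → ℂ) → ℝ) (hΦ : FormalKahler.IsKahlerPotential Φ V)
    (g : OpenPartialHomeomorph (Fin n → ℂ) (Fin n → ℂ))
    (hg : DifferentiableOn ℂ g g.source) (hg' : DifferentiableOn ℂ g.symm g.target)
    (hgV : g.target ⊆ V)
    (Φ' : (Fin n → ℂ) → ℝ) (hΦ' : ContDiffOn ℝ ∞ Φ' g.source)
    (hΦΦ' : ∀ z ∈ g.source, FormalKahler.metric Φ' z = FormalKahler.pullbackMetric Φ g z)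
    (f₁ f₂ : PowerSeries ((Fin n → ℂ) → ℂ))
    (hf₁ : FormalKahler.SmoothOn f₁ V) (hf₂ : FormalKahler.SmoothOn f₂ V) :
    ∀ m : ℕ, Set.EqOn
      (PowerSeries.coeff m (FormalKahler.compMap (FormalKahler.bullet Φ f₁ f₂) g))
      (PowerSeries.coeff m
        (FormalKahler.bullet Φ' (FormalKahler.compMap f₁ g) (FormalKahler.compMap f₂ g)))
      g.source := by
  intro m z hz
  have hgV' : Set.MapsTo g g.source V := fun w hw => hgV (g.map_source hw)
  have hdet : IsUnit (FormalKahler.jacobianAt g z).det :=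
    FormalKahler.isUnit_det_jacobianAt (hg.differentiableAt (g.open_source.mem_nhds hz))
      (hg'.differentiableAt (g.open_target.mem_nhds (g.map_source hz)))
      (Filter.eventually_of_mem (g.open_source.mem_nhds hz) fun w hw => g.left_inv hw)
  simp only [FormalKahler.compMap, FormalKahler.bullet, PowerSeries.coeff_mk, Function.comp_apply,
    Finset.sum_apply]
  -- Composition with g acts on each coefficient in ħ separately, so the bilinear extensions agree
  -- term by term.
  refine Finset.sum_congr rfl fun p _ => Finset.sum_congr rfl fun q _ => ?_
  exact FormalKahler.bulletCoeff_comp hg g.open_source hV hgV' hz hdet hΦ hΦ' hΦΦ' (hf₁ _) (hf₂ _) _
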